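/- **Setup.** Let $\xi_1,\dots,\xi_n\in\mathbb Z^d$ be characters of the torus $(\mathbb C^\times)^d$, with Lie algebra $\mathfrak t=\mathbb C^d$, $\mathfrak t_{\mathbb R}=\mathbb R^d$ and cocharacter lattice $Y=\mathbb Z^d$, and let $b_1,\dots,b_n\in\mathbb C$ (flavor parameters). Let $\mathcal A$ be the quantized abelian Coulomb branch: the algebra that is a free $\mathbb C[\mathfrak t]$-module with basis $r^\lambda$, $\lambda\in Y$, with $r^0=1$, $r^\lambda f(x)=f(x+\lambda)\,r^\lambda$ for $f\in\mathbb C[\mathfrak t]$, and $$r^\lambda r^\mu=\prod_{i=1}^n \tilde A_i(\lambda,\mu)\,r^{\lambda+\mu},$$ where, for $p=\xi_i(\lambda)$, $q=\xi_i(\mu)$, we put $\tilde A_i(\lambda,\mu)=1$ if $pq\ge 0$, $\tilde A_i(\lambda,\mu)=\prod_{j=1}^{\min(|p|,|q|)}(\xi_i+b_i+p-j+\tfrac12)$ if $p>0>q$, and $\tilde A_i(\lambda,\mu)=\prod_{j=1}^{\min(|p|,|q|)}(\xi_i+b_i+p+j-\tfrac12)$ if $p<0<q$. Let $\rho$ be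 an antilinear ring automorphism of $\mathcal A$ with $\rho(\mathbb C[\mathfrak t]r^\lambda)\subseteq \mathbb C[\mathfrak t]r^{-\lambda}$ for all $\lambda\in Y$ and $\rho(\alpha)=-\alpha$ for all $\alpha\in\mathfrak t^*\subset\mathbb C[\mathfrak t]$. A *positive trace* is a linear map $T\colon\mathcal A\to\mathbb C$ such that $T(ab)=T(b\,\rho^2(a))$ for all $a,b\in\mathcal A$ and $T(a\rho(a))>0$ for all $a\neq0$. **Corollary 4.4.** Let $T$ be a positive trace. Then there are finitely many distinct non-empty affine subspaces $U$ of $\mathfrak t_{\mathbb R}$ and, for each of them, a function $w_U$ and a vector $v_U$ in the linear part $\vec U$ of $U$ such that for all $R\in\mathbb C[\mathfrak t]$ $$T(R)=\sum_U\ \lim_{\varepsilon\to0^+}\int_{U+i\varepsilon v_U}R(iz)\,w_U(z)\,dz .$$ For each $U$ and $R$ the integrals converge absolutely for all small $\varepsilon>0$, and the limit exists; here $dz$ is the Lebesgue measure of $U$ (a point mass if $U$ is a point). Each $w_U$ is exponentially decaying with at most simple poles on $U$, in the following sense: there are $\delta,c,C>0$ and finitely many pairwise distinct hyperplanes $\{x\in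 U:\ell_k(x)=0\}$ of $U$, where $\ell_k$ is a non-constant real affine function on $U$ whose linear part does not vanish at $v_U$, such that on the tube $\{x+iy: x\in U,\ y\in\vec U,\ \|y\|<\delta\}$ in the complexification of $U$ the function $w_U\prod_k\ell_k$ extends to a holomorphic function $g$ with $|g(x+iy)|\le Ce^{-c\|x\|}$. (If there are no poles on $U$, the corresponding term is just $\int_U R(iz)w_U(z)\,dz$.) -/

import Mathlib

open scoped ComplexOrder Topology

noncomputable section

namespace AbelianCoulomb

/-! ### The quantized abelian Coulomb branch

The torus is `(ℂˣ)^d`. Its cocharacter lattice `Y` and its character lattice are both `Fin d → ℤ`, and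
`ℂ[𝔱] = S(𝔱*)` is `MvPolynomial (Fin d) ℂ`. -/

/-- The value `χ(l)` of a character `χ` on a cocharacter `l`. -/
def pairing {d : ℕ} (χ l : Fin d → ℤ) : ℤ := ∑ k, χ k * l k

/-- The character `χ`, as a linear polynomial on `𝔱`. -/
def linearForm {d : ℕ} (χ : Fin d → ℤ) : MvPolynomial (Fin d) ℂ :=
  ∑ k, MvPolynomial.C (χ k : ℂ) * MvPolynomial.X k

/-- The shift automorphism `(S_l f)(x) = f (x + l)` of `ℂ[𝔱]`. -/
def shift {d : ℕ} (l : Fin d → ℤ) : MvPolynomial (Fin d) ℂ →ₐ[ℂ] MvPolynomial (Fin d) ℂ :=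
  MvPolynomial.aeval fun k => MvPolynomial.X k + MvPolynomial.C (l k : ℂ)

/-- `d(p, q)`: zero if `p` and `q` have the same sign, and `min |p| |q|` otherwise. -/
def cancellation (p q : ℤ) : ℕ := if 0 ≤ p * q then 0 else min p.natAbs q.natAbs

/-- The structure constant attached to one weight; `x` stands for `ξ_i + b_i`, and `p`, `q` for the
values of `ξ_i` on the two cocharacters:
`∏_{j=1}^{d(p,q)} (x + p - j + 1/2)` if `p ≥ 0 ≥ q`, `∏_{j=1}^{d(p,q)} (x + p + j - 1/2)` if
`p ≤ 0 ≤ q`, and `1` if `p` and `q` have the same sign. -/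
def factor {d : ℕ} (x : MvPolynomial (Fin d) ℂ) (p q : ℤ) : MvPolynomial (Fin d) ℂ :=
  ∏ j ∈ Finset.Icc 1 (cancellation p q),
    (x + MvPolynomial.C (if 0 ≤ p then (p : ℂ) - (j : ℂ) + 1 / 2 else (p : ℂ) + (j : ℂ) - 1 / 2))

/-- The structure constant in `r^l r^m = (structureConstant ξ b l m) r^(l+m)`. -/
def structureConstant {d n : ℕ} (ξ : Fin n → Fin d → ℤ) (b : Fin n → ℂ) (l m : Fin d → ℤ) :
    MvPolynomial (Fin d) ℂ :=
  ∏ i, factor (linearForm (ξ i) + MvPolynomial.C (b i)) (pairing (ξ i) l) (pairing (ξ i) m)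

/-- The quantized abelian Coulomb branch with weights `ξ_1, …, ξ_n` and flavor parameters
`b_1, …, b_n`: the free `ℂ[𝔱]`-module on the elements `r^l`, `l ∈ Y`. The finitely supported function
`a` stands for `∑_l a(l) r^l`. -/
def CoulombBranch {d n : ℕ} (_ξ : Fin n → Fin d → ℤ) (_b : Fin n → ℂ) : Type :=
  (Fin d → ℤ) →₀ MvPolynomial (Fin d) ℂ

section Ring

variable {d n : ℕ} {ξ : Fin n → Fin d → ℤ} {b : Fin n → ℂ}

instance : AddCommGroup (CoulombBranch ξ b) :=
  inferInstanceAs (AddCommGroup ((Fin d → ℤ) →₀ MvPolynomial (Fin d) ℂ))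

instance : Module ℂ (CoulombBranch ξ b) :=
  inferInstanceAs (Module ℂ ((Fin d → ℤ) →₀ MvPolynomial (Fin d) ℂ))

/-- The element `f r^l`. -/
def mono (ξ : Fin n → Fin d → ℤ) (b : Fin n → ℂ) (l : Fin d → ℤ) (f : MvPolynomial (Fin d) ℂ) :
    CoulombBranch ξ b :=
  Finsupp.single l f

/-- `(f r^l) (h r^m) = f S_l(h) (structureConstant l m) r^(l+m)`, extended biadditively. In
particular `r^l h = S_l(h) r^l`, so that `[r^l, α] = α(l) r^l` for `α ∈ 𝔱*`. -/
instance : Mul (CoulombBranch ξ b) where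
  mul x y := Finsupp.sum x fun l f => Finsupp.sum y fun m h =>
    mono ξ b (l + m) (f * shift l h * structureConstant ξ b l m)

instance : One (CoulombBranch ξ b) where
  one := mono ξ b 0 1

/-- The inclusion of `ℂ[𝔱]` in the algebra, `R ↦ R r^0`. -/
def ofPoly (ξ : Fin n → Fin d → ℤ) (b : Fin n → ℂ) (R : MvPolynomial (Fin d) ℂ) : CoulombBranch ξ b :=
  mono ξ b 0 R

/-! The algebra axioms. -/

/-- The integers `k` such that `k + 1/2` lies between `p` and `q`. -/
def between (p q : ℤ) : Finset ℤ := Finset.Ico (min p q) (max p q)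

theorem factor_eq (x : MvPolynomial (Fin d) ℂ) (p q : ℤ) :
    factor x p q = ∏ k ∈ between 0 p ∩ between p (p + q), (x + MvPolynomial.C ((k : ℂ) + 1 / 2)) := by
  unfold factor cancellation
  by_cases hs : 0 ≤ p * q
  · have : between 0 p ∩ between p (p + q) = ∅ := by
      ext k
      simp only [between, Finset.mem_inter, Finset.mem_Ico, Finset.notMem_empty, iff_false]
      rcases lt_trichotomy p 0 with hp | hp | hp
      · have : q ≤ 0 := by nlinarith
        omega
      · omega
      · have : 0 ≤ q := by nlinarith
        omega
    rw [if_pos hs, this]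
    simp
  · rw [if_neg hs]
    push Not at hs
    by_cases hp : 0 ≤ p
    · have hp' : 0 < p := lt_of_le_of_ne hp (by rintro rfl; simp at hs)
      have hq : q < 0 := by nlinarith
      simp only [if_pos hp]
      refine Finset.prod_bij' (fun j _ => p - (j : ℤ)) (fun k _ => (p - k).toNat) ?_ ?_ ?_ ?_ ?_
      · intro j hj
        simp only [between, Finset.mem_inter, Finset.mem_Ico, Finset.mem_Icc] at hj ⊢
        omega
      · intro j hj
        simp only [between, Finset.mem_inter, Finset.mem_Ico, Finset.mem_Icc] at hj ⊢
        omega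
      · intro j hj
        simp only [Finset.mem_Icc] at hj
        omega
      · intro j hj
        simp only [between, Finset.mem_inter, Finset.mem_Ico] at hj
        omega
      · intro j _
        push_cast
        rfl
    · push Not at hp
      have hq : 0 < q := by nlinarith
      simp only [if_neg (not_le.mpr hp)]
      refine Finset.prod_bij' (fun j _ => p + (j : ℤ) - 1) (fun k _ => (k - p + 1).toNat)
        ?_ ?_ ?_ ?_ ?_
      · intro j hj
        simp only [between, Finset.mem_inter, Finset.mem_Ico, Finset.mem_Icc] at hj ⊢
        omega
      · intro j hj
        simp only [between, Finset.mem_inter, Finset.mem_Ico, Finset.mem_Icc] at hj ⊢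
        omega
      · intro j hj
        simp only [Finset.mem_Icc] at hj
        omega
      · intro j hj
        simp only [between, Finset.mem_inter, Finset.mem_Ico] at hj
        omega
      · intro j _
        push_cast
        congr 2
        ring

theorem factor_shift (x : MvPolynomial (Fin d) ℂ) (p q s : ℤ) :
    factor (x + MvPolynomial.C (p : ℂ)) q s =
      ∏ k ∈ between p (p + q) ∩ between (p + q) (p + q + s),
        (x + MvPolynomial.C ((k : ℂ) + 1 / 2)) := by
  rw [factor_eq]
  refine Finset.prod_bij' (fun k _ => p + k) (fun k _ => k - p) ?_ ?_ ?_ ?_ ?_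
  · intro j hj
    simp only [between, Finset.mem_inter, Finset.mem_Ico] at hj ⊢
    omega
  · intro j hj
    simp only [between, Finset.mem_inter, Finset.mem_Ico] at hj ⊢
    omega
  · intro j _
    ring
  · intro j _
    ring
  · intro j _
    push_cast
    simp only [map_add]
    ring

theorem factor_cocycle (x : MvPolynomial (Fin d) ℂ) (p q s : ℤ) :
    factor x p q * factor x (p + q) s = factor (x + MvPolynomial.C (p : ℂ)) q s * factor x p (q + s) := by
  rw [factor_shift, factor_eq, factor_eq, factor_eq, ← Finset.prod_union, ← Finset.prod_union]
  · congr 1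
    ext k
    simp only [between, Finset.mem_union, Finset.mem_inter, Finset.mem_Ico]
    omega
  · rw [Finset.disjoint_left]
    intro k
    simp only [between, Finset.mem_inter, Finset.mem_Ico]
    omega
  · rw [Finset.disjoint_left]
    intro k
    simp only [between, Finset.mem_inter, Finset.mem_Ico]
    omega

theorem pairing_add (χ l m : Fin d → ℤ) : pairing χ (l + m) = pairing χ l + pairing χ m := by
  simp [pairing, mul_add, Finset.sum_add_distrib]

theorem shift_linearForm (l χ : Fin d → ℤ) :
    shift l (linearForm χ) = linearForm χ + MvPolynomial.C (pairing χ l : ℂ) := by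
  simp [shift, linearForm, pairing, mul_add, Finset.sum_add_distrib]

theorem shift_add (l m : Fin d → ℤ) (f : MvPolynomial (Fin d) ℂ) :
    shift l (shift m f) = shift (l + m) f := by
  have : (shift l).comp (shift m) = shift (l + m) := by
    refine MvPolynomial.algHom_ext fun k => ?_
    simp [shift]
    ring
  rw [← this]
  rfl

theorem shift_zero (f : MvPolynomial (Fin d) ℂ) : shift 0 f = f := by
  have : shift (0 : Fin d → ℤ) = AlgHom.id ℂ _ := by
    refine MvPolynomial.algHom_ext fun k => ?_
    simp [shift]
  rw [this]
  rfl

theorem structureConstant_cocycle (l m k : Fin d → ℤ) :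
    structureConstant ξ b l m * structureConstant ξ b (l + m) k =
      shift l (structureConstant ξ b m k) * structureConstant ξ b l (m + k) := by
  unfold structureConstant
  rw [map_prod, ← Finset.prod_mul_distrib, ← Finset.prod_mul_distrib]
  refine Finset.prod_congr rfl fun i _ => ?_
  have h : shift l (factor (linearForm (ξ i) + MvPolynomial.C (b i)) (pairing (ξ i) m)
      (pairing (ξ i) k)) = factor (linearForm (ξ i) + MvPolynomial.C (b i) +
        MvPolynomial.C (pairing (ξ i) l : ℂ)) (pairing (ξ i) m) (pairing (ξ i) k) := by
    unfold factor
    rw [map_prod]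
    refine Finset.prod_congr rfl fun j _ => ?_
    have hC : ∀ c : ℂ, shift l (MvPolynomial.C c) = MvPolynomial.C c := fun c => by
      simp [shift, MvPolynomial.algebraMap_eq]
    rw [map_add, map_add, shift_linearForm, hC, hC]
    ring
  rw [h, pairing_add, pairing_add, factor_cocycle]

theorem structureConstant_zero_left (m : Fin d → ℤ) : structureConstant ξ b 0 m = 1 := by
  simp [structureConstant, factor, cancellation, pairing]

theorem structureConstant_zero_right (m : Fin d → ℤ) : structureConstant ξ b m 0 = 1 := by
  simp [structureConstant, factor, cancellation, pairing]

theorem mono_zero (l : Fin d → ℤ) : mono ξ b l 0 = 0 := Finsupp.single_zero l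

theorem mono_add (l : Fin d → ℤ) (f h : MvPolynomial (Fin d) ℂ) :
    mono ξ b l (f + h) = mono ξ b l f + mono ξ b l h := Finsupp.single_add l f h

theorem smul_mono (c : ℂ) (l : Fin d → ℤ) (f : MvPolynomial (Fin d) ℂ) :
    c • mono ξ b l f = mono ξ b l (c • f) := Finsupp.smul_single c l f

theorem mono_mul_mono (l m : Fin d → ℤ) (f h : MvPolynomial (Fin d) ℂ) :
    mono ξ b l f * mono ξ b m h = mono ξ b (l + m) (f * shift l h * structureConstant ξ b l m) := by
  change Finsupp.sum (Finsupp.single l f) (fun l f => Finsupp.sum (Finsupp.single m h) fun m h =>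
    mono ξ b (l + m) (f * shift l h * structureConstant ξ b l m)) = _
  rw [Finsupp.sum_single_index, Finsupp.sum_single_index]
  · simp [mono_zero]
  · simp [mono_zero]

theorem right_distrib' (x y z : CoulombBranch ξ b) : (x + y) * z = x * z + y * z := by
  refine Finsupp.sum_add_index' (fun l => ?_) (fun l f f' => ?_)
  · simp only [zero_mul, mono_zero]
    exact Finset.sum_const_zero
  · simp only [add_mul, mono_add]
    exact Finsupp.sum_add

theorem left_distrib' (x y z : CoulombBranch ξ b) : x * (y + z) = x * y + x * z := by
  refine Eq.trans ?_ Finsupp.sum_add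
  refine Finsupp.sum_congr fun l _ => ?_
  refine Finsupp.sum_add_index' (fun m => ?_) (fun m f f' => ?_)
  · simp [mono_zero]
  · simp only [map_add, mul_add, add_mul, mono_add]

theorem zero_mul' (x : CoulombBranch ξ b) : 0 * x = 0 := Finsupp.sum_zero_index

theorem mul_zero' (x : CoulombBranch ξ b) : x * 0 = 0 := by
  have h := left_distrib' x 0 0
  rw [add_zero] at h
  exact left_eq_add.mp h

theorem induct {p : CoulombBranch ξ b → Prop} (x : CoulombBranch ξ b) (h0 : p 0)
    (hadd : ∀ x y, p x → p y → p (x + y)) (hmono : ∀ l f, p (mono ξ b l f)) : p x :=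
  Finsupp.induction_linear x h0 hadd hmono

theorem mul_assoc' (x y z : CoulombBranch ξ b) : x * y * z = x * (y * z) := by
  induction x using induct with
  | h0 => simp only [zero_mul']
  | hadd x x' h h' => simp only [right_distrib', h, h']
  | hmono l f =>
  induction y using induct with
  | h0 => simp only [zero_mul', mul_zero']
  | hadd x x' h h' => simp only [right_distrib', left_distrib', h, h']
  | hmono m g =>
  induction z using induct with
  | h0 => simp only [mul_zero']
  | hadd x x' h h' => simp only [left_distrib', h, h']
  | hmono k h =>
  simp only [mono_mul_mono, add_assoc, map_mul, shift_add]
  refine congrArg (mono ξ b (l + (m + k))) ?_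
  have e := structureConstant_cocycle (ξ := ξ) (b := b) l m k
  calc f * shift l g * structureConstant ξ b l m * shift (l + m) h * structureConstant ξ b (l + m) k
      = f * shift l g * shift (l + m) h *
          (structureConstant ξ b l m * structureConstant ξ b (l + m) k) := by ac_rfl
    _ = f * shift l g * shift (l + m) h *
          (shift l (structureConstant ξ b m k) * structureConstant ξ b l (m + k)) := by rw [e]
    _ = _ := by ac_rfl

theorem one_mul' (x : CoulombBranch ξ b) : 1 * x = x := by
  induction x using induct with
  | h0 => exact mul_zero' _
  | hadd x y h h' => rw [left_distrib', h, h']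
  | hmono l f =>
    change mono ξ b 0 1 * _ = _
    rw [mono_mul_mono, shift_zero, structureConstant_zero_left, zero_add, one_mul, mul_one]

theorem mul_one' (x : CoulombBranch ξ b) : x * 1 = x := by
  induction x using induct with
  | h0 => exact zero_mul' _
  | hadd x y h h' => rw [right_distrib', h, h']
  | hmono l f =>
    change _ * mono ξ b 0 1 = _
    rw [mono_mul_mono, map_one, structureConstant_zero_right, add_zero, mul_one, mul_one]

instance : Ring (CoulombBranch ξ b) where
  __ := (inferInstance : AddCommGroup (CoulombBranch ξ b))
  mul_assoc := mul_assoc'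
  one_mul := one_mul'
  mul_one := mul_one'
  left_distrib := left_distrib'
  right_distrib := right_distrib'
  zero_mul := zero_mul'
  mul_zero := mul_zero'

theorem smul_mul' (c : ℂ) (x y : CoulombBranch ξ b) : c • x * y = c • (x * y) := by
  induction x using induct with
  | h0 => simp only [smul_zero, zero_mul]
  | hadd x x' h h' => simp only [smul_add, add_mul, h, h']
  | hmono l f =>
  induction y using induct with
  | h0 => simp only [smul_zero, mul_zero]
  | hadd x x' h h' => simp only [smul_add, mul_add, h, h']
  | hmono m g => simp only [smul_mono, mono_mul_mono, smul_mul_assoc]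

theorem mul_smul' (c : ℂ) (x y : CoulombBranch ξ b) : x * c • y = c • (x * y) := by
  induction x using induct with
  | h0 => simp only [smul_zero, zero_mul]
  | hadd x x' h h' => simp only [smul_add, add_mul, h, h']
  | hmono l f =>
  induction y using induct with
  | h0 => simp only [smul_zero, mul_zero]
  | hadd x x' h h' => simp only [smul_add, mul_add, h, h']
  | hmono m g => simp only [smul_mono, mono_mul_mono, smul_mul_assoc, map_smul, mul_smul_comm]

instance : Algebra ℂ (CoulombBranch ξ b) := Algebra.ofModule smul_mul' mul_smul'

end Ring

/-! ### Positive traces -/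

/-- The antilinear automorphisms under consideration: antilinear ring automorphisms which send each
weight space `ℂ[𝔱] r^l` to the weight space `ℂ[𝔱] r^(-l)` of opposite weight, and which act as minus
the identity on `𝔱* ⊆ ℂ[𝔱]`. -/
structure IsAdmissible {d n : ℕ} {ξ : Fin n → Fin d → ℤ} {b : Fin n → ℂ}
    (ρ : CoulombBranch ξ b ≃+* CoulombBranch ξ b) : Prop where
  antilinear : ∀ (c : ℂ) (a : CoulombBranch ξ b), ρ (c • a) = (starRingEnd ℂ) c • ρ a
  opposite : ∀ (l : Fin d → ℤ) (f : MvPolynomial (Fin d) ℂ),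
    ∃ h : MvPolynomial (Fin d) ℂ, ρ (mono ξ b l f) = mono ξ b (-l) h
  neg_coord : ∀ k : Fin d, ρ (ofPoly ξ b (MvPolynomial.X k)) = -ofPoly ξ b (MvPolynomial.X k)

/-- A positive trace for `ρ`: a `ρ²`-twisted trace `T` with `T (a ρ(a)) > 0` for all `a ≠ 0`
(in particular these numbers are real). -/
structure IsPositiveTrace {d n : ℕ} {ξ : Fin n → Fin d → ℤ} {b : Fin n → ℂ}
    (ρ : CoulombBranch ξ b ≃+* CoulombBranch ξ b) (T : CoulombBranch ξ b →ₗ[ℂ] ℂ) : Prop where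
  twisted : ∀ x y : CoulombBranch ξ b, T (x * y) = T (y * ρ (ρ x))
  pos : ∀ a : CoulombBranch ξ b, a ≠ 0 → 0 < T (a * ρ a)

/-! ### Weights on affine subspaces of `𝔱_ℝ = ℝ^d` and their integrals -/

/-- The point `x + i y` of `ℂ^d`. -/
def complexPoint {d : ℕ} (x y : EuclideanSpace ℝ (Fin d)) : Fin d → ℂ :=
  fun k => (x k : ℂ) + Complex.I * (y k : ℂ)

/-- The tube of radius `δ` around `U` in its complexification `U_ℂ`: the points `x + i y` with
`x ∈ U` and `y` in the direction of `U`, `‖y‖ < δ`. It is relatively open in the complex affine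
subspace `U_ℂ`, so that `DifferentiableOn ℂ g (tube U δ)` says that `g` is holomorphic on it. -/
def tube {d : ℕ} (U : AffineSubspace ℝ (EuclideanSpace ℝ (Fin d))) (δ : ℝ) : Set (Fin d → ℂ) :=
  {z | ∃ x ∈ U, ∃ y ∈ U.direction, ‖y‖ < δ ∧ z = complexPoint x y}

/-- The complex affine function `z ↦ ⟨α, z⟩ - s`, for a pair `h = (α, s)`. -/
def affineForm {d : ℕ} (h : EuclideanSpace ℝ (Fin d) × ℝ) (z : Fin d → ℂ) : ℂ :=
  ∑ k, (h.1 k : ℂ) * z k - (h.2 : ℂ)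

/-- `w` is an exponentially decaying meromorphic function on a tube around `U` in `U_ℂ`, which has at
most simple poles, along finitely many hyperplanes of `U`, and `v` is a direction in `U` transversal
to each of them.

`H` lists the polar hyperplanes `{x ∈ U | ⟨α, x⟩ = s}`, each of them once; `w` times the product of
their equations is holomorphic and exponentially decaying on the tube. -/
def IsWeight {d : ℕ} (U : AffineSubspace ℝ (EuclideanSpace ℝ (Fin d))) (w : (Fin d → ℂ) → ℂ)
    (v : EuclideanSpace ℝ (Fin d)) : Prop :=
  v ∈ U.direction ∧
  ∃ H : Finset (EuclideanSpace ℝ (Fin d) × ℝ),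
    (∀ h ∈ H, h.1 ∈ U.direction ∧ inner ℝ h.1 v ≠ 0) ∧
    (∀ h ∈ H, ∀ h' ∈ H, h ≠ h' →
      {x : EuclideanSpace ℝ (Fin d) | x ∈ U ∧ inner ℝ h.1 x = h.2} ≠
        {x : EuclideanSpace ℝ (Fin d) | x ∈ U ∧ inner ℝ h'.1 x = h'.2}) ∧
    ∃ δ : ℝ, 0 < δ ∧ ∃ g : (Fin d → ℂ) → ℂ,
      DifferentiableOn ℂ g (tube U δ) ∧
      (∃ C c : ℝ, 0 < c ∧ ∀ x ∈ U, ∀ y ∈ U.direction, ‖y‖ < δ →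
        ‖g (complexPoint x y)‖ ≤ C * Real.exp (-c * ‖x‖)) ∧
      ∀ z ∈ tube U δ, (∀ h ∈ H, affineForm h z ≠ 0) → w z * ∏ h ∈ H, affineForm h z = g z

/-- `HasContourIntegral U w v R I` says that `I = lim_{ε → 0+} ∫_{U + iεv} R(iz) w(z) dz`, where the
integrals converge absolutely for all small `ε > 0`. Here `dz` is the Lebesgue measure of `U`
(the `volume` of the Euclidean space `U.direction`; a point mass if `U` is a point), and `U` is
written as `p + U.direction`; the choice of `p ∈ U` does not matter. -/
def HasContourIntegral {d : ℕ} (U : AffineSubspace ℝ (EuclideanSpace ℝ (Fin d)))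
    (w : (Fin d → ℂ) → ℂ) (v : EuclideanSpace ℝ (Fin d)) (R : MvPolynomial (Fin d) ℂ) (I : ℂ) :
    Prop :=
  ∃ p ∈ U,
    let F : ℝ → U.direction → ℂ := fun ε u =>
      let z : Fin d → ℂ := complexPoint (p + (u : EuclideanSpace ℝ (Fin d))) (ε • v)
      MvPolynomial.eval (fun k => Complex.I * z k) R * w z
    (∀ᶠ ε in 𝓝[>] (0 : ℝ), MeasureTheory.Integrable (F ε)) ∧
    Filter.Tendsto (fun ε => ∫ u, F ε u) (𝓝[>] (0 : ℝ)) (𝓝 I)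

end AbelianCoulomb

end

/-! On `ℂ[𝔱]` the trace is a functional with two properties. Since `ρ` acts there as complex
conjugation on the imaginary points `i z`, `T` is positive on `|f|²`, as an integral over `iℝ^d`
would be. Since `ρ²` multiplies `r^l` by a scalar `χ(l)`, the twisted trace identity for `r^l` and
`g r^(-l)` reads `T(S_l(g D_l)) = χ(l) T(g D_l)`, where `D_l = r^(-l) r^l` is a product of factors
`ξ_i + b_i + k + 1/2` with `ξ_i(l) ≠ 0`.

Growth (`exists_growth`). The relation forces `|T(x^γ)| ≤ A K^N N!`, `N = deg γ`. In top degree it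
says that `T` kills multiples of the leading term of `D_l` (if `χ(l) ≠ 1`), or derivatives along `l`
of such multiples (if `χ(l) = 1`), up to an error which, given the bound in lower degrees, is
`O(1/K)` times the wanted bound. Euler's identity and a downward induction on sets of weights remove
the leading terms. So `T(x^γ)` itself is such an error, and for large `K` the bound propagates from
degree to degree.

Measure (`exists_trace_measure`). Factorial growth makes every polynomial an analytic vector for the
multiplications by coordinates on the GNS space. They are therefore strong limits of commuting
bounded self-adjoint operators, and the spectral theorem gives a measure `μ` with exponential
moments such that `T(R) = ∫ R(iz) dμ(z)`. Analytic continuation turns the relation between moments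
into one between Fourier–Laplace transforms: the transform of `S_l(g D_l) μ` is `χ(l)` times that of
`g D_l μ`, times `exp(-⟨t + iη, l⟩)`.

Densities (`exists_isWeight_stratum`). A factor of `D_l` vanishes at `i z` only if `⟨ξ_i, z⟩ = -Im
b_i`. Group the points `z` into strata by the set `I` of weights for which this holds; the stratum
of `I` is dense in a flat `U` if it is not empty. Shift relations restrict to `U` for the `l`
annihilated by the weights in `I` (`ShiftRelation.restrict`), and these `l` span the direction of
`U`. Hence a product of factors `D_l`, times its conjugate, makes the transform of `μ|_U` decay
exponentially in all directions of `U`. On the stratum these factors have no zeros, and each of them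
can be divided out without losing the decay (`HasDecay.of_affine_mul`). Fourier inversion then gives
a holomorphic, exponentially decaying density (`HasDecay.exists_density`).

Summing over the nonempty strata proves the theorem, with all `w_U` free of poles on `U` and all
`v_U = 0`. -/

noncomputable section

namespace AbelianCoulomb

/-! ### The functional on polynomials attached to a positive trace -/

section Algebra

variable {d n : ℕ} {ξ : Fin n → Fin d → ℤ} {b : Fin n → ℂ}

/-- The antilinear involution of `ℂ[𝔱]` which conjugates coefficients and sends `x` to `-x`. -/
def polyStar {d : ℕ} : MvPolynomial (Fin d) ℂ →+* MvPolynomial (Fin d) ℂ :=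
  MvPolynomial.eval₂Hom (MvPolynomial.C.comp (starRingEnd ℂ)) fun k => -MvPolynomial.X k

/-- The coefficients of the structure constant `r^(-l) r^l`. -/
def descent (ξ : Fin n → Fin d → ℤ) (b : Fin n → ℂ) (l : Fin d → ℤ) : MvPolynomial (Fin d) ℂ :=
  structureConstant ξ b (-l) l

theorem polyStar_C (c : ℂ) : polyStar (d := d) (MvPolynomial.C c) =
    MvPolynomial.C (starRingEnd ℂ c) := by simp [polyStar]

theorem polyStar_X (k : Fin d) : polyStar (MvPolynomial.X k) = -MvPolynomial.X k := by
  simp [polyStar]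

theorem polyStar_polyStar (f : MvPolynomial (Fin d) ℂ) : polyStar (polyStar f) = f := by
  induction f using MvPolynomial.induction_on with
  | C a => simp [polyStar_C]
  | add p q hp hq => rw [map_add, map_add, hp, hq]
  | mul_X p k hp => rw [map_mul, map_mul, hp, polyStar_X, map_neg, polyStar_X, neg_neg]

theorem ofPoly_mul_mono (f g : MvPolynomial (Fin d) ℂ) (l : Fin d → ℤ) :
    ofPoly ξ b f * mono ξ b l g = mono ξ b l (f * g) := by
  rw [ofPoly, mono_mul_mono, shift_zero, structureConstant_zero_left, zero_add, mul_one]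

theorem ofPoly_mul (f g : MvPolynomial (Fin d) ℂ) :
    ofPoly ξ b (f * g) = ofPoly ξ b f * ofPoly ξ b g := by
  exact (ofPoly_mul_mono f g 0).symm

theorem ofPoly_add (f g : MvPolynomial (Fin d) ℂ) :
    ofPoly ξ b (f + g) = ofPoly ξ b f + ofPoly ξ b g := mono_add 0 f g

theorem ofPoly_smul (c : ℂ) (f : MvPolynomial (Fin d) ℂ) :
    ofPoly ξ b (c • f) = c • ofPoly ξ b f := (smul_mono c 0 f).symm

theorem ofPoly_ne_zero {f : MvPolynomial (Fin d) ℂ} (hf : f ≠ 0) : ofPoly ξ b f ≠ 0 :=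
  fun h => hf (Finsupp.single_eq_zero.mp h)

/-- The restriction of a functional to `ℂ[𝔱]`. -/
def polyPart (T : CoulombBranch ξ b →ₗ[ℂ] ℂ) : MvPolynomial (Fin d) ℂ →ₗ[ℂ] ℂ where
  toFun f := T (ofPoly ξ b f)
  map_add' f g := by rw [ofPoly_add, map_add]
  map_smul' c f := by rw [ofPoly_smul, map_smul]; rfl

theorem map_ofPoly {ρ : CoulombBranch ξ b ≃+* CoulombBranch ξ b} (hρ : IsAdmissible ρ)
    (f : MvPolynomial (Fin d) ℂ) : ρ (ofPoly ξ b f) = ofPoly ξ b (polyStar f) := by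
  induction f using MvPolynomial.induction_on with
  | C a =>
    have h1 : ofPoly ξ b (MvPolynomial.C a) = a • (1 : CoulombBranch ξ b) := by
      change _ = a • mono ξ b 0 1
      rw [smul_mono, MvPolynomial.smul_eq_C_mul, mul_one]; rfl
    have h2 : ofPoly ξ b (MvPolynomial.C (starRingEnd ℂ a)) =
        (starRingEnd ℂ a) • (1 : CoulombBranch ξ b) := by
      change _ = _ • mono ξ b 0 1
      rw [smul_mono, MvPolynomial.smul_eq_C_mul, mul_one]; rfl
    rw [polyStar_C, h1, hρ.antilinear, map_one, h2]
  | add p q hp hq => rw [ofPoly_add, map_add, hp, hq, map_add, ofPoly_add]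
  | mul_X p k hp =>
    have : ofPoly ξ b (-MvPolynomial.X k) = -ofPoly ξ b (MvPolynomial.X k) := by
      rw [← neg_one_smul ℂ, ofPoly_smul, neg_one_smul]
    rw [ofPoly_mul, map_mul, hp, hρ.neg_coord, map_mul, polyStar_X, ofPoly_mul, this]

/-- `ρ²` fixes `ℂ[𝔱]` and preserves weights, so on `ℂ[𝔱] r^l` it is multiplication by a polynomial
`u_l`. By surjectivity `u_l` is a unit of `ℂ[𝔱]`, hence constant. -/
theorem exists_scalar_square {ρ : CoulombBranch ξ b ≃+* CoulombBranch ξ b} (hρ : IsAdmissible ρ)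
    (l : Fin d → ℤ) :
    ∃ c : ℂ, ρ (ρ (mono ξ b l 1)) = mono ξ b l (MvPolynomial.C c) := by
  have h0 : ∀ l f, ∃ h, ρ (ρ (mono ξ b l f)) = mono ξ b l h := by
    intro l f
    obtain ⟨h, hh⟩ := hρ.opposite l f
    obtain ⟨h', hh'⟩ := hρ.opposite (-l) h
    exact ⟨h', by rw [hh, hh', neg_neg]⟩
  choose u hu using fun l => h0 l 1
  have h1 : ∀ l f, ρ (ρ (mono ξ b l f)) = mono ξ b l (f * u l) := by
    intro l f
    have : mono ξ b l f = ofPoly ξ b f * mono ξ b l 1 := by rw [ofPoly_mul_mono, mul_one]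
    rw [this, map_mul, map_mul, map_ofPoly hρ, map_ofPoly hρ, polyStar_polyStar, hu,
      ofPoly_mul_mono]
  have h2 : ∀ a : CoulombBranch ξ b,
      (show (Fin d → ℤ) →₀ MvPolynomial (Fin d) ℂ from ρ (ρ a)) l =
      (show (Fin d → ℤ) →₀ MvPolynomial (Fin d) ℂ from a) l * u l := by
    intro a
    induction a using induct with
    | h0 => rw [map_zero, map_zero]; exact (zero_mul _).symm
    | hadd x y hx hy =>
      rw [map_add, map_add]
      refine (congrArg₂ (· + ·) hx hy).trans ?_
      exact (add_mul _ _ _).symm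
    | hmono m f =>
      rw [h1]
      change Finsupp.single m (f * u m) l = Finsupp.single m f l * u l
      by_cases hm : m = l
      · subst hm; simp
      · simp [Finsupp.single_eq_of_ne' hm]
  have h3 := h2 (ρ.symm (ρ.symm (mono ξ b l 1)))
  rw [RingEquiv.apply_symm_apply, RingEquiv.apply_symm_apply] at h3
  change Finsupp.single l (1 : MvPolynomial (Fin d) ℂ) l = _ at h3
  rw [Finsupp.single_eq_same] at h3
  have h4 : IsUnit (u l) := IsUnit.of_mul_eq_one_right _ h3.symm
  obtain ⟨c, -, hc⟩ := MvPolynomial.isUnit_iff_eq_C_of_isReduced.mp h4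
  exact ⟨c, by rw [hu, hc]⟩

/-- Associativity of `r^l r^(-l) r^l`. -/
theorem shift_descent (l : Fin d → ℤ) : shift l (descent ξ b l) = descent ξ b (-l) := by
  have h := structureConstant_cocycle (ξ := ξ) (b := b) l (-l) l
  rw [add_neg_cancel, neg_add_cancel, structureConstant_zero_left, structureConstant_zero_right,
    mul_one, mul_one] at h
  rw [descent, descent, neg_neg, h]

/-- The twisted trace identity for the pair `r^l`, `g r^(-l)`. All that follows uses only this
relation and `polyPart_pos`. -/
theorem exists_trace_relation {ρ : CoulombBranch ξ b ≃+* CoulombBranch ξ b} (hρ : IsAdmissible ρ)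
    {T : CoulombBranch ξ b →ₗ[ℂ] ℂ} (hT : IsPositiveTrace ρ T) :
    ∃ χ : (Fin d → ℤ) → ℂ, ∀ l (g : MvPolynomial (Fin d) ℂ),
      polyPart T (shift l (g * descent ξ b l)) = χ l * polyPart T (g * descent ξ b l) := by
  choose χ hχ using exists_scalar_square hρ
  refine ⟨χ, fun l g => ?_⟩
  have h := hT.twisted (mono ξ b l 1) (mono ξ b (-l) g)
  rw [hχ, mono_mul_mono, mono_mul_mono, add_neg_cancel, neg_add_cancel, one_mul] at h
  have hC : shift (-l) (MvPolynomial.C (χ l)) = MvPolynomial.C (χ l) := by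
    simp [shift, MvPolynomial.algebraMap_eq]
  have e : structureConstant ξ b l (-l) = descent ξ b (-l) := by rw [descent, neg_neg]
  rw [hC, e] at h
  rw [map_mul, shift_descent]
  change T (ofPoly ξ b _) = _ * T (ofPoly ξ b _)
  refine h.trans ?_
  change T (ofPoly ξ b _) = _
  rw [← smul_eq_mul (χ l), ← map_smul, ← ofPoly_smul, MvPolynomial.smul_eq_C_mul]
  congr 2
  rw [descent]
  ring

theorem polyPart_pos {ρ : CoulombBranch ξ b ≃+* CoulombBranch ξ b} (hρ : IsAdmissible ρ)
    {T : CoulombBranch ξ b →ₗ[ℂ] ℂ} (hT : IsPositiveTrace ρ T) {f : MvPolynomial (Fin d) ℂ}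
    (hf : f ≠ 0) : 0 < polyPart T (f * polyStar f) := by
  have h := hT.pos (ofPoly ξ b f) (ofPoly_ne_zero hf)
  rwa [map_ofPoly hρ, ← ofPoly_mul] at h

end Algebra

end AbelianCoulomb

end

noncomputable section

namespace AbelianCoulomb

/-! ### Weighted coefficient norms and the shift operators -/

section WeightedNorm

open MvPolynomial Finset
open scoped Nat

variable {d : ℕ}

/-- The weighted `ℓ¹`-norm of the coefficients of `f`, with weight `w (deg γ)` at `x^γ`. -/
def wnorm (w : ℕ → ℝ) (f : MvPolynomial (Fin d) ℂ) : ℝ :=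
  ∑ γ ∈ f.support, ‖coeff γ f‖ * w γ.degree

theorem wnorm_eq_sum {w : ℕ → ℝ} {f : MvPolynomial (Fin d) ℂ} {s : Finset (Fin d →₀ ℕ)}
    (hs : f.support ⊆ s) : wnorm w f = ∑ γ ∈ s, ‖coeff γ f‖ * w γ.degree := by
  refine Finset.sum_subset hs fun γ _ hγ => ?_
  rw [notMem_support_iff.mp hγ, norm_zero, zero_mul]

theorem wnorm_nonneg {w : ℕ → ℝ} (hw : ∀ l, 0 ≤ w l) (f : MvPolynomial (Fin d) ℂ) :
    0 ≤ wnorm w f :=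
  Finset.sum_nonneg fun _ _ => mul_nonneg (norm_nonneg _) (hw _)

theorem wnorm_zero (w : ℕ → ℝ) : wnorm w (0 : MvPolynomial (Fin d) ℂ) = 0 := by simp [wnorm]

theorem wnorm_add_le {w : ℕ → ℝ} (hw : ∀ l, 0 ≤ w l) (f g : MvPolynomial (Fin d) ℂ) :
    wnorm w (f + g) ≤ wnorm w f + wnorm w g := by
  classical
  rw [wnorm_eq_sum (support_add (p := f) (q := g)), wnorm_eq_sum (subset_union_left (s₂ := g.support)),
    wnorm_eq_sum (f := g) (subset_union_right (s₁ := f.support)), ← Finset.sum_add_distrib]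
  refine Finset.sum_le_sum fun γ _ => ?_
  rw [← add_mul, coeff_add]
  exact mul_le_mul_of_nonneg_right (norm_add_le _ _) (hw _)

theorem wnorm_C_mul (w : ℕ → ℝ) (c : ℂ) (f : MvPolynomial (Fin d) ℂ) :
    wnorm w (C c * f) = ‖c‖ * wnorm w f := by
  have : (C c * f).support ⊆ f.support := fun γ hγ => by
    rw [mem_support_iff, coeff_C_mul] at hγ
    exact mem_support_iff.mpr (right_ne_zero_of_mul hγ)
  rw [wnorm_eq_sum this, wnorm, Finset.mul_sum]
  refine Finset.sum_congr rfl fun γ _ => ?_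
  rw [coeff_C_mul, norm_mul, mul_assoc]

theorem wnorm_X_mul (w : ℕ → ℝ) (k : Fin d) (f : MvPolynomial (Fin d) ℂ) :
    wnorm w (X k * f) = wnorm (fun l => w (l + 1)) f := by
  classical
  rw [wnorm, wnorm, support_X_mul, Finset.sum_map]
  refine Finset.sum_congr rfl fun γ _ => ?_
  rw [addLeftEmbedding_apply, coeff_X_mul, map_add, Finsupp.degree_single, add_comm 1]

theorem wnorm_monomial (w : ℕ → ℝ) (γ : Fin d →₀ ℕ) :
    wnorm w (monomial γ (1 : ℂ)) = w γ.degree := by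
  classical
  simp [wnorm, support_monomial]

theorem norm_apply_le_wnorm (T : MvPolynomial (Fin d) ℂ →ₗ[ℂ] ℂ) {a : ℕ → ℝ}
    (ha : ∀ γ : Fin d →₀ ℕ, ‖T (monomial γ 1)‖ ≤ a γ.degree) (f : MvPolynomial (Fin d) ℂ) :
    ‖T f‖ ≤ wnorm a f := by
  conv_lhs => rw [f.as_sum, map_sum]
  refine (norm_sum_le _ _).trans (Finset.sum_le_sum fun γ _ => ?_)
  have : monomial γ (coeff γ f) = coeff γ f • monomial γ (1 : ℂ) := by
    rw [smul_monomial, smul_eq_mul, mul_one]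
  rw [this, map_smul, smul_eq_mul, norm_mul]
  exact mul_le_mul_of_nonneg_left (ha γ) (norm_nonneg _)

/-- The derivation `∂_v` of `ℂ[x]`. -/
def dirDeriv (v : Fin d → ℂ) : Derivation ℂ (MvPolynomial (Fin d) ℂ) (MvPolynomial (Fin d) ℂ) :=
  mkDerivation ℂ fun k => C (v k)

theorem dirDeriv_X (v : Fin d → ℂ) (k : Fin d) : dirDeriv v (X k) = C (v k) :=
  mkDerivation_X _ _ _

/-- The derivation along an integral vector. -/
def latticeDeriv (l : Fin d → ℤ) :
    Derivation ℂ (MvPolynomial (Fin d) ℂ) (MvPolynomial (Fin d) ℂ) :=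
  dirDeriv fun k => (l k : ℂ)

theorem monomial_induction {p : (Fin d →₀ ℕ) → Prop} (h0 : p 0)
    (hs : ∀ γ k, p γ → p (γ + Finsupp.single k 1)) (γ : Fin d →₀ ℕ) : p γ := by
  classical
  obtain ⟨N, hN⟩ : ∃ N, γ.degree = N := ⟨_, rfl⟩
  induction N generalizing γ with
  | zero => rw [(Finsupp.degree_eq_zero_iff γ).mp hN]; exact h0
  | succ N ih =>
    have hne : γ ≠ 0 := by rintro rfl; simp at hN
    obtain ⟨k, hk⟩ := Finsupp.ne_iff.mp hne
    have hle : Finsupp.single k 1 ≤ γ := by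
      rw [Finsupp.single_le_iff]; exact Nat.one_le_iff_ne_zero.mpr hk
    have e : γ - Finsupp.single k 1 + Finsupp.single k 1 = γ := tsub_add_cancel_of_le hle
    rw [← e]
    refine hs _ k (ih _ ?_)
    have := congrArg Finsupp.degree e
    rw [map_add, Finsupp.degree_single, hN] at this
    omega

/-- The bound for the part of lower degree of the shift of a monomial. -/
def shiftBound (Λ : ℝ) (M : ℕ) (w : ℕ → ℝ) : ℝ :=
  ∑ l ∈ range M, (M.choose l : ℝ) * Λ ^ (M - l) * w l

/-- Pascal's rule: `(x + Λ)^(M+1) - x^(M+1) = (x + Λ)((x + Λ)^M - x^M) + Λ x^M`, with `x^l` replaced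
by `w l`. -/
theorem shiftBound_succ (Λ : ℝ) (M : ℕ) (w : ℕ → ℝ) :
    shiftBound Λ (M + 1) w =
      shiftBound Λ M (fun l => w (l + 1)) + Λ * shiftBound Λ M w + Λ * w M := by
  unfold shiftBound
  rw [Finset.sum_range_succ']
  have h1 : ∑ l ∈ range M, (M.choose (l + 1) : ℝ) * Λ ^ (M - l) * w (l + 1) +
      (M.choose 0 : ℝ) * Λ ^ (M + 1) * w 0 =
      ∑ l ∈ range (M + 1), (M.choose l : ℝ) * Λ ^ (M + 1 - l) * w l := by
    rw [Finset.sum_range_succ']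
    simp
  rw [Finset.sum_range_succ] at h1
  have h2 : ∀ l ∈ range M, (M.choose l : ℝ) * Λ ^ (M + 1 - l) * w l =
      Λ * ((M.choose l : ℝ) * Λ ^ (M - l) * w l) := by
    intro l hl
    rw [show M + 1 - l = (M - l) + 1 by have := mem_range.mp hl; omega, pow_succ]
    ring
  rw [Finset.sum_congr rfl h2, ← Finset.mul_sum] at h1
  have h3 : ∀ l ∈ range M, ((M + 1).choose (l + 1) : ℝ) * Λ ^ (M + 1 - (l + 1)) * w (l + 1) =
      (M.choose l : ℝ) * Λ ^ (M - l) * w (l + 1) +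
        (M.choose (l + 1) : ℝ) * Λ ^ (M - l) * w (l + 1) := by
    intro l _
    rw [Nat.choose_succ_succ, show M + 1 - (l + 1) = M - l by omega]
    push_cast
    ring
  rw [Finset.sum_congr rfl h3, Finset.sum_add_distrib]
  simp only [Nat.choose_self, Nat.cast_one, one_mul, Nat.add_sub_cancel_left, pow_one,
    Nat.choose_zero_right, tsub_zero] at h1 ⊢
  linarith

/-- The `ℓ¹`-size of an integral vector. -/
def latticeNorm (l : Fin d → ℤ) : ℝ := ∑ k, |(l k : ℝ)|

theorem abs_le_latticeNorm (l : Fin d → ℤ) (k : Fin d) : |(l k : ℝ)| ≤ latticeNorm l :=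
  Finset.single_le_sum (f := fun k => |(l k : ℝ)|) (fun _ _ => abs_nonneg _) (mem_univ k)

theorem latticeNorm_nonneg (l : Fin d → ℤ) : 0 ≤ latticeNorm l :=
  Finset.sum_nonneg fun _ _ => abs_nonneg _

theorem shift_X (l : Fin d → ℤ) (k : Fin d) : shift l (X k) = X k + C (l k : ℂ) := by
  simp [shift]

theorem wnorm_const_le {w : ℕ → ℝ} (hw : ∀ l, 0 ≤ w l) (l : Fin d → ℤ) (k : Fin d)
    (f : MvPolynomial (Fin d) ℂ) : wnorm w (C (l k : ℂ) * f) ≤ latticeNorm l * wnorm w f := by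
  rw [wnorm_C_mul]
  refine mul_le_mul_of_nonneg_right ?_ (wnorm_nonneg hw f)
  rw [Complex.norm_intCast]
  exact abs_le_latticeNorm l k

theorem monomial_add_single_one (γ : Fin d →₀ ℕ) (k : Fin d) :
    monomial (γ + Finsupp.single k 1) (1 : ℂ) = X k * monomial γ 1 := by
  rw [add_comm, monomial_single_add, pow_one]

/-- Every entry of `l` is at most `latticeNorm l`, so the expansion is dominated by that of `(x +
Λ)^M - x^M` in a single variable. -/
theorem wnorm_shift_sub_le (l : Fin d → ℤ) (γ : Fin d →₀ ℕ) {w : ℕ → ℝ} (hw : ∀ l, 0 ≤ w l) :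
    wnorm w (shift l (monomial γ 1) - monomial γ 1) ≤
      shiftBound (latticeNorm l) γ.degree w := by
  induction γ using monomial_induction generalizing w with
  | h0 =>
    have : shift l (monomial 0 (1 : ℂ)) - monomial 0 1 = 0 := by
      rw [sub_eq_zero]; exact map_one _
    rw [this, wnorm_zero]
    simp [shiftBound]
  | hs γ k ih =>
    rw [map_add, Finsupp.degree_single, shiftBound_succ, monomial_add_single_one, map_mul, shift_X]
    have e : (X k + C (l k : ℂ)) * shift l (monomial γ 1) - X k * monomial γ 1 =
        X k * (shift l (monomial γ 1) - monomial γ 1) +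
        C (l k : ℂ) * (shift l (monomial γ 1) - monomial γ 1) + C (l k : ℂ) * monomial γ 1 := by
      ring
    rw [e]
    refine (wnorm_add_le hw _ _).trans (add_le_add ((wnorm_add_le hw _ _).trans
      (add_le_add ?_ ?_)) ?_)
    · rw [wnorm_X_mul]
      exact ih fun l => hw (l + 1)
    · exact (wnorm_const_le hw l k _).trans
        (mul_le_mul_of_nonneg_left (ih hw) (latticeNorm_nonneg l))
    · exact (wnorm_const_le hw l k _).trans_eq (by rw [wnorm_monomial])

/-- Removing the derivative removes the terms of degree `M - 1`, which is the subtracted summand of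
the one-variable bound. -/
theorem wnorm_shift_sub_deriv_le (l : Fin d → ℤ) (γ : Fin d →₀ ℕ) {w : ℕ → ℝ}
    (hw : ∀ l, 0 ≤ w l) :
    wnorm w (shift l (monomial γ 1) - monomial γ 1 - latticeDeriv l (monomial γ 1)) ≤
      shiftBound (latticeNorm l) γ.degree w -
        γ.degree * latticeNorm l * w (γ.degree - 1) := by
  induction γ using monomial_induction generalizing w with
  | h0 =>
    have : shift l (monomial 0 (1 : ℂ)) - monomial 0 1 - latticeDeriv l (monomial 0 1) = 0 := by
      have h1 : shift l (monomial 0 (1 : ℂ)) = 1 := map_one _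
      have h2 : latticeDeriv l (monomial 0 (1 : ℂ)) = 0 := Derivation.map_one_eq_zero _
      rw [h1, h2, sub_zero, sub_eq_zero]; rfl
    rw [this, wnorm_zero]
    simp [shiftBound]
  | hs γ k ih =>
    rw [map_add, Finsupp.degree_single, shiftBound_succ, monomial_add_single_one, map_mul, shift_X,
      Derivation.leibniz]
    have e0 : latticeDeriv l (X k) = C (l k : ℂ) := dirDeriv_X _ _
    rw [e0, smul_eq_mul, smul_eq_mul]
    have e : (X k + C (l k : ℂ)) * shift l (monomial γ 1) - X k * monomial γ 1 -
          (X k * latticeDeriv l (monomial γ 1) + monomial γ 1 * C (l k : ℂ)) =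
        X k * (shift l (monomial γ 1) - monomial γ 1 - latticeDeriv l (monomial γ 1)) +
        C (l k : ℂ) * (shift l (monomial γ 1) - monomial γ 1) := by
      ring
    rw [e]
    have h1 := ih fun l => hw (l + 1)
    rw [← wnorm_X_mul] at h1
    have h2 := (wnorm_const_le hw l k (shift l (monomial γ 1) - monomial γ 1)).trans
        (mul_le_mul_of_nonneg_left (wnorm_shift_sub_le l γ hw) (latticeNorm_nonneg l))
    have h3 : (γ.degree : ℝ) * latticeNorm l * w (γ.degree - 1 + 1) =
        γ.degree * latticeNorm l * w γ.degree := by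
      rcases Nat.eq_zero_or_pos γ.degree with h | h
      · rw [h]; simp
      · rw [Nat.sub_add_cancel h]
    rw [h3] at h1
    refine (wnorm_add_le hw _ _).trans ((add_le_add h1 h2).trans (le_of_eq ?_))
    push_cast
    ring

theorem choose_mul_le (Λ K A : ℝ) (hK : 0 < K) {M l : ℕ} (hl : l ≤ M) :
    (M.choose l : ℝ) * Λ ^ (M - l) * (A * K ^ l * l !) =
      A * K ^ M * M ! * ((Λ / K) ^ (M - l) / (M - l)!) := by
  have h := Nat.choose_mul_factorial_mul_factorial hl
  have h' : (M.choose l : ℝ) * l ! * (M - l)! = M ! := by exact_mod_cast h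
  rw [← h', div_pow]
  have hf : ((M - l)! : ℝ) ≠ 0 := by positivity
  have hKM : K ^ M = K ^ l * K ^ (M - l) := by rw [← pow_add]; congr 1; omega
  rw [hKM]
  field_simp

theorem sum_pow_div_factorial (x : ℝ) (M : ℕ) :
    ∑ l ∈ range M, x ^ (M - l) / (M - l)! + 1 = ∑ j ∈ range (M + 1), x ^ j / j ! := by
  rw [← Finset.sum_range_reflect (fun j => x ^ j / (j ! : ℝ)), Finset.sum_range_succ]
  simp

/-- Factorial weights turn the binomial sum into a piece of the series of `exp(Λ/K) - 1`, which is
`O(Λ/K)`. This gain of `1/K` is what makes the induction for the growth bound close. -/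
theorem shiftBound_le {Λ K A : ℝ} {M : ℕ} {a : ℕ → ℝ} (hΛ : 0 ≤ Λ) (hK : 0 < K) (hΛK : Λ ≤ K)
    (hA : 0 ≤ A) (ha : ∀ l < M, a l ≤ A * K ^ l * l !) :
    shiftBound Λ M a ≤ A * K ^ M * M ! * (2 * (Λ / K)) := by
  have hx : |Λ / K| ≤ 1 := by
    rw [abs_of_nonneg (by positivity)]; exact div_le_one_of_le₀ hΛK hK.le
  have hx0 : 0 ≤ Λ / K := by positivity
  calc shiftBound Λ M a
      ≤ ∑ l ∈ range M, (M.choose l : ℝ) * Λ ^ (M - l) * (A * K ^ l * l !) :=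
        Finset.sum_le_sum fun l hl => mul_le_mul_of_nonneg_left (ha l (mem_range.mp hl))
          (by positivity)
    _ = A * K ^ M * M ! * ∑ l ∈ range M, (Λ / K) ^ (M - l) / (M - l)! := by
        rw [Finset.mul_sum]
        exact Finset.sum_congr rfl fun l hl => choose_mul_le Λ K A hK (mem_range.mp hl).le
    _ ≤ _ := by
        refine mul_le_mul_of_nonneg_left ?_ (by positivity)
        have h1 := sum_pow_div_factorial (Λ / K) M
        have h2 := Real.sum_le_exp_of_nonneg hx0 (M + 1)
        have h3 := (abs_le.mp (Real.abs_exp_sub_one_le hx)).2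
        rw [abs_of_nonneg hx0] at h3
        linarith

/-- The same with `exp(Λ/K) - 1 - Λ/K ≤ (Λ/K)²`. Only moments of degree at most `M - 2` enter, hence
the weaker hypothesis on `a`. -/
theorem shiftBound_sub_le {Λ K A : ℝ} {M : ℕ} {a : ℕ → ℝ} (hΛ : 0 ≤ Λ) (hK : 0 < K)
    (hΛK : Λ ≤ K) (hA : 0 ≤ A) (ha : ∀ l, l + 1 < M → a l ≤ A * K ^ l * l !) :
    shiftBound Λ M a - M * Λ * a (M - 1) ≤ A * K ^ M * M ! * (Λ / K) ^ 2 := by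
  rcases M with _ | M
  · simp only [shiftBound, range_zero, sum_empty, Nat.cast_zero, zero_mul, sub_zero]
    positivity
  have hx : |Λ / K| ≤ 1 := by
    rw [abs_of_nonneg (by positivity)]; exact div_le_one_of_le₀ hΛK hK.le
  have hx0 : 0 ≤ Λ / K := by positivity
  have e : shiftBound Λ (M + 1) a - (M + 1 : ℕ) * Λ * a (M + 1 - 1) =
      ∑ l ∈ range M, ((M + 1).choose l : ℝ) * Λ ^ (M + 1 - l) * a l := by
    rw [shiftBound, Finset.sum_range_succ]
    simp [Nat.choose_succ_self_right]
  rw [e]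
  calc _ ≤ ∑ l ∈ range M, ((M + 1).choose l : ℝ) * Λ ^ (M + 1 - l) * (A * K ^ l * l !) :=
        Finset.sum_le_sum fun l hl => mul_le_mul_of_nonneg_left
          (ha l (by have := mem_range.mp hl; omega)) (by positivity)
    _ = A * K ^ (M + 1) * (M + 1)! *
          ∑ l ∈ range M, (Λ / K) ^ (M + 1 - l) / (M + 1 - l)! := by
        rw [Finset.mul_sum]
        exact Finset.sum_congr rfl fun l hl =>
          choose_mul_le Λ K A hK (by have := mem_range.mp hl; omega)
    _ ≤ _ := by
        refine mul_le_mul_of_nonneg_left ?_ (by positivity)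
        have h1 := sum_pow_div_factorial (Λ / K) (M + 1)
        rw [Finset.sum_range_succ] at h1
        have h2 := Real.sum_le_exp_of_nonneg hx0 (M + 1 + 1)
        have h3 := (abs_le.mp (Real.abs_exp_sub_one_sub_id_le hx)).2
        simp only [Nat.add_sub_cancel_left, pow_one, Nat.factorial_one, Nat.cast_one, div_one] at h1
        linarith

end WeightedNorm

end AbelianCoulomb

end

noncomputable section

namespace AbelianCoulomb

/-! ### Factorial growth of the moments of a functional satisfying the trace relation -/

section Growth

open MvPolynomial Finset
open scoped Nat

variable {d n : ℕ} {ξ : Fin n → Fin d → ℤ} {b : Fin n → ℂ}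
  {T : MvPolynomial (Fin d) ℂ →ₗ[ℂ] ℂ}

/-- The largest absolute value of `T` on monomials of degree `l`. -/
def momentBound (T : MvPolynomial (Fin d) ℂ →ₗ[ℂ] ℂ) (l : ℕ) : ℝ :=
  ((Finset.univ.finsuppAntidiag l).sup fun γ : Fin d →₀ ℕ => ‖T (monomial γ 1)‖₊ : NNReal)

theorem mem_antidiag_iff {γ : Fin d →₀ ℕ} {l : ℕ} :
    γ ∈ (Finset.univ : Finset (Fin d)).finsuppAntidiag l ↔ γ.degree = l := by
  rw [mem_finsuppAntidiag, Finsupp.degree_eq_sum]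
  simp

theorem momentBound_nonneg (l : ℕ) : 0 ≤ momentBound T l := NNReal.coe_nonneg _

theorem norm_le_momentBound (γ : Fin d →₀ ℕ) : ‖T (monomial γ 1)‖ ≤ momentBound T γ.degree := by
  have := Finset.le_sup (f := fun γ : Fin d →₀ ℕ => ‖T (monomial γ 1)‖₊)
    (mem_antidiag_iff.mpr (rfl : γ.degree = γ.degree))
  exact_mod_cast this

theorem momentBound_le {l : ℕ} {B : ℝ} (hB : 0 ≤ B)
    (h : ∀ γ : Fin d →₀ ℕ, γ.degree = l → ‖T (monomial γ 1)‖ ≤ B) : momentBound T l ≤ B := by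
  lift B to NNReal using hB
  rw [momentBound, NNReal.coe_le_coe]
  exact Finset.sup_le fun γ hγ => by exact_mod_cast h γ (mem_antidiag_iff.mp hγ)

/-- All terms of `f` have degree less than `e`. -/
def DegLT (e : ℕ) (f : MvPolynomial (Fin d) ℂ) : Prop := ∀ γ, e ≤ γ.degree → coeff γ f = 0

theorem DegLT.zero (e : ℕ) : DegLT e (0 : MvPolynomial (Fin d) ℂ) := fun _ _ => coeff_zero _

theorem DegLT.add {e : ℕ} {f g : MvPolynomial (Fin d) ℂ} (hf : DegLT e f) (hg : DegLT e g) :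
    DegLT e (f + g) := fun γ h => by rw [coeff_add, hf γ h, hg γ h, add_zero]

theorem DegLT.mono {e e' : ℕ} {f : MvPolynomial (Fin d) ℂ} (hf : DegLT e f) (h : e ≤ e') :
    DegLT e' f := fun γ hγ => hf γ (h.trans hγ)

theorem DegLT.mul {e e' : ℕ} {f g : MvPolynomial (Fin d) ℂ} (hf : DegLT e f)
    (hg : DegLT (e' + 1) g) : DegLT (e + e') (f * g) := by
  classical
  intro γ hγ
  rw [coeff_mul]
  refine Finset.sum_eq_zero fun p hp => ?_
  have hd : p.1.degree + p.2.degree = γ.degree := by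
    rw [← map_add, mem_antidiagonal.mp hp]
  by_cases h : e ≤ p.1.degree
  · rw [hf _ h, zero_mul]
  · rw [hg p.2 (by omega), mul_zero]

theorem IsHomogeneous_degLT {e : ℕ} {f : MvPolynomial (Fin d) ℂ} (hf : f.IsHomogeneous e) :
    DegLT (e + 1) f := fun γ h => hf.coeff_eq_zero (by omega)

/-- `H` is the homogeneous part of degree `e` of `H'`, and the other terms of `H'` have lower
degree. -/
structure IsLeading (e : ℕ) (H' H : MvPolynomial (Fin d) ℂ) : Prop where
  homogeneous : H.IsHomogeneous e
  lower : DegLT e (H' - H)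

theorem IsLeading.degLT {e : ℕ} {H' H : MvPolynomial (Fin d) ℂ} (h : IsLeading e H' H) :
    DegLT (e + 1) H' := by
  have := (h.lower.mono (Nat.le_succ e)).add (IsHomogeneous_degLT h.homogeneous)
  rwa [sub_add_cancel] at this

theorem IsLeading.self {e : ℕ} {H : MvPolynomial (Fin d) ℂ} (h : H.IsHomogeneous e) :
    IsLeading e H H := ⟨h, by rw [sub_self]; exact DegLT.zero e⟩

theorem IsLeading.mul {e₁ e₂ : ℕ} {H₁' H₁ H₂' H₂ : MvPolynomial (Fin d) ℂ}
    (h₁ : IsLeading e₁ H₁' H₁) (h₂ : IsLeading e₂ H₂' H₂) :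
    IsLeading (e₁ + e₂) (H₁' * H₂') (H₁ * H₂) := by
  refine ⟨h₁.homogeneous.mul h₂.homogeneous, ?_⟩
  have e : H₁' * H₂' - H₁ * H₂ = (H₁' - H₁) * H₂' + (H₂' - H₂) * H₁ := by ring
  rw [e]
  refine (h₁.lower.mul h₂.degLT).add ?_
  rw [add_comm]
  exact h₂.lower.mul (IsHomogeneous_degLT h₁.homogeneous)

theorem IsLeading.prod {ι : Type*} (s : Finset ι) {e : ι → ℕ}
    {H' H : ι → MvPolynomial (Fin d) ℂ} (h : ∀ i ∈ s, IsLeading (e i) (H' i) (H i)) :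
    IsLeading (∑ i ∈ s, e i) (∏ i ∈ s, H' i) (∏ i ∈ s, H i) := by
  classical
  induction s using Finset.induction_on with
  | empty => exact IsLeading.self (isHomogeneous_one _ _)
  | insert i s hi ih =>
    rw [Finset.sum_insert hi, Finset.prod_insert hi, Finset.prod_insert hi]
    exact (h i (mem_insert_self i s)).mul (ih fun j hj => h j (mem_insert_of_mem hj))

theorem IsLeading.add_C {H : MvPolynomial (Fin d) ℂ} {H' : MvPolynomial (Fin d) ℂ}
    (h : IsLeading 1 H' H) (c : ℂ) : IsLeading 1 (H' + C c) H := by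
  refine ⟨h.homogeneous, ?_⟩
  rw [add_sub_right_comm]
  exact h.lower.add fun γ hγ => by
    classical
    rw [coeff_C, if_neg]
    rintro rfl
    simp at hγ

theorem linearForm_isHomogeneous (χ : Fin d → ℤ) : (linearForm χ).IsHomogeneous 1 :=
  IsHomogeneous.sum _ _ _ fun _ _ => isHomogeneous_C_mul_X _ _

theorem descent_eq (l : Fin d → ℤ) : descent ξ b l =
    ∏ i, factor (linearForm (ξ i) + C (b i)) (-pairing (ξ i) l) (pairing (ξ i) l) := by
  have h : ∀ χ, pairing χ (-l) = -pairing χ l := fun χ => by simp [pairing]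
  simp only [descent, structureConstant, h]

theorem cancellation_neg (p : ℤ) : cancellation (-p) p = p.natAbs := by
  unfold cancellation
  split_ifs with h
  · have : p * p ≤ 0 := by linarith
    have : p = 0 := by nlinarith
    simp [this]
  · simp

/-- The leading term of `descent ξ b l`. -/
def descentTop (ξ : Fin n → Fin d → ℤ) (l : Fin d → ℤ) : MvPolynomial (Fin d) ℂ :=
  ∏ i, linearForm (ξ i) ^ (pairing (ξ i) l).natAbs

theorem isLeading_descent (l : Fin d → ℤ) :
    IsLeading (∑ i, (pairing (ξ i) l).natAbs) (descent ξ b l) (descentTop ξ l) := by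
  rw [descent_eq]
  refine IsLeading.prod _ fun i _ => ?_
  have h : ∀ j ∈ Finset.Icc 1 (pairing (ξ i) l).natAbs, IsLeading 1
      (linearForm (ξ i) + C (b i) + C (if 0 ≤ -pairing (ξ i) l then
        ((-pairing (ξ i) l : ℤ) : ℂ) - (j : ℂ) + 1 / 2
        else ((-pairing (ξ i) l : ℤ) : ℂ) + (j : ℂ) - 1 / 2)) (linearForm (ξ i)) := fun j _ =>
    ((IsLeading.self (linearForm_isHomogeneous (ξ i))).add_C _).add_C _
  have := IsLeading.prod _ h
  unfold factor
  rw [cancellation_neg]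
  simpa using this

/-- `u` is of smaller order than the size of the moments of degree `deg γ + e`. -/
def IsSmall (T : MvPolynomial (Fin d) ℂ →ₗ[ℂ] ℂ) (e : ℕ) (u : (Fin d →₀ ℕ) → ℂ) : Prop :=
  ∃ (C K₀ : ℝ) (N₀ : ℕ), 0 ≤ C ∧ 1 ≤ K₀ ∧ ∀ K ≥ K₀, ∀ A ≥ 0, ∀ γ : Fin d →₀ ℕ,
    N₀ ≤ γ.degree + e → (∀ l < γ.degree + e, momentBound T l ≤ A * K ^ l * l !) →
    ‖u γ‖ ≤ C / K * (A * K ^ (γ.degree + e) * (γ.degree + e)!)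

theorem IsSmall.of_le {e : ℕ} {u v : (Fin d →₀ ℕ) → ℂ} (h : IsSmall T e u) (c : ℝ) (N₁ : ℕ)
    (hc : ∀ γ, N₁ ≤ γ.degree + e → ‖v γ‖ ≤ c * ‖u γ‖) : IsSmall T e v := by
  obtain ⟨C, K₀, N₀, hC, hK₀, h⟩ := h
  refine ⟨|c| * C, K₀, max N₀ N₁, by positivity, hK₀, fun K hK A hA γ hγ hl => ?_⟩
  have h1 := h K hK A hA γ (le_of_max_le_left hγ) hl
  calc ‖v γ‖ ≤ c * ‖u γ‖ := hc γ (le_of_max_le_right hγ)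
    _ ≤ |c| * ‖u γ‖ := mul_le_mul_of_nonneg_right (le_abs_self c) (norm_nonneg _)
    _ ≤ |c| * (C / K * (A * K ^ (γ.degree + e) * (γ.degree + e)!)) :=
      mul_le_mul_of_nonneg_left h1 (abs_nonneg c)
    _ = _ := by ring

theorem IsSmall.const_mul {e : ℕ} {u : (Fin d →₀ ℕ) → ℂ} (h : IsSmall T e u) (c : ℂ) :
    IsSmall T e fun γ => c * u γ :=
  h.of_le ‖c‖ 0 fun _ _ => (norm_mul _ _).le

theorem IsSmall.add {e : ℕ} {u v : (Fin d →₀ ℕ) → ℂ} (h : IsSmall T e u) (h' : IsSmall T e v) :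
    IsSmall T e fun γ => u γ + v γ := by
  obtain ⟨C, K₀, N₀, hC, hK₀, h⟩ := h
  obtain ⟨C', K₀', N₀', hC', hK₀', h'⟩ := h'
  refine ⟨C + C', max K₀ K₀', max N₀ N₀', by positivity, hK₀.trans (le_max_left _ _),
    fun K hK A hA γ hγ hl => ?_⟩
  have h1 := h K (le_of_max_le_left hK) A hA γ (le_of_max_le_left hγ) hl
  have h2 := h' K (le_of_max_le_right hK) A hA γ (le_of_max_le_right hγ) hl
  refine (norm_add_le _ _).trans ((add_le_add h1 h2).trans_eq ?_)
  ring

theorem IsSmall.zero (e : ℕ) : IsSmall T e fun _ => 0 :=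
  ⟨0, 1, 0, le_rfl, le_rfl, fun K hK A hA γ _ _ => by simp⟩

theorem IsSmall.sum {e : ℕ} {ι : Type*} (s : Finset ι) {u : ι → (Fin d →₀ ℕ) → ℂ}
    (h : ∀ i ∈ s, IsSmall T e (u i)) : IsSmall T e fun γ => ∑ i ∈ s, u i γ := by
  classical
  induction s using Finset.induction_on with
  | empty => simpa using IsSmall.zero e
  | insert i s hi ih =>
    simp only [Finset.sum_insert hi]
    exact (h i (mem_insert_self i s)).add (ih fun j hj => h j (mem_insert_of_mem hj))

theorem IsSmall.comp_add {e : ℕ} {u : (Fin d →₀ ℕ) → ℂ} (h : IsSmall T e u) (δ : Fin d →₀ ℕ) :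
    IsSmall T (e + δ.degree) fun γ => u (γ + δ) := by
  obtain ⟨C, K₀, N₀, hC, hK₀, h⟩ := h
  refine ⟨C, K₀, N₀, hC, hK₀, fun K hK A hA γ hγ hl => ?_⟩
  have e1 : (γ + δ).degree + e = γ.degree + (e + δ.degree) := by rw [map_add]; ring
  have := h K hK A hA (γ + δ)
  rw [e1] at this
  exact this hγ hl

/-- Multiples of `h` have small moments. -/
def IsNegligible (T : MvPolynomial (Fin d) ℂ →ₗ[ℂ] ℂ) (e : ℕ) (h : MvPolynomial (Fin d) ℂ) :
    Prop := IsSmall T e fun γ => T (h * monomial γ 1)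

theorem apply_mul_eq_sum (Ψ : MvPolynomial (Fin d) ℂ →ₗ[ℂ] ℂ) (h H : MvPolynomial (Fin d) ℂ)
    (γ : Fin d →₀ ℕ) : Ψ (h * H * monomial γ 1) =
      ∑ δ ∈ H.support, coeff δ H * Ψ (h * monomial (γ + δ) 1) := by
  conv_lhs => rw [H.as_sum, Finset.mul_sum, Finset.sum_mul, map_sum]
  refine Finset.sum_congr rfl fun δ _ => ?_
  rw [← smul_eq_mul (coeff δ H), ← map_smul]
  congr 1
  rw [mul_assoc, monomial_mul, mul_one, ← mul_smul_comm, smul_monomial, smul_eq_mul, mul_one,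
    add_comm]

theorem IsNegligible.mul {e e' : ℕ} {h g : MvPolynomial (Fin d) ℂ} (hh : IsNegligible T e h)
    (hg : g.IsHomogeneous e') : IsNegligible T (e + e') (h * g) := by
  unfold IsNegligible
  simp only [apply_mul_eq_sum]
  refine IsSmall.sum _ fun δ hδ => IsSmall.const_mul ?_ _
  have : δ.degree = e' := by
    by_contra hne
    exact mem_support_iff.mp hδ (hg.coeff_eq_zero hne)
  rw [← this]
  exact hh.comp_add δ

/-- Bounds on monomials pass to fixed multiples. It is applied to `T` composed with `S_l - 1`, with
`S_l - 1 - ∂_l` and with `∂_l`. -/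
theorem norm_apply_mul_le (Ψ : MvPolynomial (Fin d) ℂ →ₗ[ℂ] ℂ) {N e : ℕ} {β : ℝ}
    (hΨ : ∀ γ : Fin d →₀ ℕ, γ.degree ≤ N → ‖Ψ (monomial γ 1)‖ ≤ β)
    {H : MvPolynomial (Fin d) ℂ} (hH : DegLT (e + 1) H) {γ : Fin d →₀ ℕ} (hγ : γ.degree + e ≤ N) :
    ‖Ψ (H * monomial γ 1)‖ ≤ wnorm (fun _ => 1) H * β := by
  have := apply_mul_eq_sum Ψ 1 H γ
  simp only [one_mul] at this
  rw [this, wnorm, Finset.sum_mul]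
  refine (norm_sum_le _ _).trans (Finset.sum_le_sum fun δ hδ => ?_)
  rw [norm_mul, mul_one]
  refine mul_le_mul_of_nonneg_left (hΨ _ ?_) (norm_nonneg _)
  have : ¬ e + 1 ≤ δ.degree := fun h => mem_support_iff.mp hδ (hH δ h)
  rw [map_add]
  omega

theorem pow_mul_factorial_le {A K : ℝ} (hA : 0 ≤ A) (hK : 1 ≤ K) {M N : ℕ} (h : M ≤ N) :
    A * K ^ M * M ! ≤ A * K ^ N * N ! := by
  have h1 : K ^ M ≤ K ^ N := pow_le_pow_right₀ hK h
  have h2 : (M ! : ℝ) ≤ N ! := by exact_mod_cast Nat.factorial_le h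
  have h3 : 0 ≤ K := by linarith
  gcongr

/-- All terms have degree below `deg γ + e`, and lowering the degree by one already gains a factor
`K` in `A K^N N!`. -/
theorem isSmall_of_degLT {e : ℕ} {H : MvPolynomial (Fin d) ℂ} (hH : DegLT e H) :
    IsSmall T e fun γ => T (H * monomial γ 1) := by
  rcases e with _ | e
  · have : H = 0 := by ext γ; exact hH γ (Nat.zero_le _)
    simpa [this] using IsSmall.zero 0
  refine ⟨wnorm (fun _ => 1) H, 1, 0, wnorm_nonneg (fun _ => zero_le_one) H, le_rfl,
    fun K hK A hA γ _ hl => ?_⟩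
  have hK0 : 0 < K := by linarith
  have := norm_apply_mul_le T (N := γ.degree + e) (β := A * K ^ (γ.degree + e) * (γ.degree + e)!)
    (fun δ hδ => (norm_le_momentBound δ).trans ((hl _ (by omega)).trans
      (pow_mul_factorial_le hA hK hδ))) hH le_rfl
  refine this.trans ?_
  rw [div_mul_eq_mul_div, le_div_iff₀ hK0, mul_assoc]
  refine mul_le_mul_of_nonneg_left ?_ (wnorm_nonneg (fun _ => zero_le_one) H)
  rw [← add_assoc, Nat.factorial_succ, pow_succ]
  have : (1 : ℝ) ≤ (γ.degree + e + 1 : ℕ) := by exact_mod_cast Nat.le_add_left _ _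
  push_cast at this ⊢
  have h0 : 0 ≤ A * K ^ (γ.degree + e) * K * ((γ.degree + e)! : ℝ) := by positivity
  nlinarith

theorem norm_apply_shift_sub_le {K A : ℝ} {N : ℕ} (l : Fin d → ℤ) (hK : latticeNorm l + 1 ≤ K)
    (hA : 0 ≤ A) (hl : ∀ l < N, momentBound T l ≤ A * K ^ l * l !) (γ : Fin d →₀ ℕ)
    (hγ : γ.degree ≤ N) :
    ‖T (shift l (monomial γ 1) - monomial γ 1)‖ ≤
      A * K ^ N * N ! * (2 * (latticeNorm l / K)) := by
  have h0 := latticeNorm_nonneg l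
  refine (norm_apply_le_wnorm T norm_le_momentBound _).trans
    ((wnorm_shift_sub_le l γ momentBound_nonneg).trans
    ((shiftBound_le h0 (by linarith) (by linarith) hA fun j hj => hl j (by omega)).trans ?_))
  have hK0 : 0 < K := by linarith
  exact mul_le_mul_of_nonneg_right (pow_mul_factorial_le hA (by linarith) hγ) (by positivity)

theorem norm_apply_shift_sub_deriv_le {K A : ℝ} {N : ℕ} (l : Fin d → ℤ)
    (hK : latticeNorm l + 1 ≤ K)
    (hA : 0 ≤ A) (hl : ∀ l, l + 1 < N → momentBound T l ≤ A * K ^ l * l !) (γ : Fin d →₀ ℕ)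
    (hγ : γ.degree ≤ N) :
    ‖T (shift l (monomial γ 1) - monomial γ 1 - latticeDeriv l (monomial γ 1))‖ ≤
      A * K ^ N * N ! * (latticeNorm l / K) ^ 2 := by
  have h0 := latticeNorm_nonneg l
  refine (norm_apply_le_wnorm T norm_le_momentBound _).trans
    ((wnorm_shift_sub_deriv_le l γ momentBound_nonneg).trans
    ((shiftBound_sub_le h0 (by linarith) (by linarith) hA fun j hj => hl j (by omega)).trans ?_))
  have hK0 : 0 < K := by linarith
  exact mul_le_mul_of_nonneg_right (pow_mul_factorial_le hA (by linarith) hγ) (by positivity)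

theorem isSmall_shift_sub (l : Fin d → ℤ) {e : ℕ} {H : MvPolynomial (Fin d) ℂ}
    (hH : DegLT (e + 1) H) :
    IsSmall T e fun γ => T (shift l (H * monomial γ 1) - H * monomial γ 1) := by
  have h0 := latticeNorm_nonneg l
  have hw := wnorm_nonneg (fun _ => zero_le_one) H
  refine ⟨wnorm (fun _ => 1) H * (2 * latticeNorm l), latticeNorm l + 1, 0,
    by positivity, by linarith, fun K hK A hA γ _ hl => ?_⟩
  refine (norm_apply_mul_le (T ∘ₗ ((shift l).toLinearMap - LinearMap.id))
    (fun δ hδ => norm_apply_shift_sub_le l hK hA hl δ hδ) hH le_rfl).trans (le_of_eq ?_)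
  ring

/-- In degree `N = deg γ + e + 1` the remainder is at most `A K^N N! (Λ/K)²` up to a constant.
Dividing by `N` leaves `A K^(N-1) (N-1)!` times `Λ²/K`, small relative to degree `N - 1`. -/
theorem isSmall_shift_sub_deriv (l : Fin d → ℤ) {e : ℕ} {H : MvPolynomial (Fin d) ℂ}
    (hH : DegLT (e + 1 + 1) H) :
    IsSmall T e fun γ => T (shift l (H * monomial γ 1) - H * monomial γ 1 -
      latticeDeriv l (H * monomial γ 1)) / (γ.degree + e + 1 : ℕ) := by
  have h0 := latticeNorm_nonneg l
  have hw := wnorm_nonneg (fun _ => zero_le_one) H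
  refine ⟨wnorm (fun _ => 1) H * (latticeNorm l ^ 2), latticeNorm l + 1, 0,
    by positivity, by linarith, fun K hK A hA γ _ hl => ?_⟩
  have hK0 : 0 < K := by linarith
  have := norm_apply_mul_le
    (T ∘ₗ ((shift l).toLinearMap - LinearMap.id - (latticeDeriv l).toLinearMap))
    (N := γ.degree + e + 1) (γ := γ)
    (fun δ hδ => norm_apply_shift_sub_deriv_le (N := γ.degree + e + 1) l hK hA
      (fun j hj => hl j (by omega)) δ hδ) hH (add_assoc _ _ _).ge
  rw [norm_div, Complex.norm_natCast, div_le_iff₀ (by positivity)]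
  refine this.trans (le_of_eq ?_)
  rw [Nat.factorial_succ, pow_succ]
  push_cast
  field_simp

/-- Write `∂_l` as the difference of `S_l - 1` and `S_l - 1 - ∂_l`, both already estimated. -/
theorem isSmall_deriv (l : Fin d → ℤ) {e : ℕ} {H : MvPolynomial (Fin d) ℂ}
    (hH : DegLT (e + 1) H) :
    IsSmall T e fun γ => T (latticeDeriv l (H * monomial γ 1)) := by
  have h0 := latticeNorm_nonneg l
  have hw := wnorm_nonneg (fun _ => zero_le_one) H
  refine ⟨wnorm (fun _ => 1) H * (2 * latticeNorm l + latticeNorm l ^ 2), latticeNorm l + 1, 0,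
    by positivity, by linarith, fun K hK A hA γ _ hl => ?_⟩
  have hK0 : 0 < K := by linarith
  refine (norm_apply_mul_le (T ∘ₗ (latticeDeriv l).toLinearMap)
    (β := A * K ^ (γ.degree + e) * (γ.degree + e)! * ((2 * latticeNorm l + latticeNorm l ^ 2) / K))
    (fun δ hδ => ?_) hH le_rfl).trans (le_of_eq (by ring))
  have h1 := norm_apply_shift_sub_le l hK hA hl δ hδ
  have h2 := norm_apply_shift_sub_deriv_le (T := T) l hK hA (fun j hj => hl j (by omega)) δ hδ
  have e1 : T (latticeDeriv l (monomial δ 1)) = T (shift l (monomial δ 1) - monomial δ 1) -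
      T (shift l (monomial δ 1) - monomial δ 1 - latticeDeriv l (monomial δ 1)) := by
    rw [← map_sub]; congr 1; ring
  change ‖T (latticeDeriv l (monomial δ 1))‖ ≤ _
  rw [e1]
  refine (norm_sub_le _ _).trans ((add_le_add h1 h2).trans ?_)
  rw [← mul_add]
  refine mul_le_mul_of_nonneg_left ?_ (by positivity)
  rw [div_pow, add_div, mul_div_assoc]
  gcongr
  nlinarith

end Growth

end AbelianCoulomb

end

noncomputable section

namespace AbelianCoulomb

/-! ### Consequences of the trace relation in top degree, and Euler's identity. -/

section GrowthTheorem

open MvPolynomial Finset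
open scoped Nat

variable {d n : ℕ} {ξ : Fin n → Fin d → ℤ} {b : Fin n → ℂ}
  {T : MvPolynomial (Fin d) ℂ →ₗ[ℂ] ℂ}

/-- A rational projection onto the common kernel of some of the characters. -/
theorem exists_lattice_projection (ξ : Fin n → Fin d → ℤ) (J : Finset (Fin n)) :
    ∃ (m : ℤ) (l : Fin d → Fin d → ℤ) (e : Fin n → Fin d → ℚ), m ≠ 0 ∧
      (∀ i ∈ J, ∀ k, pairing (ξ i) (l k) = 0) ∧
      ∀ k j, (l k j : ℚ) + m * ∑ i ∈ J, (ξ i k : ℚ) * e i j = if k = j then (m : ℚ) else 0 := by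
  classical
  let Ξ : (Fin d → ℚ) →ₗ[ℚ] (Fin n → ℚ) :=
    Matrix.toLin' (Matrix.of fun i k => if i ∈ J then (ξ i k : ℚ) else 0)
  have hΞ : ∀ x i, Ξ x i = if i ∈ J then ∑ k, (ξ i k : ℚ) * x k else 0 := by
    intro x i
    simp only [Ξ, Matrix.toLin'_apply, Matrix.mulVec, dotProduct, Matrix.of_apply]
    split_ifs <;> simp
  -- A generalized inverse of `Ξ`: then `1 - g Ξ` is a projection onto the common kernel of the
  -- weights in `J`. The `l k` are the images of the basis vectors, cleared of denominators by `m`,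
  -- and the columns of `g` are the `e i`.
  obtain ⟨g, hg⟩ : ∃ g : (Fin n → ℚ) →ₗ[ℚ] (Fin d → ℚ), ∀ x, Ξ (g (Ξ x)) = Ξ x := by
    obtain ⟨g₀, hg₀⟩ := Ξ.rangeRestrict.exists_rightInverse_of_surjective Ξ.range_rangeRestrict
    obtain ⟨g, hg⟩ := LinearMap.exists_extend g₀
    refine ⟨g, fun x => ?_⟩
    have h1 : g (Ξ x) = g₀ (Ξ.rangeRestrict x) := LinearMap.congr_fun hg (Ξ.rangeRestrict x)
    have h2 := congrArg Subtype.val (LinearMap.congr_fun hg₀ (Ξ.rangeRestrict x))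
    rw [h1]
    exact h2
  let π : Fin d → Fin d → ℚ := fun k => Pi.single k 1 - g (Ξ (Pi.single k 1))
  obtain ⟨m, hm⟩ := IsLocalization.exist_integer_multiples_of_finite (nonZeroDivisors ℤ)
    (fun p : Fin d × Fin d => π p.1 p.2)
  choose l hl using hm
  have hl' : ∀ k j, ((l (k, j) : ℤ) : ℚ) = (m : ℤ) * π k j := by
    intro k j
    have := hl (k, j)
    simpa using this
  refine ⟨m, fun k j => l (k, j), fun i j => g (Pi.single i 1) j,
    nonZeroDivisors.coe_ne_zero m, fun i hi k => ?_, fun k j => ?_⟩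
  · have h1 : Ξ (π k) i = 0 := by
      simp only [π, map_sub, hg, sub_self, Pi.zero_apply]
    rw [hΞ, if_pos hi] at h1
    have h2 : ((pairing (ξ i) fun j => l (k, j) : ℤ) : ℚ) = 0 := by
      rw [pairing]
      push_cast
      simp only [hl']
      rw [← mul_zero ((m : ℤ) : ℚ), ← h1, Finset.mul_sum]
      exact Finset.sum_congr rfl fun _ _ => by ring
    exact_mod_cast h2
  · rw [hl']
    have h1 : g (Ξ (Pi.single k 1)) j = ∑ i ∈ J, (ξ i k : ℚ) * g (Pi.single i 1) j := by
      have : Ξ (Pi.single k 1) = ∑ i ∈ J, (ξ i k : ℚ) • Pi.single i (1 : ℚ) := by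
        ext i
        rw [hΞ]
        simp [Finset.sum_apply, Pi.single_apply, Finset.sum_ite_eq]
      rw [this, map_sum, Finset.sum_apply]
      simp
    rw [← h1, ← mul_add]
    simp only [π, Pi.sub_apply, sub_add_cancel, Pi.single_apply]
    simp [eq_comm]

theorem dirDeriv_eq_zero_of_linearForm {l : Fin d → ℤ} {χ : Fin d → ℤ} (h : pairing χ l = 0) :
    latticeDeriv l (linearForm χ) = 0 := by
  have : latticeDeriv l (linearForm χ) = C ((pairing χ l : ℤ) : ℂ) := by
    simp only [linearForm, pairing, map_sum, Derivation.leibniz, latticeDeriv, dirDeriv_X]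
    simp [mul_comm]
  rw [this, h]
  simp

/-- The product of the linear forms `ξ_i`, `i ∈ K`. -/
def prodForm (ξ : Fin n → Fin d → ℤ) (K : Finset (Fin n)) : MvPolynomial (Fin d) ℂ :=
  ∏ i ∈ K, linearForm (ξ i)

/-- The monomial in the linear forms `ξ_i` with exponents given by a multiset. -/
def multForm (ξ : Fin n → Fin d → ℤ) (s : Multiset (Fin n)) : MvPolynomial (Fin d) ℂ :=
  (s.map fun i => linearForm (ξ i)).prod

theorem prodForm_isHomogeneous (K : Finset (Fin n)) : (prodForm ξ K).IsHomogeneous K.card := by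
  have := IsHomogeneous.prod K (fun i => linearForm (ξ i)) (fun _ => 1)
    fun i _ => linearForm_isHomogeneous (ξ i)
  simpa [prodForm] using this

theorem multForm_cons (i : Fin n) (s : Multiset (Fin n)) :
    multForm ξ (i ::ₘ s) = linearForm (ξ i) * multForm ξ s := by simp [multForm]

theorem multForm_isHomogeneous (s : Multiset (Fin n)) :
    (multForm ξ s).IsHomogeneous (Multiset.card s) := by
  induction s using Multiset.induction_on with
  | empty => simpa [multForm] using isHomogeneous_one (Fin d) ℂ
  | cons i s ih =>
    rw [multForm_cons, Multiset.card_cons, add_comm]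
    exact (linearForm_isHomogeneous _).mul ih

theorem latticeDeriv_multForm {l : Fin d → ℤ} {s : Multiset (Fin n)}
    (h : ∀ i ∈ s, pairing (ξ i) l = 0) : latticeDeriv l (multForm ξ s) = 0 := by
  induction s using Multiset.induction_on with
  | empty => simp [multForm]
  | cons i s ih =>
    rw [multForm_cons, Derivation.leibniz, ih fun j hj => h j (Multiset.mem_cons_of_mem hj),
      dirDeriv_eq_zero_of_linearForm (h i (Multiset.mem_cons_self i s))]
    simp

/-- If only weights in `K` are nonzero on `l`, the leading term of `D_l` divides a power of
`prodForm ξ K`, so relations for `l` apply to multiples of that power. -/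
theorem prodForm_pow_eq {K : Finset (Fin n)} {l : Fin d → ℤ}
    (hl : ∀ i, i ∉ K → pairing (ξ i) l = 0) {m : ℕ}
    (hm : ∀ i, (pairing (ξ i) l).natAbs ≤ m) :
    ∃ M : MvPolynomial (Fin d) ℂ, ∃ e, M.IsHomogeneous e ∧
      prodForm ξ K ^ m = descentTop ξ l * M ∧
      m * K.card = ∑ i, (pairing (ξ i) l).natAbs + e := by
  have h1 : descentTop ξ l = ∏ i ∈ K, linearForm (ξ i) ^ (pairing (ξ i) l).natAbs := by
    refine (Finset.prod_subset (Finset.subset_univ K) fun i _ hi => ?_).symm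
    rw [hl i hi]; simp
  have h2 : ∑ i, (pairing (ξ i) l).natAbs = ∑ i ∈ K, (pairing (ξ i) l).natAbs := by
    refine (Finset.sum_subset (Finset.subset_univ K) fun i _ hi => ?_).symm
    rw [hl i hi]; simp
  refine ⟨∏ i ∈ K, linearForm (ξ i) ^ (m - (pairing (ξ i) l).natAbs),
    ∑ i ∈ K, 1 * (m - (pairing (ξ i) l).natAbs),
    IsHomogeneous.prod _ _ _ fun i _ => (linearForm_isHomogeneous _).pow _, ?_, ?_⟩
  · rw [h1, ← Finset.prod_mul_distrib, prodForm, ← Finset.prod_pow]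
    refine Finset.prod_congr rfl fun i _ => ?_
    rw [← pow_add, Nat.add_sub_cancel' (hm i)]
  · rw [h2, ← Finset.sum_add_distrib, mul_comm, ← smul_eq_mul, ← Finset.sum_const]
    refine Finset.sum_congr rfl fun i _ => ?_
    have := hm i
    omega

/-- The trace relation. -/
def TraceRelation (ξ : Fin n → Fin d → ℤ) (b : Fin n → ℂ) (χ : (Fin d → ℤ) → ℂ)
    (T : MvPolynomial (Fin d) ℂ →ₗ[ℂ] ℂ) : Prop :=
  ∀ l (g : MvPolynomial (Fin d) ℂ),
    T (shift l (g * descent ξ b l)) = χ l * T (g * descent ξ b l)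

/-- With `f = D_l M x^γ` the trace relation reads `(χ(l) - 1) T(f) = T(S_l f - f)`, and the
right-hand side is small. Replacing `D_l` by its leading term costs terms of lower degree only. -/
theorem isNegligible_of_ne_one {χ : (Fin d → ℤ) → ℂ} (hT : TraceRelation ξ b χ T)
    {l : Fin d → ℤ} (hχ : χ l ≠ 1) {M : MvPolynomial (Fin d) ℂ} {e : ℕ} (hM : M.IsHomogeneous e) :
    IsNegligible T (∑ i, (pairing (ξ i) l).natAbs + e) (descentTop ξ l * M) := by
  have hlead := (isLeading_descent (ξ := ξ) (b := b) l).mul (IsLeading.self hM)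
  have h1 := isSmall_shift_sub (T := T) l hlead.degLT
  have h2 := isSmall_of_degLT (T := T) hlead.lower
  refine ((h1.const_mul (χ l - 1)⁻¹).add (h2.const_mul (-1))).of_le 1 0 fun γ _ => ?_
  rw [one_mul]
  refine le_of_eq (congrArg _ ?_)
  have hrel := hT l (M * monomial γ 1)
  have e1 : descent ξ b l * M * monomial γ 1 = M * monomial γ 1 * descent ξ b l := by ring
  have hne : χ l - 1 ≠ 0 := sub_ne_zero.mpr hχ
  rw [e1, map_sub, hrel, sub_mul, map_sub, ← e1]
  field_simp
  ring

/-- Now `T(S_l f - f) = 0`, so `T(∂_l f)` equals minus the second-order remainder of the shift. -/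
theorem isSmall_deriv_of_eq_one {χ : (Fin d → ℤ) → ℂ} (hT : TraceRelation ξ b χ T)
    {l : Fin d → ℤ} (hχ : χ l = 1) {M : MvPolynomial (Fin d) ℂ} {e e' : ℕ}
    (hM : M.IsHomogeneous e) (he : ∑ i, (pairing (ξ i) l).natAbs + e = e' + 1) :
    IsSmall T e' fun γ =>
      T (latticeDeriv l (descentTop ξ l * M * monomial γ 1)) / (γ.degree + e' + 1 : ℕ) := by
  have hlead := (isLeading_descent (ξ := ξ) (b := b) l).mul (IsLeading.self hM)
  rw [he] at hlead
  have h1 := isSmall_shift_sub_deriv (T := T) l hlead.degLT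
  have h2 := isSmall_deriv (T := T) l hlead.lower
  have h3 : IsSmall T e' fun γ => T (latticeDeriv l
      ((descent ξ b l * M - descentTop ξ l * M) * monomial γ 1)) / (γ.degree + e' + 1 : ℕ) := by
    refine h2.of_le 1 0 fun γ _ => ?_
    rw [norm_div, Complex.norm_natCast, one_mul]
    exact div_le_self (norm_nonneg _) (by exact_mod_cast Nat.le_add_left 1 _)
  refine (h1.add h3).of_le 1 0 fun γ _ => ?_
  rw [one_mul]
  refine le_of_eq ?_
  rw [← norm_neg]
  refine congrArg _ ?_
  have hrel := hT l (M * monomial γ 1)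
  have e1 : descent ξ b l * M * monomial γ 1 = M * monomial γ 1 * descent ξ b l := by ring
  rw [hχ, one_mul, ← e1] at hrel
  rw [map_sub, map_sub, hrel, sub_mul, map_sub, map_sub]
  ring

/-- Differentiating `x^γ` produces a factor `γ_j`, which is at most the degree and is absorbed by
the division. -/
theorem isSmall_lower {e : ℕ} {u : (Fin d →₀ ℕ) → ℂ} (h : IsSmall T (e + 1) u) (j : Fin d) :
    IsSmall T e fun γ =>
      (γ j : ℂ) * u (γ - Finsupp.single j 1) / (γ.degree + e + 1 : ℕ) := by
  obtain ⟨C, K₀, N₀, hC, hK₀, h⟩ := h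
  refine ⟨C, K₀, N₀, hC, hK₀, fun K hK A hA γ hγ hl => ?_⟩
  have hK0 : 0 < K := by linarith
  by_cases hj : γ j = 0
  · simp only [hj, Nat.cast_zero, zero_mul, zero_div, norm_zero]
    positivity
  have hle : Finsupp.single j 1 ≤ γ := by
    rw [Finsupp.single_le_iff]; exact Nat.one_le_iff_ne_zero.mpr hj
  have hd := congrArg Finsupp.degree (tsub_add_cancel_of_le hle)
  rw [map_add, Finsupp.degree_single] at hd
  have h1 := h K hK A hA (γ - Finsupp.single j 1)
  have hd' : (γ - Finsupp.single j 1).degree + (e + 1) = γ.degree + e := by omega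
  simp only [hd'] at h1
  have h2 := h1 hγ hl
  rw [norm_div, norm_mul, Complex.norm_natCast, Complex.norm_natCast, div_le_iff₀ (by positivity)]
  have h3 : (γ j : ℝ) ≤ (γ.degree + e + 1 : ℕ) := by
    exact_mod_cast (Finsupp.le_degree j γ).trans (by omega)
  rw [mul_comm]
  exact mul_le_mul h2 h3 (by positivity) (by positivity)

theorem dirDeriv_monomial (v : Fin d → ℂ) (γ : Fin d →₀ ℕ) :
    dirDeriv v (monomial γ 1) =
      ∑ j, C (v j * γ j) * monomial (γ - Finsupp.single j 1) 1 := by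
  rw [dirDeriv, mkDerivation_monomial, one_smul, Finsupp.sum_fintype]
  · refine Finset.sum_congr rfl fun j _ => ?_
    rw [smul_eq_mul, mul_comm, C_mul_monomial, C_mul_monomial, mul_one]
  · intro j; simp

theorem dirDeriv_apply (v : Fin d → ℂ) (f : MvPolynomial (Fin d) ℂ) :
    dirDeriv v f = ∑ j, C (v j) * pderiv j f := by
  have : dirDeriv v = ∑ j, (C (v j) : MvPolynomial (Fin d) ℂ) • pderiv j := by
    refine derivation_ext fun k => ?_
    rw [dirDeriv_X, ← Derivation.coeFnAddMonoidHom_apply, map_sum, Finset.sum_apply]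
    simp [pderiv_X, Pi.single_apply]
  rw [this, ← Derivation.coeFnAddMonoidHom_apply, map_sum, Finset.sum_apply]
  simp

theorem combine_constants (J : Finset (Fin n)) (c a : ℂ) (p q : Fin n → ℂ)
    (x y : MvPolynomial (Fin d) ℂ) :
    C c * (x * (C a * y)) + ∑ i ∈ J, C (p i) * x * (C (q i) * y) =
      C (c * a + ∑ i ∈ J, p i * q i) * (x * y) := by
  rw [C_add, add_mul, map_sum, Finset.sum_mul]
  congr 1
  · rw [C_mul]; ring
  · refine Finset.sum_congr rfl fun i _ => ?_
    rw [C_mul]; ring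

/-- Euler's identity, split along a rational projection. -/
theorem euler_split {J : Finset (Fin n)} {m : ℤ} {l : Fin d → Fin d → ℤ} {e : Fin n → Fin d → ℚ}
    (hm : m ≠ 0)
    (he : ∀ k j, (l k j : ℚ) + m * ∑ i ∈ J, (ξ i k : ℚ) * e i j = if k = j then (m : ℚ) else 0)
    {f : MvPolynomial (Fin d) ℂ} {N : ℕ} (hf : f.IsHomogeneous N) :
    C (N : ℂ) * f = C (m : ℂ)⁻¹ * ∑ k, X k * latticeDeriv (l k) f +
      ∑ i ∈ J, linearForm (ξ i) * dirDeriv (fun j => (e i j : ℂ)) f := by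
  have h0 := hf.sum_X_mul_pderiv
  rw [nsmul_eq_mul] at h0
  have h1 : C (N : ℂ) = (N : MvPolynomial (Fin d) ℂ) := by simp
  rw [h1, ← h0]
  have key : ∀ k j, C (m : ℂ)⁻¹ * (X k * (C (l k j : ℂ) * pderiv j f)) +
      ∑ i ∈ J, C (ξ i k : ℂ) * X k * (C (e i j : ℂ) * pderiv j f) =
      if k = j then X j * pderiv j f else 0 := by
    intro k j
    have hc : ((m : ℂ)⁻¹ * (l k j : ℂ)) + ∑ i ∈ J, (ξ i k : ℂ) * (e i j : ℂ) =
        if k = j then 1 else 0 := by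
      have h2 := congrArg (fun q : ℚ => (q : ℂ)) (he k j)
      have hm' : (m : ℂ) ≠ 0 := by exact_mod_cast hm
      push_cast at h2
      refine mul_left_cancel₀ hm' ?_
      rw [mul_add, ← mul_assoc, mul_inv_cancel₀ hm', one_mul, h2]
      split_ifs <;> simp
    rw [combine_constants, hc]
    split_ifs with h
    · rw [h, C_1, one_mul]
    · rw [C_0, zero_mul]
  have h3 : ∀ k, X k * pderiv k f = ∑ j, if k = j then X j * pderiv j f else 0 := by
    intro k; simp
  -- Each `x_k ∂_k f` is expanded by the decomposition of the identity matrix into the projection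
  -- and the part spanned by the weights in `J`.
  rw [Finset.sum_congr rfl fun k _ => (h3 k).trans
    (Finset.sum_congr rfl fun j _ => (key k j).symm)]
  simp only [Finset.sum_add_distrib, latticeDeriv, dirDeriv_apply, Finset.mul_sum, linearForm,
    Finset.sum_mul]
  congr 1
  exact (Finset.sum_comm.trans ((Finset.sum_congr rfl fun j _ => Finset.sum_comm).trans
    Finset.sum_comm)).symm

end GrowthTheorem

end AbelianCoulomb

end

noncomputable section

namespace AbelianCoulomb

/-! ### The induction on sets of weights and the growth bound. -/

section GrowthTheorem

open MvPolynomial Finset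
open scoped Nat

variable {d n : ℕ} {ξ : Fin n → Fin d → ℤ} {b : Fin n → ℂ}
  {T : MvPolynomial (Fin d) ℂ →ₗ[ℂ] ℂ}

theorem dirDeriv_isHomogeneous (v : Fin d → ℂ) {f : MvPolynomial (Fin d) ℂ} {e : ℕ}
    (hf : f.IsHomogeneous (e + 1)) : (dirDeriv v f).IsHomogeneous e := by
  rw [dirDeriv_apply]
  refine IsHomogeneous.sum _ _ _ fun j _ => ?_
  have := (isHomogeneous_C (Fin d) (v j)).mul (hf.pderiv (i := j))
  simpa using this

theorem pow_split {K : Finset (Fin n)} {m m' : ℕ} (h : m ≤ m') (e : ℕ)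
    {g : MvPolynomial (Fin d) ℂ} (hg : IsNegligible T (m * K.card + e) (prodForm ξ K ^ m * g)) :
    IsNegligible T (m' * K.card + e) (prodForm ξ K ^ m' * g) := by
  have h1 := hg.mul ((prodForm_isHomogeneous (ξ := ξ) K).pow (m' - m))
  have e1 : m * K.card + e + K.card * (m' - m) = m' * K.card + e := by
    obtain ⟨p, rfl⟩ := Nat.exists_eq_add_of_le h
    rw [Nat.add_sub_cancel_left]; ring
  have e2 : prodForm ξ K ^ m * g * prodForm ξ K ^ (m' - m) = prodForm ξ K ^ m' * g := by
    rw [mul_right_comm, ← pow_add, Nat.add_sub_cancel' h]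
  rwa [e1, e2] at h1

/-- Euler's identity for `q^(p+1) · multForm s · g` in divergence form. Moving `x_k` inside `∂_(l
k)` costs the trace of the `l k`. The `l k` kill `multForm s`, so Euler's identity for `multForm s`
alone accounts for its derivatives and gives the `-card s`. Every other term contains one more
weight from `J`. -/
theorem euler_split_mul {J : Finset (Fin n)} {m : ℤ} {l : Fin d → Fin d → ℤ}
    {e : Fin n → Fin d → ℚ} (hm : m ≠ 0)
    (hl : ∀ i ∈ J, ∀ k, pairing (ξ i) (l k) = 0)
    (he : ∀ k j, (l k j : ℚ) + m * ∑ i ∈ J, (ξ i k : ℚ) * e i j = if k = j then (m : ℚ) else 0)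
    {s : Multiset (Fin n)} (hs : ∀ i ∈ s, i ∈ J) (q g : MvPolynomial (Fin d) ℂ) (p N : ℕ)
    (hf : (q ^ (p + 1) * multForm ξ s * g).IsHomogeneous N) :
    C ((N : ℂ) + (m : ℂ)⁻¹ * ∑ k, (l k k : ℂ) - Multiset.card s) *
        (q ^ (p + 1) * multForm ξ s * g) =
      C (m : ℂ)⁻¹ * ∑ k, latticeDeriv (l k) (X k * (q ^ (p + 1) * multForm ξ s * g)) +
      ∑ i ∈ J, C ((p + 1 : ℕ) : ℂ) * (q ^ p * multForm ξ (i ::ₘ s) *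
        dirDeriv (fun j => (e i j : ℂ)) q * g) +
      ∑ i ∈ J, q ^ (p + 1) * multForm ξ (i ::ₘ s) * dirDeriv (fun j => (e i j : ℂ)) g := by
  have h1 := euler_split hm he hf
  have h2 := euler_split hm he (multForm_isHomogeneous (ξ := ξ) s)
  have h3 : ∀ k, latticeDeriv (l k) (multForm ξ s) = 0 := fun k =>
    latticeDeriv_multForm fun i hi => hl i (hs i hi) k
  simp only [h3, mul_zero, Finset.sum_const_zero, zero_add] at h2
  have h4 : ∀ k f, latticeDeriv (l k) (X k * f) = X k * latticeDeriv (l k) f + C (l k k : ℂ) * f := by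
    intro k f
    rw [Derivation.leibniz, latticeDeriv, dirDeriv_X, smul_eq_mul, smul_eq_mul, mul_comm f]
  have h5 : ∀ i, linearForm (ξ i) * dirDeriv (fun j => (e i j : ℂ)) (q ^ (p + 1) * multForm ξ s * g) =
      C ((p + 1 : ℕ) : ℂ) * (q ^ p * multForm ξ (i ::ₘ s) *
        dirDeriv (fun j => (e i j : ℂ)) q * g) +
      q ^ (p + 1) * multForm ξ (i ::ₘ s) * dirDeriv (fun j => (e i j : ℂ)) g +
      (q ^ (p + 1) * g) * (linearForm (ξ i) * dirDeriv (fun j => (e i j : ℂ)) (multForm ξ s)) := by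
    intro i
    rw [multForm_cons, Derivation.leibniz, Derivation.leibniz, Derivation.leibniz_pow]
    simp only [smul_eq_mul, nsmul_eq_mul, Nat.add_sub_cancel, map_natCast]
    ring
  simp only [h4, Finset.sum_add_distrib, ← Finset.sum_mul]
  simp only [h5, Finset.sum_add_distrib, ← Finset.mul_sum] at h1
  rw [← h2] at h1
  rw [C_sub, C_add, C_mul, map_sum, sub_mul, add_mul, h1]
  simp only [← Finset.mul_sum]
  ring

/-- The first kind of term in `euler_split_mul`. -/
theorem isSmall_latticeDeriv {χ : (Fin d → ℤ) → ℂ} (hT : TraceRelation ξ b χ T)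
    {K : Finset (Fin n)} {l : Fin d → ℤ} (hl : ∀ i, i ∉ K → pairing (ξ i) l = 0)
    (hχ : χ l = 1) {p : ℕ} (hp : ∀ i, (pairing (ξ i) l).natAbs ≤ p) (k : Fin d)
    (s : Multiset (Fin n)) {E : ℕ} (hE : E = p * K.card + Multiset.card s) :
    IsSmall T E fun γ => T (latticeDeriv l (X k *
      (prodForm ξ K ^ p * multForm ξ s * monomial γ 1))) / (γ.degree + E + 1 : ℕ) := by
  obtain ⟨M, e', hM, hMq, hMe⟩ := prodForm_pow_eq (ξ := ξ) (K := K) (l := l) hl hp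
  have h1 := isSmall_deriv_of_eq_one (b := b) hT hχ (M := M * multForm ξ s * X k)
    (e := e' + Multiset.card s + 1) (e' := E)
    ((hM.mul (multForm_isHomogeneous s)).mul (isHomogeneous_X ℂ k)) (by rw [hE, hMe]; ring)
  have h2 : ∀ γ : Fin d →₀ ℕ, X k * (prodForm ξ K ^ p * multForm ξ s * monomial γ (1 : ℂ)) =
      descentTop ξ l * (M * multForm ξ s * X k) * monomial γ 1 := by
    intro γ; rw [hMq]; ring
  simpa only [h2] using h1

/-- The second kind of term: the derivative of `prodForm ξ K` costs one of its powers, and the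
factor left over is homogeneous. -/
theorem isSmall_dirDeriv_prodForm {K : Finset (Fin n)} {p c : ℕ} {g : MvPolynomial (Fin d) ℂ}
    (hg : IsNegligible T (p * K.card + (c + 1)) (prodForm ξ K ^ p * g)) (a : ℂ) (v : Fin d → ℂ)
    {E : ℕ} (hE : E = (p + 1) * K.card + c) :
    IsSmall T E fun γ => T (C a * (prodForm ξ K ^ p * g * dirDeriv v (prodForm ξ K) *
      monomial γ 1)) / (γ.degree + E + 1 : ℕ) := by
  by_cases hK : K.card = 0
  · have h1 : prodForm ξ K = 1 := by rw [prodForm, Finset.card_eq_zero.mp hK]; simp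
    rw [h1]
    simpa using IsSmall.zero E
  obtain ⟨c', hc⟩ := Nat.exists_eq_succ_of_ne_zero hK
  have hqh := prodForm_isHomogeneous (ξ := ξ) K
  rw [hc] at hqh
  have h1 := hg.mul (dirDeriv_isHomogeneous v hqh)
  have h2 : p * K.card + (c + 1) + c' = E := by
    rw [hE, hc]; simp only [Nat.succ_eq_add_one]; ring
  rw [h2] at h1
  refine (IsSmall.const_mul h1 a).of_le 1 0 fun γ _ => ?_
  rw [← smul_eq_C_mul, map_smul, smul_eq_mul, norm_div, Complex.norm_natCast, one_mul]
  exact div_le_self (norm_nonneg _) (by exact_mod_cast Nat.le_add_left 1 _)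

theorem isSmall_mul_dirDeriv {h : MvPolynomial (Fin d) ℂ} {E : ℕ}
    (hh : IsNegligible T (E + 1) h) (v : Fin d → ℂ) :
    IsSmall T E fun γ => T (h * dirDeriv v (monomial γ 1)) / (γ.degree + E + 1 : ℕ) := by
  have h2 := IsSmall.sum Finset.univ fun j _ => (isSmall_lower hh j).const_mul (v j)
  refine h2.of_le 1 0 fun γ _ => ?_
  rw [one_mul]
  refine le_of_eq (congrArg _ ?_)
  rw [dirDeriv_monomial, Finset.mul_sum, map_sum, Finset.sum_div]
  refine Finset.sum_congr rfl fun j _ => ?_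
  rw [mul_left_comm, ← smul_eq_C_mul, map_smul, smul_eq_mul]
  ring

/-- The constant in Euler's identity is comparable to the degree, once the degree is large, so one
can divide by it. -/
theorem norm_natCast_succ_le {N r : ℕ} {κ : ℂ} (h : 2 * ‖κ‖ + 2 * r + 2 ≤ (N : ℝ)) :
    ((N + 1 : ℕ) : ℝ) ≤ 4 * ‖(N : ℂ) + κ - r‖ := by
  have h1 : ‖(N : ℂ)‖ ≤ ‖(N : ℂ) + κ - r‖ + ‖κ‖ + r := by
    have : (N : ℂ) = ((N : ℂ) + κ - r) + (-κ) + (r : ℂ) := by ring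
    calc ‖(N : ℂ)‖ = ‖((N : ℂ) + κ - r) + (-κ) + (r : ℂ)‖ := by rw [← this]
      _ ≤ _ := norm_add₃_le
      _ = _ := by rw [norm_neg, Complex.norm_natCast]
  rw [Complex.norm_natCast] at h1
  push_cast
  linarith [norm_nonneg κ]

theorem IsSmall.of_mul {E r : ℕ} {κ : ℂ} {u v : (Fin d →₀ ℕ) → ℂ} (hv : IsSmall T E v)
    (h : ∀ γ, (((γ.degree + E : ℕ) : ℂ) + κ - r) * u γ / (γ.degree + E + 1 : ℕ) = v γ) :
    IsSmall T E u := by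
  refine hv.of_le 4 ⌈2 * ‖κ‖ + 2 * r + 2⌉₊ fun γ hγ => ?_
  have hN : 2 * ‖κ‖ + 2 * r + 2 ≤ ((γ.degree + E : ℕ) : ℝ) :=
    (Nat.le_ceil _).trans (by exact_mod_cast hγ)
  have h1 := norm_natCast_succ_le hN
  have hpos : (0 : ℝ) < ((γ.degree + E + 1 : ℕ) : ℝ) := by positivity
  rw [← h γ, norm_div, norm_mul, Complex.norm_natCast, ← mul_div_assoc, le_div_iff₀ hpos,
    ← mul_assoc, mul_comm]
  exact mul_le_mul_of_nonneg_right h1 (norm_nonneg _)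

/-- By `euler_split_mul`, `N` times the product is a sum of derivatives along the `l k`, which are
small after division by `N`, and of terms with `r + 1` weights outside `K`, which are negligible by
hypothesis. So `r + 1` such weights can be lowered to `r`, at the cost of a higher power of
`prodForm ξ K`. -/
theorem isNegligible_descend {χ : (Fin d → ℤ) → ℂ} (hT : TraceRelation ξ b χ T)
    {K : Finset (Fin n)} {m : ℤ} {l : Fin d → Fin d → ℤ} {e : Fin n → Fin d → ℚ} (hm : m ≠ 0)
    (hl : ∀ i ∈ Kᶜ, ∀ k, pairing (ξ i) (l k) = 0)
    (he : ∀ k j, (l k j : ℚ) + m * ∑ i ∈ Kᶜ, (ξ i k : ℚ) * e i j = if k = j then (m : ℚ) else 0)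
    (hχ : ∀ k, χ (l k) = 1) {p₀ r : ℕ}
    (h : ∀ s : Multiset (Fin n), (∀ i ∈ s, i ∈ Kᶜ) → Multiset.card s = r + 1 →
      IsNegligible T (p₀ * K.card + (r + 1)) (prodForm ξ K ^ p₀ * multForm ξ s)) :
    ∃ p, ∀ s : Multiset (Fin n), (∀ i ∈ s, i ∈ Kᶜ) → Multiset.card s = r →
      IsNegligible T (p * K.card + r) (prodForm ξ K ^ p * multForm ξ s) := by
  obtain ⟨p₁, hp₀, hp₁⟩ : ∃ p₁, p₀ ≤ p₁ ∧ ∀ k i, (pairing (ξ i) (l k)).natAbs ≤ p₁ + 1 := by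
    refine ⟨p₀ + ∑ k, ∑ i, (pairing (ξ i) (l k)).natAbs, Nat.le_add_right _ _, fun k i => ?_⟩
    have h1 : _ ≤ ∑ i, (pairing (ξ i) (l k)).natAbs := Finset.single_le_sum
      (f := fun i => (pairing (ξ i) (l k)).natAbs) (fun _ _ => Nat.zero_le _) (mem_univ i)
    have h2 : _ ≤ ∑ k, ∑ i, (pairing (ξ i) (l k)).natAbs := Finset.single_le_sum
      (f := fun k => ∑ i, (pairing (ξ i) (l k)).natAbs) (fun _ _ => Nat.zero_le _) (mem_univ k)
    omega
  refine ⟨p₁ + 1, fun s hs hsr => ?_⟩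
  have hcons : ∀ i ∈ Kᶜ, ∀ j ∈ i ::ₘ s, j ∈ Kᶜ := by
    intro i hi j hj
    rcases Multiset.mem_cons.mp hj with rfl | hj
    · exact hi
    · exact hs j hj
  have hneg : ∀ p ≥ p₀, ∀ i ∈ Kᶜ, IsNegligible T (p * K.card + (r + 1))
      (prodForm ξ K ^ p * multForm ξ (i ::ₘ s)) := fun p hp i hi =>
    pow_split hp _ (h _ (hcons i hi) (by rw [Multiset.card_cons, hsr]))
  obtain ⟨E, hE⟩ : ∃ E, E = (p₁ + 1) * K.card + r := ⟨_, rfl⟩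
  have hHh : (prodForm ξ K ^ (p₁ + 1) * multForm ξ s).IsHomogeneous E := by
    rw [hE, ← hsr, mul_comm (p₁ + 1)]
    exact ((prodForm_isHomogeneous K).pow _).mul (multForm_isHomogeneous s)
  have t1 := fun k => isSmall_latticeDeriv hT (fun i hi => hl i (mem_compl.mpr hi) k) (hχ k)
    (hp₁ k) k s (hsr.symm ▸ hE)
  have t2 := fun i (hi : i ∈ Kᶜ) => isSmall_dirDeriv_prodForm (hneg p₁ hp₀ i hi)
    ((p₁ + 1 : ℕ) : ℂ) (fun j => (e i j : ℂ)) hE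
  have t3 := fun i (hi : i ∈ Kᶜ) => isSmall_mul_dirDeriv (E := E)
    (h := prodForm ξ K ^ (p₁ + 1) * multForm ξ (i ::ₘ s))
    (by rw [hE, add_assoc]; exact hneg (p₁ + 1) (by omega) i hi) (fun j => (e i j : ℂ))
  have tot := ((IsSmall.sum Finset.univ fun k _ => t1 k).const_mul (m : ℂ)⁻¹).add
    ((IsSmall.sum Kᶜ t2).add (IsSmall.sum Kᶜ t3))
  rw [← hE]
  refine tot.of_mul (r := r) (κ := (m : ℂ)⁻¹ * ∑ k, (l k k : ℂ)) fun γ => ?_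
  have hhom : (prodForm ξ K ^ (p₁ + 1) * multForm ξ s * monomial γ (1 : ℂ)).IsHomogeneous
      (γ.degree + E) := by
    rw [add_comm γ.degree E]
    exact hHh.mul (isHomogeneous_monomial (1 : ℂ) (rfl : γ.degree = γ.degree))
  have key := congrArg T (euler_split_mul hm hl he hs (prodForm ξ K) (monomial γ 1) p₁
    (γ.degree + E) hhom)
  rw [← smul_eq_C_mul, map_smul, smul_eq_mul, ← smul_eq_C_mul, map_add, map_add, map_smul, map_sum,
    map_sum, map_sum, smul_eq_mul, hsr] at key
  rw [key, ← Finset.sum_div, ← Finset.sum_div, ← Finset.sum_div, add_div, add_div, mul_div_assoc,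
    add_assoc]

/-- Downward induction on `K`, starting with the set of all weights; the goal is `K = ∅`, where the
power is `1`. Take lattice vectors `l k` spanning the common kernel of the weights outside `K`. If
some `χ(l k) ≠ 1`, the trace relation suffices; otherwise the number of weights outside `K` is
lowered step by step by `isNegligible_descend`. -/
theorem exists_isNegligible_pow {χ : (Fin d → ℤ) → ℂ} (hT : TraceRelation ξ b χ T) (c : ℕ) :
    ∀ K : Finset (Fin n), Kᶜ.card = c → ∃ p, IsNegligible T (p * K.card) (prodForm ξ K ^ p) := by
  classical
  induction c with
  | zero | succ c ih => ?_
  all_goals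
    intro K hK
    obtain ⟨m, l, e, hm, hl, he⟩ := exists_lattice_projection ξ Kᶜ
    by_cases hχ : ∃ k, χ (l k) ≠ 1
    · obtain ⟨k, hk⟩ := hχ
      obtain ⟨M, e', hM, hMq, hMe⟩ := prodForm_pow_eq (ξ := ξ) (K := K) (l := l k)
        (m := ∑ i, (pairing (ξ i) (l k)).natAbs)
        (fun i hi => hl i (mem_compl.mpr hi) k)
        (fun i => Finset.single_le_sum (f := fun i => (pairing (ξ i) (l k)).natAbs)
          (fun _ _ => Nat.zero_le _) (mem_univ i))
      exact ⟨_, by rw [hMq, hMe]; exact isNegligible_of_ne_one hT hk hM⟩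
    push Not at hχ
    have descend : ∀ R p₀, (∀ s : Multiset (Fin n), (∀ i ∈ s, i ∈ Kᶜ) → Multiset.card s = R →
        IsNegligible T (p₀ * K.card + R) (prodForm ξ K ^ p₀ * multForm ξ s)) →
        ∃ p, IsNegligible T (p * K.card) (prodForm ξ K ^ p) := by
      intro R
      induction R with
      | zero =>
        intro p₀ h
        have := h 0 (by simp) rfl
        exact ⟨p₀, by simpa [multForm] using this⟩
      | succ R ihR =>
        intro p₀ h
        obtain ⟨p, hp⟩ := isNegligible_descend hT hm hl he hχ h
        exact ihR p hp
  -- There are no weights outside `K`, so a product containing one of them does not exist and the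
  -- hypothesis is vacuous.
  · refine descend 1 0 fun s hs hs1 => ?_
    obtain ⟨a, rfl⟩ := Multiset.card_eq_one.mp hs1
    have := hs a (Multiset.mem_singleton_self a)
    rw [Finset.card_eq_zero.mp hK] at this
    simp at this
  · have h1 : ∀ i, ∃ p, i ∈ Kᶜ →
        IsNegligible T (p * K.card + p) (prodForm ξ K ^ p * linearForm (ξ i) ^ p) := by
      intro i
      by_cases hi : i ∈ Kᶜ
      · have hiK := mem_compl.mp hi
        obtain ⟨p, hp⟩ := ih (insert i K) (by
          rw [Finset.card_compl, Finset.card_insert_of_notMem hiK]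
          rw [Finset.card_compl] at hK
          omega)
        refine ⟨p, fun _ => ?_⟩
        have e1 : p * (insert i K).card = p * K.card + p := by
          rw [Finset.card_insert_of_notMem hiK]; ring
        have e2 : prodForm ξ (insert i K) ^ p = prodForm ξ K ^ p * linearForm (ξ i) ^ p := by
          rw [prodForm, Finset.prod_insert hiK, mul_pow, mul_comm]; rfl
        rwa [e1, e2] at hp
      · exact ⟨0, fun h => absurd h hi⟩
    choose p hp using h1
    set S := ∑ i, p i with hS
    -- Pigeonhole: a product of `n S + 1` weights contains some `ξ_i` more than `S` times, and then
    -- the induction hypothesis for `insert i K` applies.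
    refine descend (n * S + 1) S fun s hs hsc => ?_
    obtain ⟨i, hi⟩ : ∃ i, S < s.count i := by
      by_contra hcon
      push Not at hcon
      have h2 : ∑ i, s.count i ≤ ∑ _i : Fin n, S := Finset.sum_le_sum fun i _ => hcon i
      rw [Multiset.sum_count_eq_card (fun a _ => mem_univ a), hsc, Finset.sum_const] at h2
      simp at h2
    have hiK : i ∈ Kᶜ := hs i (Multiset.count_pos.mp (by omega))
    have hpS : p i ≤ S := Finset.single_le_sum (fun _ _ => Nat.zero_le _) (mem_univ i)
    have h3 := pow_split hpS _ (hp i hiK)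
    obtain ⟨t, ht⟩ := Multiset.le_iff_exists_add.mp
      (Multiset.le_count_iff_replicate_le.mp (show p i ≤ s.count i by omega))
    have h4 := h3.mul (multForm_isHomogeneous (ξ := ξ) t)
    have h5 : multForm ξ s = linearForm (ξ i) ^ (p i) * multForm ξ t := by
      rw [ht, multForm, Multiset.map_add, Multiset.prod_add, Multiset.map_replicate,
        Multiset.prod_replicate, multForm]
    have h6 : Multiset.card s = p i + Multiset.card t := by
      rw [ht, Multiset.card_add, Multiset.card_replicate]
    rw [h5, ← hsc, h6, ← mul_assoc, ← add_assoc]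
    exact h4

/-- Functionals which satisfy the trace relation have moments of factorial growth. -/
theorem exists_growth {χ : (Fin d → ℤ) → ℂ} (hT : TraceRelation ξ b χ T) :
    ∃ A K : ℝ, 0 ≤ A ∧ 1 ≤ K ∧
      ∀ γ : Fin d →₀ ℕ, ‖T (monomial γ 1)‖ ≤ A * K ^ γ.degree * (γ.degree)! := by
  obtain ⟨p, hp⟩ := exists_isNegligible_pow hT _ ∅ rfl
  have h1 : IsNegligible T 0 1 := by simpa [prodForm] using hp
  obtain ⟨C, K₀, N₀, hC, hK₀, h⟩ := h1
  simp only [one_mul, add_zero] at h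
  -- This makes `C / K ≤ 1`, so the bound reproduces itself in the next degree; `A` below takes care
  -- of the degrees less than `N₀`.
  obtain ⟨K, hK⟩ : ∃ K, K = K₀ + C := ⟨_, rfl⟩
  obtain ⟨A, hA⟩ : ∃ A, A = ∑ l ∈ range N₀, momentBound T l := ⟨_, rfl⟩
  have hK1 : 1 ≤ K := by linarith
  have hK0 : 0 < K := by linarith
  have hA0 : 0 ≤ A := by
    rw [hA]; exact Finset.sum_nonneg fun l _ => momentBound_nonneg (T := T) l
  have main : ∀ N, momentBound T N ≤ A * K ^ N * N ! := by
    intro N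
    induction N using Nat.strong_induction_on with
    | _ N ih =>
    by_cases hN : N < N₀
    · have h2 : momentBound T N ≤ A := by
        rw [hA]
        exact Finset.single_le_sum (f := momentBound T) (fun l _ => momentBound_nonneg (T := T) l)
          (mem_range.mpr hN)
      have h4 : (1 : ℝ) ≤ N ! := by exact_mod_cast Nat.factorial_pos N
      have h3 : (1 : ℝ) ≤ K ^ N * N ! := one_le_mul_of_one_le_of_one_le (one_le_pow₀ hK1) h4
      rw [mul_assoc]
      exact h2.trans (le_mul_of_one_le_right hA0 h3)
    · refine momentBound_le (by positivity) fun γ hγ => ?_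
      have h2 := h K (by linarith) A hA0 γ (by omega) (by rw [hγ]; exact ih)
      rw [hγ] at h2
      refine h2.trans ?_
      have h3 : C / K ≤ 1 := div_le_one_of_le₀ (by linarith) hK0.le
      exact mul_le_of_le_one_left (by positivity) h3
  exact ⟨A, K, hA0, hK1, fun γ => (norm_le_momentBound γ).trans (main _)⟩

end GrowthTheorem

end AbelianCoulomb

end

noncomputable section

namespace AbelianCoulomb

universe u

/-! ### The spectral theorem for commuting bounded self-adjoint operators, in cyclic form -/

section Spectral

open MeasureTheory ComplexConjugate
open scoped CompactlySupported ENNReal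

/-- Commuting self-adjoint operators come from a representation of an algebra `C(X, ℂ)`. -/
theorem exists_representation {H : Type u} [NormedAddCommGroup H] [InnerProductSpace ℂ H]
    [CompleteSpace H] (S : Set (H →L[ℂ] H)) (hsa : ∀ B ∈ S, IsSelfAdjoint B)
    (hcomm : ∀ B ∈ S, ∀ B' ∈ S, B * B' = B' * B) :
    ∃ (X : Type u) (_ : TopologicalSpace X) (_ : CompactSpace X) (_ : T2Space X)
      (Φ : C(X, ℂ) →⋆ₐ[ℂ] (H →L[ℂ] H)), ∀ B ∈ S, ∃ g : C(X, ℂ), Φ g = B ∧ star g = g := by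
  have hstar : ∀ B ∈ S, ∀ B' ∈ S, B * star B' = star B' * B := fun B hB B' hB' => by
    rw [(hsa B' hB').star_eq]; exact hcomm B hB B' hB'
  have hA : IsMulCommutative (StarAlgebra.adjoin ℂ S) := 
    StarAlgebra.isMulCommutative_adjoin ℂ hcomm hstar
  let A := (StarAlgebra.adjoin ℂ S).topologicalClosure
  let : CStarAlgebra A := StarSubalgebra.cstarAlgebra A
    (h_closed := StarSubalgebra.isClosed_topologicalClosure _)
  have hmul : ∀ x y : A, x * y = y * x := by
    let := StarSubalgebra.commRingTopologicalClosure (StarAlgebra.adjoin ℂ S)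
      (fun x y => hA.is_comm.comm x y)
    exact fun x y => mul_comm x y
  let : CommCStarAlgebra A := { (inferInstance : CStarAlgebra A) with mul_comm := hmul }
  refine ⟨WeakDual.characterSpace ℂ A, inferInstance, inferInstance, inferInstance,
    -- The inverse Gelfand transform of the commutative C*-algebra generated by the operators,
    -- followed by its inclusion into all operators.
    (StarSubalgebra.subtype A).comp (gelfandStarTransform A).symm.toStarAlgHom, fun B hB => ?_⟩
  have hBA : B ∈ A := StarSubalgebra.le_topologicalClosure _ (StarAlgebra.subset_adjoin ℂ S hB)
  refine ⟨gelfandStarTransform A ⟨B, hBA⟩, ?_, ?_⟩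
  · simp
  · rw [← map_star]
    congr 1
    exact Subtype.ext (hsa B hB).star_eq

/-- The functional `g ↦ ⟨e, Φ(g) e⟩` is positive because `f = (√f)²` for `f ≥ 0`, so the
Riesz–Markov theorem applies. -/
theorem exists_spectral_measure {H X : Type*} [NormedAddCommGroup H] [InnerProductSpace ℂ H]
    [CompleteSpace H] [TopologicalSpace X] [CompactSpace X] [T2Space X] [MeasurableSpace X]
    [BorelSpace X] (Φ : C(X, ℂ) →⋆ₐ[ℂ] (H →L[ℂ] H)) (e : H) :
    ∃ μ : Measure X, μ.Regular ∧ IsFiniteMeasure μ ∧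
      ∀ g : C(X, ℂ), ∫ x, g x ∂μ = inner ℂ e (Φ g e) := by
  let toC : C_c(X, ℝ) → C(X, ℂ) := fun f => ⟨fun x => (f x : ℂ), by fun_prop⟩
  have hpos : ∀ f : C_c(X, ℝ), (∀ x, 0 ≤ f x) → 0 ≤ (inner ℂ e (Φ (toC f) e)).re := by
    intro f hf
    let r : C(X, ℂ) := ⟨fun x => (Real.sqrt (f x) : ℂ), by fun_prop⟩
    have h1 : toC f = star r * r := by
      ext x
      simp only [toC, r, ContinuousMap.coe_mk, ContinuousMap.mul_apply, ContinuousMap.star_apply,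
        Complex.star_def, Complex.conj_ofReal]
      rw [← Complex.ofReal_mul, Real.mul_self_sqrt (hf x)]
    rw [h1, map_mul, map_star, ContinuousLinearMap.star_eq_adjoint, mul_apply_eq_comp,
      ContinuousLinearMap.adjoint_inner_right, inner_self_eq_norm_sq_to_K]
    rw [← RCLike.ofReal_pow]
    exact sq_nonneg ‖Φ r e‖
  have hadd : ∀ f g, toC (f + g) = toC f + toC g := fun f g => by ext x; simp [toC]
  have hsmul : ∀ (c : ℝ) f, toC (c • f) = (c : ℂ) • toC f := fun c f => by ext x; simp [toC]
  let Λ₀ : C_c(X, ℝ) →ₗ[ℝ] ℝ :=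
    { toFun := fun f => (inner ℂ e (Φ (toC f) e)).re
      map_add' := fun f g => by
        rw [hadd, map_add, add_apply, inner_add_right, Complex.add_re]
      map_smul' := fun c f => by
        rw [hsmul, map_smul, smul_apply, inner_smul_right]
        simp }
  let Λ : C_c(X, ℝ) →ₚ[ℝ] ℝ := PositiveLinearMap.mk₀ Λ₀ fun f hf => hpos f fun x => hf x
  refine ⟨RealRMK.rieszMeasure Λ, inferInstance, inferInstance, fun g => ?_⟩
  have hreal : ∀ f : C_c(X, ℝ), (∫ x, (f x : ℂ) ∂(RealRMK.rieszMeasure Λ)) =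
      inner ℂ e (Φ (toC f) e) := by
    intro f
    rw [integral_complex_ofReal, RealRMK.integral_rieszMeasure Λ f]
    have h1 : star (toC f) = toC f := by ext x; simp [toC]
    have h2 : conj (inner ℂ e (Φ (toC f) e)) = inner ℂ e (Φ (toC f) e) := by
      rw [inner_conj_symm, ← ContinuousLinearMap.adjoint_inner_right,
        ← ContinuousLinearMap.star_eq_adjoint, ← map_star, h1]
    exact Complex.conj_eq_iff_re.mp h2
  let re : C_c(X, ℝ) := ⟨⟨fun x => (g x).re, by fun_prop⟩, HasCompactSupport.of_compactSpace _⟩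
  let im : C_c(X, ℝ) := ⟨⟨fun x => (g x).im, by fun_prop⟩, HasCompactSupport.of_compactSpace _⟩
  have hg : g = toC re + Complex.I • toC im := by
    ext x
    simp only [toC, re, im, ContinuousMap.add_apply, ContinuousMap.smul_apply, smul_eq_mul,
      ContinuousMap.coe_mk]
    rw [mul_comm]
    exact (Complex.re_add_im (g x)).symm
  have hi : ∀ f : C(X, ℂ), Integrable f (RealRMK.rieszMeasure Λ) := fun f =>
    f.continuous.integrable_of_hasCompactSupport (HasCompactSupport.of_compactSpace _)
  have h3 : ∫ x, g x ∂(RealRMK.rieszMeasure Λ) = (∫ x, (re x : ℂ) ∂(RealRMK.rieszMeasure Λ)) +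
      Complex.I * ∫ x, (im x : ℂ) ∂(RealRMK.rieszMeasure Λ) := by
    rw [← integral_const_mul]
    refine Eq.trans ?_ (integral_add (hi (toC re)) ((hi (toC im)).const_mul _))
    rw [hg]
    rfl
  rw [h3, hg, map_add, map_smul, add_apply, smul_apply, inner_add_right, inner_smul_right,
    ← hreal, ← hreal]

/-- The cyclic representation generated by `e` is multiplication on an `L²` space. -/
theorem exists_isometry {H X : Type*} [NormedAddCommGroup H] [InnerProductSpace ℂ H]
    [CompleteSpace H] [TopologicalSpace X] [CompactSpace X] [T2Space X] [MeasurableSpace X]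
    [BorelSpace X] (Φ : C(X, ℂ) →⋆ₐ[ℂ] (H →L[ℂ] H)) (e : H) :
    ∃ μ : Measure X, IsFiniteMeasure μ ∧ ∃ W : Lp ℂ 2 μ →ₗᵢ[ℂ] H,
      (∀ F : Lp ℂ 2 μ, F =ᵐ[μ] 1 → W F = e) ∧
      ∀ (g : C(X, ℂ)) (F G : Lp ℂ 2 μ), G =ᵐ[μ] (fun x => g x * F x) → W G = Φ g (W F) := by
  obtain ⟨μ, hreg, hfin, hμ⟩ := exists_spectral_measure Φ e
  let ι : C(X, ℂ) →L[ℂ] Lp ℂ 2 μ := ContinuousMap.toLp 2 μ ℂ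
  have hdense : DenseRange ι := ContinuousMap.toLp_denseRange ℂ μ ℂ (by norm_num)
  let W₀ : C(X, ℂ) →ₗ[ℂ] H :=
    { toFun := fun g => Φ g e
      map_add' := fun f g => by rw [map_add, add_apply]
      map_smul' := fun c f => by rw [map_smul, smul_apply]; rfl }
  -- `‖Φ(g) e‖² = ⟨e, Φ(ḡ g) e⟩ = ∫ |g|² dμ`; hence `g ↦ Φ(g) e` extends isometrically from the
  -- dense continuous functions to `L²`.
  have hnorm : ∀ g, ‖W₀ g‖ = ‖ι g‖ := by
    intro g
    have h1 : inner ℂ (W₀ g) (W₀ g) = inner ℂ (ι g) (ι g) := by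
      rw [ContinuousMap.inner_toLp]
      change inner ℂ (Φ g e) (Φ g e) = _
      rw [← ContinuousLinearMap.adjoint_inner_right, ← ContinuousLinearMap.star_eq_adjoint,
        ← map_star, ← mul_apply_eq_comp, ← map_mul, ← hμ]
      refine integral_congr_ae (Filter.Eventually.of_forall fun x => ?_)
      simp [mul_comm]
    rw [inner_self_eq_norm_sq_to_K, inner_self_eq_norm_sq_to_K] at h1
    have h2 : ‖W₀ g‖ ^ 2 = ‖ι g‖ ^ 2 := by exact_mod_cast h1
    exact (sq_eq_sq₀ (norm_nonneg _) (norm_nonneg _)).mp h2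
  have hbd : ∃ C, ∀ g, ‖W₀ g‖ ≤ C * ‖ι.toLinearMap g‖ :=
    ⟨1, fun g => by rw [one_mul]; exact (hnorm g).le⟩
  let W₁ : Lp ℂ 2 μ →L[ℂ] H := W₀.extendOfNorm ι.toLinearMap
  have hW₁ : ∀ g, W₁ (ι g) = Φ g e := fun g =>
    LinearMap.extendOfNorm_eq (e := ι.toLinearMap) hdense hbd g
  have hWn : ∀ F, ‖W₁ F‖ = ‖F‖ := fun F => by
    refine hdense.induction_on (p := fun F => ‖W₁ F‖ = ‖F‖) F
      (isClosed_eq (by fun_prop) (by fun_prop)) fun g => ?_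
    rw [hW₁]
    exact hnorm g
  refine ⟨μ, hfin, ⟨W₁.toLinearMap, hWn⟩, fun F hF => ?_, fun g F G hG => ?_⟩
  · have : F = ι 1 := by
      refine Lp.ext (hF.trans ?_)
      exact (ContinuousMap.coeFn_toLp (p := 2) (𝕜 := ℂ) μ (1 : C(X, ℂ))).symm
    rw [this]
    change W₁ (ι 1) = e
    rw [hW₁, map_one, one_apply_eq_self]
  · let γ : Lp ℂ ∞ μ := ContinuousMap.toLp ∞ μ ℂ g
    let M : Lp ℂ 2 μ →L[ℂ] Lp ℂ 2 μ := (ContinuousLinearMap.mul ℂ ℂ).holderL μ ∞ 2 2 γ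
    have hM : ∀ F : Lp ℂ 2 μ, M F =ᵐ[μ] fun x => g x * F x := by
      intro F
      refine ((ContinuousLinearMap.mul ℂ ℂ).coeFn_holder γ F).trans ?_
      filter_upwards [ContinuousMap.coeFn_toLp (p := ∞) (𝕜 := ℂ) μ g] with x hx
      rw [ContinuousLinearMap.mul_apply', hx]
    have hG' : G = M F := Lp.ext (hG.trans (hM F).symm)
    rw [hG']
    change W₁ (M F) = Φ g (W₁ F)
    refine hdense.induction_on (p := fun F => W₁ (M F) = Φ g (W₁ F)) F
      (isClosed_eq (by fun_prop) (by fun_prop)) fun f => ?_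
    have : M (ι f) = ι (g * f) := by
      refine Lp.ext ((hM _).trans ?_)
      filter_upwards [ContinuousMap.coeFn_toLp (p := 2) (𝕜 := ℂ) μ f,
        ContinuousMap.coeFn_toLp (p := 2) (𝕜 := ℂ) μ (g * f)] with x hx hx'
      rw [hx', hx]
      rfl
    rw [this, hW₁, hW₁, map_mul, mul_apply_eq_comp]

end Spectral

end AbelianCoulomb

end

noncomputable section

namespace AbelianCoulomb

/-! ### Commuting symmetric operators with factorial growth -/

section Exponentials

open Finset Filter
open scoped Nat
open UniformSpace (Completion)

theorem factorial_add_le (m n : ℕ) : ((m + n)! : ℝ) ≤ 2 ^ (m + n) * (m ! * n !) := by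
  have h1 : (m + n)! = (m + n).choose m * m ! * n ! := by
    rw [← Nat.add_choose_mul_factorial_mul_factorial m n, Nat.choose_symm_add]
  have h2 : ((m + n).choose m : ℝ) ≤ 2 ^ (m + n) := by exact_mod_cast Nat.choose_le_two_pow _ _
  rw [h1]
  push_cast
  rw [mul_assoc]
  exact mul_le_mul_of_nonneg_right h2 (by positivity)

theorem norm_double_le {A K x y z : ℝ} {m n : ℕ} (hA : 0 ≤ A) (hK : 0 ≤ K) (hx : 0 ≤ x)
    (hy : 0 ≤ y) (hz : z ≤ A * K ^ (m + n) * (m + n)!) :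
    x ^ m / m ! * (y ^ n / n !) * z ≤ A * ((2 * K * x) ^ m * (2 * K * y) ^ n) := by
  have h1 : z ≤ A * K ^ (m + n) * (2 ^ (m + n) * (m ! * n !)) :=
    hz.trans (mul_le_mul_of_nonneg_left (factorial_add_le m n) (by positivity))
  refine (mul_le_mul_of_nonneg_left h1 (by positivity)).trans_eq ?_
  have hm : (m ! : ℝ) ≠ 0 := by positivity
  have hn : (n ! : ℝ) ≠ 0 := by positivity
  field_simp
  ring

theorem summable_double {E : Type*} [NormedAddCommGroup E] [NormedSpace ℂ E] [CompleteSpace E]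
    {u : ℕ → ℕ → E} {A K : ℝ} (hA : 0 ≤ A) (hK : 0 ≤ K)
    (hu : ∀ m n, ‖u m n‖ ≤ A * K ^ (m + n) * (m + n)!) {s t : ℂ} (hs : 2 * K * ‖s‖ < 1)
    (ht : 2 * K * ‖t‖ < 1) :
    Summable fun p : ℕ × ℕ => (s ^ p.1 / p.1 ! * (t ^ p.2 / p.2 !)) • u p.1 p.2 := by
  have h1 : Summable fun p : ℕ × ℕ => A * ((2 * K * ‖s‖) ^ p.1 * (2 * K * ‖t‖) ^ p.2) :=
    (Summable.mul_of_nonneg (summable_geometric_of_lt_one (by positivity) hs)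
      (summable_geometric_of_lt_one (by positivity) ht) (fun _ => by positivity)
      (fun _ => by positivity)).mul_left A
  refine Summable.of_norm_bounded h1 fun p => ?_
  rw [norm_smul, norm_mul, norm_div, norm_div, norm_pow, norm_pow, Complex.norm_natCast,
    Complex.norm_natCast]
  exact norm_double_le hA hK (norm_nonneg _) (norm_nonneg _) (hu p.1 p.2)

/-- This is `exp(-s) exp(s) = 1`: summed along antidiagonals, degree `N` contributes `(-s + s)^N /
N!`. The factor 2 in `2 K ‖s‖ < 1` comes from `(m + n)! ≤ 2^(m+n) m! n!`. -/
theorem tsum_double_eq {E : Type*} [NormedAddCommGroup E] [NormedSpace ℂ E] [CompleteSpace E]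
    {u : ℕ → E} {A K : ℝ} (hA : 0 ≤ A) (hK : 0 ≤ K) (hu : ∀ n, ‖u n‖ ≤ A * K ^ n * n !) {s : ℂ}
    (hs : 2 * K * ‖s‖ < 1) :
    ∑' n, ∑' m, ((-s) ^ m / m ! * (s ^ n / n !)) • u (m + n) = u 0 := by
  have hsum := summable_double (u := fun m n => u (m + n)) hA hK (fun m n => hu (m + n))
    (s := -s) (t := s) (by rwa [norm_neg]) hs
  rw [← (hsum.prod_symm).tsum_prod (f := fun p : ℕ × ℕ => ((-s) ^ p.2 / p.2 ! * (s ^ p.1 / p.1 !)) •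
    u (p.2 + p.1)), ← (Equiv.prodComm ℕ ℕ).tsum_eq,
    ← Finset.HasAntidiagonal.sigmaAntidiagonalEquivProd.tsum_eq, Summable.tsum_sigma']
  · rw [tsum_eq_single 0]
    · simp [tsum_fintype]
    · intro N hN
      rw [tsum_fintype]
      have h1 : ∀ p ∈ antidiagonal N, ((-s) ^ p.1 / p.1 ! * (s ^ p.2 / p.2 !)) • u (p.1 + p.2) =
          ((N ! : ℂ)⁻¹ * ((-s) ^ p.1 * s ^ p.2 * (N.choose p.1 : ℂ))) • u N := by
        intro p hp
        have hp' := mem_antidiagonal.mp hp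
        rw [hp']
        congr 1
        have h2 : (N.choose p.1 : ℂ) * p.1 ! * p.2 ! = N ! := by
          have h3 := Nat.add_choose_mul_factorial_mul_factorial p.1 p.2
          rw [← Nat.choose_symm_add] at h3
          rw [← hp']
          exact_mod_cast h3
        rw [← h2]
        have h3 : (p.1 ! : ℂ) ≠ 0 := by exact_mod_cast Nat.factorial_ne_zero _
        have h4 : (p.2 ! : ℂ) ≠ 0 := by exact_mod_cast Nat.factorial_ne_zero _
        have h5 : (N.choose p.1 : ℂ) ≠ 0 := by
          exact_mod_cast (Nat.choose_pos (by omega)).ne'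
        field_simp
      refine (Finset.sum_coe_sort (antidiagonal N) fun p : ℕ × ℕ =>
        ((-s) ^ p.1 / p.1 ! * (s ^ p.2 / p.2 !)) • u (p.1 + p.2)).trans ?_
      rw [Finset.sum_congr rfl h1, ← Finset.sum_smul, ← Finset.mul_sum]
      have h6 := (Commute.all (-s) s).add_pow' N
      simp only [nsmul_eq_mul] at h6
      have h7 : ∑ p ∈ antidiagonal N, (-s) ^ p.1 * s ^ p.2 * (N.choose p.1 : ℂ) = 0 := by
        rw [← zero_pow hN, ← neg_add_cancel s, h6]
        exact Finset.sum_congr rfl fun _ _ => mul_comm _ _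
      rw [h7, mul_zero, zero_smul]
  · exact fun N => (hasSum_fintype _).summable
  · exact (Finset.HasAntidiagonal.sigmaAntidiagonalEquivProd.summable_iff (f := fun p : ℕ × ℕ =>
      ((-s) ^ p.1 / p.1 ! * (s ^ p.2 / p.2 !)) • u (p.1 + p.2))).mpr hsum

variable {ι P : Type*} [NormedAddCommGroup P] [InnerProductSpace ℂ P]

/-- Commuting symmetric operators, with growth of powers controlled by `K`. -/
structure IsAnalyticFamily (Z : ι → Module.End ℂ P) (K : ℝ) : Prop where
  nonneg : 0 ≤ K
  symm : ∀ k f g, inner ℂ (Z k f) g = inner ℂ f (Z k g)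
  comm : ∀ k l, Commute (Z k) (Z l)
  growth : ∀ f, ∃ A, 0 ≤ A ∧ ∀ k l m n, ‖(Z k ^ m * Z l ^ n) f‖ ≤ A * K ^ (m + n) * (m + n)!

variable {Z : ι → Module.End ℂ P} {K : ℝ}

theorem IsAnalyticFamily.growth_pow (h : IsAnalyticFamily Z K) (f : P) :
    ∃ A, 0 ≤ A ∧ ∀ k m, ‖(Z k ^ m) f‖ ≤ A * K ^ m * m ! := by
  obtain ⟨A, hA, hg⟩ := h.growth f
  exact ⟨A, hA, fun k m => by simpa using hg k k m 0⟩

/-- The term of degree `m` of `exp (s Z) f`. -/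
def expTerm (Z : Module.End ℂ P) (s : ℂ) (f : P) (m : ℕ) : Completion P :=
  (s ^ m / m ! : ℂ) • (((Z ^ m) f : P) : Completion P)

theorem IsAnalyticFamily.summable (h : IsAnalyticFamily Z K) (k : ι) (f : P) {s : ℂ}
    (hs : 2 * K * ‖s‖ < 1) : Summable (expTerm (Z k) s f) := by
  obtain ⟨A, hA, hg⟩ := h.growth_pow f
  have h0 : 0 ≤ K * ‖s‖ := mul_nonneg h.nonneg (norm_nonneg _)
  have h1 : Summable fun m => A * (K * ‖s‖) ^ m :=
    (summable_geometric_of_lt_one h0 (by nlinarith)).mul_left A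
  refine Summable.of_norm_bounded h1 fun m => ?_
  rw [expTerm, norm_smul, norm_div, norm_pow, Complex.norm_natCast, Completion.norm_coe]
  refine (mul_le_mul_of_nonneg_left (hg k m) (by positivity)).trans_eq ?_
  have hm : (m ! : ℝ) ≠ 0 := by positivity
  field_simp
  ring

/-- The exponential `exp (s Z)` on the dense domain. -/
def expMap (h : IsAnalyticFamily Z K) (k : ι) (s : ℂ) (hs : 2 * K * ‖s‖ < 1) :
    P →ₗ[ℂ] Completion P where
  toFun f := ∑' m, expTerm (Z k) s f m
  map_add' f g := by
    rw [← (h.summable k f hs).tsum_add (h.summable k g hs)]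
    refine tsum_congr fun m => ?_
    rw [expTerm, map_add, Completion.coe_add, smul_add]
    rfl
  map_smul' c f := by
    rw [RingHom.id_apply, ← (h.summable k f hs).tsum_const_smul]
    refine tsum_congr fun m => ?_
    rw [expTerm, map_smul, Completion.coe_smul, smul_comm]
    rfl

theorem IsAnalyticFamily.symm_pow (h : IsAnalyticFamily Z K) (k : ι) (m : ℕ) (f g : P) :
    inner ℂ ((Z k ^ m) f) g = inner ℂ f ((Z k ^ m) g) := by
  induction m generalizing f with
  | zero => rfl
  | succ m ih => rw [pow_succ, Module.End.mul_apply, ih, h.symm, ← Module.End.mul_apply, ← pow_succ',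
    pow_succ]

theorem hasSum_inner_left {E : Type*} [NormedAddCommGroup E] [InnerProductSpace ℂ E]
    {f : ℕ → E} (hf : Summable f) (g : E) :
    HasSum (fun m => inner ℂ (f m) g) (inner ℂ (∑' m, f m) g) := by
  have := (hf.hasSum.mapL (innerSL ℂ g)).star
  simpa only [innerSL_apply_apply, RCLike.star_def, inner_conj_symm] using this

/-- Symmetry of `Z` moves all powers to one side, and `⟨exp(σZ) f, exp(σZ) f⟩` with `σ` imaginary
becomes the double series of `tsum_double_eq`. -/
theorem norm_expMap (h : IsAnalyticFamily Z K) (k : ι) (s : ℝ) (hs : 2 * K * ‖(Complex.I * s : ℂ)‖ < 1)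
    (f : P) : ‖expMap h k (Complex.I * s) hs f‖ = ‖f‖ := by
  set σ : ℂ := Complex.I * s with hσ
  have hconj : (starRingEnd ℂ) σ = -σ := by simp [hσ]
  obtain ⟨A, hA, hg⟩ := h.growth_pow f
  have hS := h.summable k f hs
  have hmn : ∀ m n, inner ℂ (expTerm (Z k) σ f m) (expTerm (Z k) σ f n) =
      ((-σ) ^ m / m ! * (σ ^ n / n !)) • inner ℂ f ((Z k ^ (m + n)) f) := by
    intro m n
    rw [expTerm, expTerm, inner_smul_left, inner_smul_right, Completion.inner_coe, h.symm_pow,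
      ← Module.End.mul_apply, ← pow_add, map_div₀, map_pow, hconj, map_natCast, smul_eq_mul,
      ← mul_assoc]
  have h1 : inner ℂ (expMap h k σ hs f) (expMap h k σ hs f) = inner ℂ f f := by
    change inner ℂ (∑' m, expTerm (Z k) σ f m) (∑' m, expTerm (Z k) σ f m) = _
    have h2 := (hS.hasSum.mapL (innerSL ℂ (∑' m, expTerm (Z k) σ f m))).tsum_eq
    rw [innerSL_apply_apply] at h2
    rw [← h2]
    have h3 := tsum_double_eq (u := fun N => inner ℂ f ((Z k ^ N) f)) (A := ‖f‖ * A)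
      (mul_nonneg (norm_nonneg _) hA) h.nonneg (fun N => (norm_inner_le_norm _ _).trans (by
        rw [mul_assoc, mul_assoc, ← mul_assoc A]
        exact mul_le_mul_of_nonneg_left (hg k N) (norm_nonneg _))) hs
    rw [pow_zero] at h3
    refine Eq.trans (tsum_congr fun n => ?_) h3
    rw [innerSL_apply_apply, ← (hasSum_inner_left hS _).tsum_eq]
    exact tsum_congr fun m => hmn m n
  rw [inner_self_eq_norm_sq_to_K, inner_self_eq_norm_sq_to_K] at h1
  have h2 : ‖expMap h k σ hs f‖ ^ 2 = ‖f‖ ^ 2 := by exact_mod_cast h1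
  exact (sq_eq_sq₀ (norm_nonneg _) (norm_nonneg _)).mp h2

/-- The unitary operator `exp (i s Z)` on the completion. -/
def expUnitary (h : IsAnalyticFamily Z K) (k : ι) (s : ℝ)
    (hs : 2 * K * ‖(Complex.I * s : ℂ)‖ < 1) : Completion P →L[ℂ] Completion P :=
  (expMap h k (Complex.I * s) hs).extendOfNorm (Completion.toComplL (𝕜 := ℂ) (E := P)).toLinearMap

theorem expUnitary_coe (h : IsAnalyticFamily Z K) (k : ι) (s : ℝ)
    (hs : 2 * K * ‖(Complex.I * s : ℂ)‖ < 1) (f : P) :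
    expUnitary h k s hs (f : Completion P) = ∑' m, expTerm (Z k) (Complex.I * s) f m :=
  LinearMap.extendOfNorm_eq (e := (Completion.toComplL (𝕜 := ℂ) (E := P)).toLinearMap)
    Completion.denseRange_coe ⟨1, fun f => by
      rw [one_mul, norm_expMap h k s hs]; exact (Completion.norm_coe f).ge⟩ f

theorem inner_expUnitary (h : IsAnalyticFamily Z K) (k : ι) (s : ℝ)
    (hs : 2 * K * ‖(Complex.I * s : ℂ)‖ < 1) (hs' : 2 * K * ‖(Complex.I * (-s : ℝ) : ℂ)‖ < 1)
    (x y : Completion P) :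
    inner ℂ (expUnitary h k s hs x) y = inner ℂ x (expUnitary h k (-s) hs' y) := by
  induction x, y using Completion.induction_on₂ with
  | hp => exact isClosed_eq (by fun_prop) (by fun_prop)
  | ih f g =>
    have hconj : (starRingEnd ℂ) (Complex.I * s) = Complex.I * (-s : ℝ) := by simp
    have h2 := ((h.summable k g hs').hasSum.mapL (innerSL ℂ (f : Completion P))).tsum_eq
    rw [innerSL_apply_apply] at h2
    rw [expUnitary_coe, expUnitary_coe, ← h2, ← (hasSum_inner_left (h.summable k f hs) _).tsum_eq]
    refine tsum_congr fun m => ?_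
    rw [innerSL_apply_apply, expTerm, expTerm, inner_smul_left, inner_smul_right,
      Completion.inner_coe, Completion.inner_coe, h.symm_pow, map_div₀, map_pow, hconj,
      map_natCast]

/-- Both products are iterated sums of one absolutely convergent double series. This is where the
joint growth bound for `Z_k^m Z_l^n` is needed. -/
theorem expUnitary_comm (h : IsAnalyticFamily Z K) (k l : ι) (s t : ℝ)
    (hs : 2 * K * ‖(Complex.I * s : ℂ)‖ < 1) (ht : 2 * K * ‖(Complex.I * t : ℂ)‖ < 1) :
    expUnitary h k s hs * expUnitary h l t ht = expUnitary h l t ht * expUnitary h k s hs := by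
  ext x
  rw [mul_apply_eq_comp, mul_apply_eq_comp]
  induction x using Completion.induction_on with
  | hp => exact isClosed_eq (by fun_prop) (by fun_prop)
  | ih f =>
    obtain ⟨A, hA, hg⟩ := h.growth f
    rw [expUnitary_coe, expUnitary_coe, ContinuousLinearMap.map_tsum _ (h.summable l f ht),
      ContinuousLinearMap.map_tsum _ (h.summable k f hs)]
    have e1 : ∀ n, expUnitary h k s hs (expTerm (Z l) (Complex.I * t) f n) =
        ∑' m, ((Complex.I * s) ^ m / m ! * ((Complex.I * t) ^ n / n ! : ℂ)) •
          (((Z k ^ m * Z l ^ n) f : P) : Completion P) := by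
      intro n
      rw [expTerm, map_smul, expUnitary_coe, ← (h.summable k _ hs).tsum_const_smul]
      refine tsum_congr fun m => ?_
      rw [expTerm, smul_smul, mul_comm, Module.End.mul_apply]
    have e2 : ∀ m, expUnitary h l t ht (expTerm (Z k) (Complex.I * s) f m) =
        ∑' n, ((Complex.I * s) ^ m / m ! * ((Complex.I * t) ^ n / n ! : ℂ)) •
          (((Z k ^ m * Z l ^ n) f : P) : Completion P) := by
      intro m
      rw [expTerm, map_smul, expUnitary_coe, ← (h.summable l _ ht).tsum_const_smul]
      refine tsum_congr fun n => ?_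
      rw [expTerm, smul_smul, ((h.comm k l).pow_pow m n).eq, Module.End.mul_apply]
    simp only [e1, e2]
    exact Summable.tsum_comm (summable_double (u := fun m n =>
      (((Z k ^ m * Z l ^ n) f : P) : Completion P)) hA h.nonneg
      (fun m n => by rw [Completion.norm_coe]; exact hg k l m n) hs ht)

theorem tendsto_difference_quotient (h : IsAnalyticFamily Z K) (k : ι) (f : P) {σ : ℕ → ℂ}
    (hσ : ∀ j, 2 * K * ‖σ j‖ < 1) (hσ0 : ∀ j, σ j ≠ 0) (hlim : Tendsto σ atTop (𝓝 0)) :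
    Tendsto (fun j => (σ j)⁻¹ • ((∑' m, expTerm (Z k) (σ j) f m) - (f : Completion P))) atTop
      (𝓝 ((Z k f : P) : Completion P)) := by
  obtain ⟨A, hA, hg⟩ := h.growth_pow f
  have e1 : ∀ j, (σ j)⁻¹ • ((∑' m, expTerm (Z k) (σ j) f m) - (f : Completion P)) =
      ∑' m, ((σ j) ^ m / (m + 1)! : ℂ) • (((Z k ^ (m + 1)) f : P) : Completion P) := by
    intro j
    rw [(h.summable k f (hσ j)).tsum_eq_zero_add]
    have : expTerm (Z k) (σ j) f 0 = (f : Completion P) := by simp [expTerm]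
    rw [this, add_sub_cancel_left,
      ← ((summable_nat_add_iff 1).mpr (h.summable k f (hσ j))).tsum_const_smul]
    refine tsum_congr fun m => ?_
    rw [expTerm, smul_smul]
    congr 1
    have := hσ0 j
    rw [pow_succ]
    field_simp
  simp only [e1]
  have e2 : ((Z k f : P) : Completion P) =
      ∑' m, if m = 0 then ((Z k f : P) : Completion P) else 0 := by
    rw [tsum_eq_single 0 (fun m hm => if_neg hm), if_pos rfl]
  rw [e2]
  refine tendsto_tsum_of_dominated_convergence (bound := fun m => A * K * (1 / 2) ^ m)
    ((summable_geometric_of_lt_one (by norm_num) (by norm_num)).mul_left _) (fun m => ?_)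
    (Eventually.of_forall fun j m => ?_)
  · rcases Nat.eq_zero_or_pos m with rfl | hm
    · simp
    · rw [if_neg hm.ne']
      have h1 : Tendsto (fun j => (σ j ^ m / (m + 1)! : ℂ)) atTop (𝓝 0) := by
        have := (hlim.pow m).div_const ((m + 1)! : ℂ)
        rwa [zero_pow hm.ne', zero_div] at this
      have := h1.smul_const (((Z k ^ (m + 1)) f : P) : Completion P)
      rwa [zero_smul] at this
  · rw [norm_smul, norm_div, norm_pow, Complex.norm_natCast, Completion.norm_coe]
    refine (mul_le_mul_of_nonneg_left (hg k (m + 1)) (by positivity)).trans ?_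
    have hm : ((m + 1)! : ℝ) ≠ 0 := by positivity
    have e3 : ‖σ j‖ ^ m / (m + 1)! * (A * K ^ (m + 1) * (m + 1)!) =
        A * K * (K * ‖σ j‖) ^ m := by field_simp; ring
    rw [e3]
    refine mul_le_mul_of_nonneg_left (pow_le_pow_left₀ (mul_nonneg h.nonneg (norm_nonneg _))
      (by linarith [hσ j]) m) (mul_nonneg hA h.nonneg)

/-- Commuting bounded self-adjoint operators approximating an analytic family. -/
theorem exists_bounded_approximation (h : IsAnalyticFamily Z K) :
    ∃ B : ι → ℕ → (Completion P →L[ℂ] Completion P), (∀ k j, IsSelfAdjoint (B k j)) ∧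
      (∀ k j k' j', B k j * B k' j' = B k' j' * B k j) ∧
      ∀ k (f : P), Tendsto (fun j => B k j (f : Completion P)) atTop
        (𝓝 ((Z k f : P) : Completion P)) := by
  obtain ⟨s, hspos, hs, hlim⟩ : ∃ s : ℕ → ℝ, (∀ j, 0 < s j) ∧ (∀ j, 2 * K * s j < 1) ∧
      Tendsto s atTop (𝓝 0) := by
    refine ⟨fun j => 1 / (2 * K + 1) * (1 / ((j : ℝ) + 1)), fun j => ?_, fun j => ?_, ?_⟩
    · have := h.nonneg; positivity
    · have h1 : 1 / ((j : ℝ) + 1) ≤ 1 := by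
        rw [div_le_one (by positivity)]; linarith [Nat.cast_nonneg (α := ℝ) j]
      have h2 : 2 * K * (1 / (2 * K + 1)) < 1 := by
        have := h.nonneg
        rw [mul_one_div, div_lt_one (by positivity)]; linarith
      have h3 : 0 ≤ 2 * K * (1 / (2 * K + 1)) := by have := h.nonneg; positivity
      rw [← mul_assoc]
      exact (mul_le_of_le_one_right h3 h1).trans_lt h2
    · simpa using tendsto_one_div_add_atTop_nhds_zero_nat.const_mul (1 / (2 * K + 1))
  have hp : ∀ j, 2 * K * ‖(Complex.I * s j : ℂ)‖ < 1 := fun j => by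
    rw [norm_mul, Complex.norm_I, one_mul, Complex.norm_real, Real.norm_of_nonneg (hspos j).le]
    exact hs j
  have hm : ∀ j, 2 * K * ‖(Complex.I * (-s j : ℝ) : ℂ)‖ < 1 := fun j => by
    have := hp j
    rwa [Complex.ofReal_neg, mul_neg, norm_neg]
  -- `B k j` plays the role of `sin(s_j Z_k) / s_j`. Exponentials at small parameters suffice, so no
  -- one-parameter group has to be constructed.
  let B : ι → ℕ → (Completion P →L[ℂ] Completion P) := fun k j =>
    (2 * (Complex.I * s j))⁻¹ • (expUnitary h k (s j) (hp j) - expUnitary h k (-s j) (hm j))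
  refine ⟨B, fun k j => ?_, fun k j k' j' => ?_, fun k f => ?_⟩
  · have h1 : ContinuousLinearMap.adjoint (expUnitary h k (s j) (hp j)) =
        expUnitary h k (-s j) (hm j) := by
      refine ((ContinuousLinearMap.eq_adjoint_iff _ _).mpr fun x y => ?_).symm
      have h2 := inner_expUnitary h k (-s j) (hm j) (by rw [neg_neg]; exact hp j) x y
      simpa only [neg_neg] using h2
    have h2 : ContinuousLinearMap.adjoint (expUnitary h k (-s j) (hm j)) =
        expUnitary h k (s j) (hp j) := by rw [← h1, ContinuousLinearMap.adjoint_adjoint]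
    rw [IsSelfAdjoint, ContinuousLinearMap.star_eq_adjoint]
    simp only [B]
    rw [map_smulₛₗ, map_sub, h1, h2, map_inv₀, map_mul, map_mul, Complex.conj_I, Complex.conj_ofReal,
      Complex.conj_ofNat, neg_mul, mul_neg, inv_neg, neg_smul, ← smul_neg, neg_sub]
  · simp only [B, smul_mul_smul_comm, mul_sub, sub_mul]
    rw [expUnitary_comm h k k', expUnitary_comm h k k', expUnitary_comm h k k',
      expUnitary_comm h k k', mul_comm]
    congr 1
    abel
  · have hne : ∀ j, (Complex.I * s j : ℂ) ≠ 0 := fun j =>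
      mul_ne_zero Complex.I_ne_zero (by exact_mod_cast (hspos j).ne')
    have hlim1 : Tendsto (fun j => (Complex.I * s j : ℂ)) atTop (𝓝 0) := by
      have := (Complex.continuous_ofReal.tendsto 0).comp hlim
      simpa using this.const_mul Complex.I
    have hlim2 : Tendsto (fun j => (Complex.I * (-s j : ℝ) : ℂ)) atTop (𝓝 0) := by
      have := hlim1.neg
      simpa using this
    have t1 := tendsto_difference_quotient h k f hp hne hlim1
    have t2 := tendsto_difference_quotient h k f hm (fun j => by simpa using hne j) hlim2
    have t3 := (t1.add t2).const_smul (2⁻¹ : ℂ)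
    have e1 : (2⁻¹ : ℂ) • (((Z k f : P) : Completion P) + ((Z k f : P) : Completion P)) =
        ((Z k f : P) : Completion P) := by
      rw [← two_smul ℂ, smul_smul]; norm_num
    rw [e1] at t3
    refine t3.congr fun j => ?_
    simp only [B]
    rw [smul_apply, sub_apply, expUnitary_coe, expUnitary_coe, Complex.ofReal_neg, mul_neg, inv_neg,
      neg_smul, mul_inv]
    module

end Exponentials

end AbelianCoulomb

end

noncomputable section

namespace AbelianCoulomb

/-! ### The moment problem for functionals with factorial growth -/

section Moments

open Finset Filter MeasureTheory
open scoped Nat ENNReal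
open UniformSpace (Completion)

universe u

/-- Simultaneous diagonalization of an analytic family on the cyclic space of a vector. -/
theorem exists_spectral_functions {ι : Type*} {P : Type u} [NormedAddCommGroup P]
    [InnerProductSpace ℂ P] {Z : ι → Module.End ℂ P} {K : ℝ} (h : IsAnalyticFamily Z K) (e : P) :
    ∃ (X : Type u) (_ : MeasurableSpace X) (μ : Measure X) (_ : IsFiniteMeasure μ)
      (W : Lp ℂ 2 μ →ₗᵢ[ℂ] Completion P) (z : ι → X → ℝ), (∀ k, Measurable (z k)) ∧
      (∀ F : Lp ℂ 2 μ, F =ᵐ[μ] 1 → W F = (e : Completion P)) ∧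
      ∀ k (f : P) (F : Lp ℂ 2 μ), W F = (f : Completion P) →
        ∃ G : Lp ℂ 2 μ, W G = ((Z k f : P) : Completion P) ∧ G =ᵐ[μ] fun x => (z k x : ℂ) * F x := by
  obtain ⟨B, hsa, hcomm, hB⟩ := exists_bounded_approximation h
  obtain ⟨X, _, _, _, Φ, hΦ⟩ := exists_representation (Set.range fun p : ι × ℕ => B p.1 p.2)
    (by rintro _ ⟨p, rfl⟩; exact hsa _ _)
    (by rintro _ ⟨p, rfl⟩ _ ⟨q, rfl⟩; exact hcomm _ _ _ _)
  let _ : MeasurableSpace X := borel X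
  have : BorelSpace X := ⟨rfl⟩
  obtain ⟨μ, hfin, W, hW1, hWmul⟩ := exists_isometry Φ (e : Completion P)
  have hg : ∀ k j, ∃ g : C(X, ℂ), Φ g = B k j ∧ star g = g := fun k j => hΦ _ ⟨(k, j), rfl⟩
  choose g hg hgr using hg
  have hbdd : ∀ (c : C(X, ℂ)) (F : Lp ℂ 2 μ), MemLp (fun x => c x * F x) 2 μ := fun c F => by
    obtain ⟨C, hC⟩ := (isCompact_range c.continuous).isBounded.exists_norm_le
    refine MemLp.of_le_mul (c := C) (Lp.memLp F)
      (c.continuous.aestronglyMeasurable.mul (Lp.aestronglyMeasurable F))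
      (Eventually.of_forall fun x => ?_)
    rw [norm_mul]
    exact mul_le_mul_of_nonneg_right (hC _ ⟨x, rfl⟩) (norm_nonneg _)
  -- `g_(k,j) F` converges in `L²` because its image `B k j f` converges, and the range of an
  -- isometry is closed; a further subsequence converges almost everywhere. Allowing an arbitrary
  -- `ns` makes it possible to pass to subsequences of the one that defines `z k`.
  have key : ∀ k (f : P) (F : Lp ℂ 2 μ), W F = (f : Completion P) → ∀ ns : ℕ → ℕ, StrictMono ns →
      ∃ G : Lp ℂ 2 μ, W G = ((Z k f : P) : Completion P) ∧ ∃ ms : ℕ → ℕ, StrictMono ms ∧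
        ∀ᵐ x ∂μ, Tendsto (fun j => g k (ns (ms j)) x * F x) atTop (𝓝 (G x)) := by
    intro k f F hF ns hns
    let M : ℕ → Lp ℂ 2 μ := fun j => (hbdd (g k (ns j)) F).toLp _
    have hM : ∀ j, W (M j) = B k (ns j) (f : Completion P) := fun j => by
      rw [hWmul (g k (ns j)) F (M j) (MemLp.coeFn_toLp _), hg, hF]
    have hlim := (hB k f).comp hns.tendsto_atTop
    have hcl : IsClosed (Set.range W) := W.isometry.isClosedEmbedding.isClosed_range
    obtain ⟨G, hG⟩ := hcl.mem_of_tendsto hlim (Eventually.of_forall fun j => ⟨M j, hM j⟩)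
    have hMG : Tendsto M atTop (𝓝 G) := by
      rw [W.isometry.isEmbedding.tendsto_nhds_iff, hG]
      exact hlim.congr fun j => (hM j).symm
    obtain ⟨ms, hms, hae⟩ := (tendstoInMeasure_of_tendsto_Lp hMG).exists_seq_tendsto_ae
    refine ⟨G, hG, ms, hms, ?_⟩
    have hall : ∀ᵐ x ∂μ, ∀ j, M j x = g k (ns j) x * F x :=
      ae_all_iff.mpr fun j => MemLp.coeFn_toLp _
    filter_upwards [hae, hall] with x hx hx'
    exact hx.congr fun j => hx' _
  let one : Lp ℂ 2 μ := (memLp_const (1 : ℂ)).toLp _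
  have hone : one =ᵐ[μ] 1 := MemLp.coeFn_toLp _
  -- Applied to the cyclic vector `F = 1`, this gives the spectral function itself as a pointwise
  -- limit of real functions.
  have hz : ∀ k, ∃ (z : X → ℝ) (ns : ℕ → ℕ), Measurable z ∧ StrictMono ns ∧
      ∀ᵐ x ∂μ, Tendsto (fun j => g k (ns j) x) atTop (𝓝 (z x : ℂ)) := by
    intro k
    obtain ⟨G, -, ms, hms, hae⟩ := key k e one (hW1 one hone) id strictMono_id
    obtain ⟨G', hG'm, hG'⟩ := (Lp.aestronglyMeasurable G)
    refine ⟨fun x => (G' x).re, ms, Complex.measurable_re.comp hG'm.measurable, hms, ?_⟩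
    filter_upwards [hae, hone, hG'] with x hx h1 h2
    have h3 : Tendsto (fun j => g k (ms j) x) atTop (𝓝 (G' x)) := by
      rw [← h2]
      refine hx.congr fun j => ?_
      rw [h1, Pi.one_apply, mul_one, id]
    have h4 : ∀ j, ((g k (ms j) x).re : ℂ) = g k (ms j) x := fun j => by
      have := DFunLike.congr_fun (hgr k (ms j)) x
      exact Complex.conj_eq_iff_re.mp this
    have h5 := ((Complex.continuous_ofReal.comp Complex.continuous_re).tendsto _).comp h3
    exact h5.congr fun j => h4 j
  choose z ns hzm hns hzlim using hz
  refine ⟨X, inferInstance, μ, hfin, W, z, hzm, hW1, fun k f F hF => ?_⟩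
  obtain ⟨G, hG, ms, hms, hae⟩ := key k f F hF (ns k) (hns k)
  refine ⟨G, hG, ?_⟩
  filter_upwards [hae, hzlim k] with x hx hx'
  exact tendsto_nhds_unique hx ((hx'.comp hms.tendsto_atTop).mul_const _)

variable {d : ℕ}

open MvPolynomial

/-- Conjugation of the coefficients. -/
def conjCoeff : MvPolynomial (Fin d) ℂ →+* MvPolynomial (Fin d) ℂ :=
  MvPolynomial.map (starRingEnd ℂ)

theorem conjCoeff_conjCoeff (f : MvPolynomial (Fin d) ℂ) : conjCoeff (conjCoeff f) = f := by
  have : (starRingEnd ℂ).comp (starRingEnd ℂ) = RingHom.id ℂ := RingHom.ext fun x => by simp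
  rw [conjCoeff, MvPolynomial.map_map, this, MvPolynomial.map_id]

/-- Hamburger-type data: a strictly positive functional with moments of factorial growth. -/
structure IsMomentFunctional (L : MvPolynomial (Fin d) ℂ →ₗ[ℂ] ℂ) (A K : ℝ) : Prop where
  pos : ∀ f, f ≠ 0 → 0 < L (f * conjCoeff f)
  nonneg_const : 0 ≤ A
  nonneg : 0 ≤ K
  growth : ∀ γ : Fin d →₀ ℕ, ‖L (monomial γ 1)‖ ≤ A * K ^ γ.degree * (γ.degree)!

variable {L : MvPolynomial (Fin d) ℂ →ₗ[ℂ] ℂ} {A K : ℝ}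

theorem IsMomentFunctional.im_eq_zero (h : IsMomentFunctional L A K) (f : MvPolynomial (Fin d) ℂ) :
    (L (f * conjCoeff f)).im = 0 := by
  by_cases hf : f = 0
  · simp [hf]
  · exact (Complex.lt_def.mp (h.pos f hf)).2.symm

/-- Polarization: reality of `L` on the squares of `f + 1` and `f + i` makes `L(f) + L(f̄)` and `i
(L(f̄) - L(f))` real. -/
theorem IsMomentFunctional.map_conjCoeff (h : IsMomentFunctional L A K)
    (f : MvPolynomial (Fin d) ℂ) : L (conjCoeff f) = (starRingEnd ℂ) (L f) := by
  have h1 : (L (conjCoeff 1)).im = 0 := by simpa using h.im_eq_zero 1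
  have h2 := h.im_eq_zero f
  have h3 := h.im_eq_zero (f + 1)
  have h4 := h.im_eq_zero (f + C Complex.I)
  have h5 := h.im_eq_zero (C Complex.I)
  have e1 : (f + 1) * conjCoeff (f + 1) = f * conjCoeff f + 1 * conjCoeff 1 + f + conjCoeff f := by
    rw [map_add, map_one]; ring
  have e2 : (f + C Complex.I) * conjCoeff (f + C Complex.I) =
      f * conjCoeff f + C Complex.I * conjCoeff (C Complex.I) + Complex.I • conjCoeff f
        - Complex.I • f := by
    rw [map_add, smul_eq_C_mul, smul_eq_C_mul]
    have : conjCoeff (C Complex.I : MvPolynomial (Fin d) ℂ) = -C Complex.I := by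
      rw [conjCoeff, map_C, Complex.conj_I, C_neg]
    rw [this]; ring
  rw [e1, map_add, map_add, map_add, one_mul] at h3
  rw [e2, map_sub, map_add, map_add, map_smul, map_smul] at h4
  simp only [Complex.add_im, Complex.sub_im, smul_eq_mul, Complex.mul_im, Complex.I_re,
    Complex.I_im, zero_mul, one_mul, zero_add] at h3 h4
  refine Complex.ext ?_ ?_
  · rw [Complex.conj_re]; linarith
  · rw [Complex.conj_im]; linarith

/-- The space of polynomials, without its topology. -/
def PolySpace (d : ℕ) : Type := MvPolynomial (Fin d) ℂ

instance : AddCommGroup (PolySpace d) := inferInstanceAs (AddCommGroup (MvPolynomial (Fin d) ℂ))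

instance : Module ℂ (PolySpace d) := inferInstanceAs (Module ℂ (MvPolynomial (Fin d) ℂ))

/-- The inner product defined by a moment functional. -/
@[reducible]
def IsMomentFunctional.core (h : IsMomentFunctional L A K) :
    InnerProductSpace.Core ℂ (PolySpace d) where
  inner := fun (f g : MvPolynomial (Fin d) ℂ) => L (conjCoeff f * g)
  conj_inner_symm := fun (f g : MvPolynomial (Fin d) ℂ) => by
    rw [← h.map_conjCoeff, map_mul, conjCoeff_conjCoeff, mul_comm]
  re_inner_nonneg := fun (f : MvPolynomial (Fin d) ℂ) => by
    by_cases hf : f = 0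
    · simp [hf]
    · rw [mul_comm]; exact (Complex.lt_def.mp (h.pos f hf)).1.le
  add_left := fun (f g k : MvPolynomial (Fin d) ℂ) => by
    change L (conjCoeff (f + g) * k) = _
    rw [map_add, add_mul, map_add]
  smul_left := fun (f g : MvPolynomial (Fin d) ℂ) c => by
    change L (conjCoeff (c • f) * g) = _
    have : conjCoeff (c • f) * g = (starRingEnd ℂ) c • (conjCoeff f * g) := by
      rw [smul_eq_C_mul, smul_eq_C_mul, conjCoeff, map_mul (MvPolynomial.map _), map_C, mul_assoc]
    rw [this, map_smul, smul_eq_mul]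
  definite := fun (f : MvPolynomial (Fin d) ℂ) hf => by
    by_contra hne
    have h1 := h.pos f hne
    rw [mul_comm] at h1
    exact h1.ne' hf

theorem IsMomentFunctional.growth_mul (h : IsMomentFunctional L A K)
    (F : MvPolynomial (Fin d) ℂ) : ∃ A', 0 ≤ A' ∧ ∀ γ : Fin d →₀ ℕ,
      ‖L (monomial γ 1 * F)‖ ≤ A' * (2 * K) ^ γ.degree * (γ.degree)! := by
  have hA := h.nonneg_const
  have hK := h.nonneg
  induction F using MvPolynomial.induction_on' with
  | monomial δ c =>
    refine ⟨‖c‖ * (A * (2 * K) ^ δ.degree * (δ.degree)!), by positivity, fun γ => ?_⟩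
    have e1 : monomial γ (1 : ℂ) * monomial δ c = c • monomial (γ + δ) 1 := by
      rw [monomial_mul, one_mul, smul_monomial, smul_eq_mul, mul_one]
    rw [e1, map_smul, norm_smul, mul_assoc ‖c‖, mul_assoc ‖c‖]
    refine mul_le_mul_of_nonneg_left ((h.growth _).trans ?_) (norm_nonneg _)
    rw [map_add]
    refine (mul_le_mul_of_nonneg_left (factorial_add_le _ _) (by positivity)).trans_eq ?_
    ring
  | add F G hF hG =>
    obtain ⟨A₁, h₁, H₁⟩ := hF
    obtain ⟨A₂, h₂, H₂⟩ := hG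
    refine ⟨A₁ + A₂, by positivity, fun γ => ?_⟩
    rw [mul_add, map_add]
    refine (norm_add_le _ _).trans ((add_le_add (H₁ γ) (H₂ γ)).trans_eq ?_)
    ring

/-- Multiplication by a coordinate. -/
def mulCoord (k : Fin d) : Module.End ℂ (MvPolynomial (Fin d) ℂ) := LinearMap.mulLeft ℂ (X k)

theorem mulCoord_pow_mul_pow (k l : Fin d) (m n : ℕ) (f : MvPolynomial (Fin d) ℂ) :
    (mulCoord k ^ m * mulCoord l ^ n) f =
      monomial (Finsupp.single k m + Finsupp.single l n) 1 * f := by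
  rw [Module.End.mul_apply, mulCoord, mulCoord, LinearMap.pow_mulLeft, LinearMap.pow_mulLeft,
    LinearMap.mulLeft_apply, LinearMap.mulLeft_apply, X_pow_eq_monomial, X_pow_eq_monomial,
    ← mul_assoc, monomial_mul, one_mul]

/-- The squared norm of `x^γ f` is the moment `L(x^(2γ) f̄ f)`, and `(2N)! ≤ 4^N N!²`; so
polynomials are analytic vectors. -/
theorem IsMomentFunctional.exists_growth_inner (h : IsMomentFunctional L A K)
    (f : MvPolynomial (Fin d) ℂ) : ∃ A', 0 ≤ A' ∧ ∀ (k l : Fin d) (m n : ℕ),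
      ‖L (conjCoeff ((mulCoord k ^ m * mulCoord l ^ n) f) * (mulCoord k ^ m * mulCoord l ^ n) f)‖ ≤
        (A' * (4 * K) ^ (m + n) * (m + n)!) ^ 2 := by
  have hK := h.nonneg
  obtain ⟨A', hA', hg⟩ := h.growth_mul (conjCoeff f * f)
  refine ⟨Real.sqrt A', by positivity, fun k l m n => ?_⟩
  set γ : Fin d →₀ ℕ := Finsupp.single k m + Finsupp.single l n with hγ
  have hdeg : γ.degree = m + n := by simp [hγ]
  have e1 : conjCoeff ((mulCoord k ^ m * mulCoord l ^ n) f) * (mulCoord k ^ m * mulCoord l ^ n) f =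
      monomial (γ + γ) 1 * (conjCoeff f * f) := by
    rw [mulCoord_pow_mul_pow, ← hγ, map_mul]
    have : conjCoeff (monomial γ (1 : ℂ)) = monomial γ 1 := by
      rw [conjCoeff, map_monomial, map_one]
    have h2 : monomial (γ + γ) (1 : ℂ) = monomial γ 1 * monomial γ 1 := by
      rw [monomial_mul, one_mul]
    rw [this, h2]
    ring
  rw [e1]
  refine (hg _).trans ?_
  rw [map_add, hdeg]
  refine (mul_le_mul_of_nonneg_left (factorial_add_le _ _) (by positivity)).trans_eq ?_
  have h4 : (4 : ℝ) ^ (m + n) = 2 ^ (m + n) * 2 ^ (m + n) := by rw [← mul_pow]; norm_num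
  rw [mul_pow (4 : ℝ), h4, mul_pow (_ * _ : ℝ), mul_pow (Real.sqrt A'), Real.sq_sqrt hA']
  ring

theorem IsMomentFunctional.exists_measure_of_equiv (h : IsMomentFunctional L A K) {P : Type}
    [NormedAddCommGroup P] [InnerProductSpace ℂ P] (e : MvPolynomial (Fin d) ℂ ≃ₗ[ℂ] P)
    (he : ∀ f g, inner ℂ (e f) (e g) = L (conjCoeff f * g)) :
    ∃ (X : Type) (_ : MeasurableSpace X) (μ : Measure X) (_ : IsFiniteMeasure μ)
      (z : Fin d → X → ℝ), (∀ k, Measurable (z k)) ∧ ∀ f : MvPolynomial (Fin d) ℂ,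
        Integrable (fun x => eval (fun k => (z k x : ℂ)) f) μ ∧
        L f = ∫ x, eval (fun k => (z k x : ℂ)) f ∂μ := by
  have hX : ∀ k : Fin d, conjCoeff (X k : MvPolynomial (Fin d) ℂ) = X k := fun k => by
    rw [conjCoeff, map_X]
  have hnorm : ∀ f, ‖e f‖ ^ 2 = ‖L (conjCoeff f * f)‖ := fun f => by
    rw [← he, inner_self_eq_norm_sq_to_K, norm_pow]
    simp
  let Z : Fin d → Module.End ℂ P := fun k => e.conj (mulCoord k)
  have hZ : ∀ k f, Z k (e f) = e (X k * f) := fun k f => by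
    simp only [Z, LinearEquiv.conj_apply_apply, LinearEquiv.symm_apply_apply]
    rfl
  have hZpow : ∀ k m f, (Z k ^ m) (e f) = e ((mulCoord k ^ m) f) := fun k m f => by
    induction m generalizing f with
    | zero => rfl
    | succ m ih =>
      rw [pow_succ, pow_succ, Module.End.mul_apply, Module.End.mul_apply, hZ, ih]
      rfl
  have hfam : IsAnalyticFamily Z (4 * K) := by
    have hK := h.nonneg
    refine ⟨by positivity, fun k f g => ?_, fun k l => ?_, fun f => ?_⟩
    · obtain ⟨f, rfl⟩ := e.surjective f
      obtain ⟨g, rfl⟩ := e.surjective g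
      rw [hZ, hZ, he, he, map_mul conjCoeff, hX]
      congr 1; ring
    · refine LinearMap.ext fun f => ?_
      obtain ⟨f, rfl⟩ := e.surjective f
      rw [Module.End.mul_apply, Module.End.mul_apply, hZ, hZ, hZ, hZ, mul_left_comm]
    · obtain ⟨f, rfl⟩ := e.surjective f
      obtain ⟨A', hA', hg⟩ := h.exists_growth_inner f
      refine ⟨A', hA', fun k l m n => ?_⟩
      refine (sq_le_sq₀ (norm_nonneg _) (by positivity)).mp ?_
      rw [Module.End.mul_apply, hZpow, hZpow, ← Module.End.mul_apply, hnorm]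
      exact hg k l m n
  obtain ⟨Ω, _, μ, hfin, W, z, hz, hW1, hWz⟩ := exists_spectral_functions hfam (e 1)
  have hrep : ∀ f, ∃ F : Lp ℂ 2 μ, W F = (e f : Completion P) ∧
      F =ᵐ[μ] fun x => eval (fun k => (z k x : ℂ)) f := by
    let one : Lp ℂ 2 μ := (memLp_const (1 : ℂ)).toLp _
    have hone : one =ᵐ[μ] 1 := MemLp.coeFn_toLp _
    intro f
    induction f using MvPolynomial.induction_on with
    | C a =>
      refine ⟨a • one, ?_, ?_⟩
      · rw [map_smul, hW1 one hone, ← Completion.coe_smul, ← map_smul, smul_eq_C_mul, mul_one]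
      · filter_upwards [hone, Lp.coeFn_smul a one] with x h1 h2
        rw [h2, Pi.smul_apply, h1, eval_C, Pi.one_apply, smul_eq_mul, mul_one]
    | add p q hp hq =>
      obtain ⟨F, hF, hF'⟩ := hp
      obtain ⟨G, hG, hG'⟩ := hq
      refine ⟨F + G, by rw [map_add, hF, hG, map_add, Completion.coe_add], ?_⟩
      filter_upwards [hF', hG', Lp.coeFn_add F G] with x h1 h2 h3
      rw [h3, Pi.add_apply, h1, h2, map_add]
    | mul_X p k hp =>
      obtain ⟨F, hF, hF'⟩ := hp
      obtain ⟨G, hG, hG'⟩ := hWz k _ F hF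
      refine ⟨G, by rw [hG, hZ, mul_comm], ?_⟩
      filter_upwards [hF', hG'] with x h1 h2
      rw [h2, h1, map_mul, eval_X, mul_comm]
  refine ⟨Ω, inferInstance, μ, hfin, z, hz, fun f => ?_⟩
  obtain ⟨F, hF, hF'⟩ := hrep f
  obtain ⟨E, hE, hE'⟩ := hrep 1
  refine ⟨((Lp.memLp F).integrable (by norm_num)).congr hF', ?_⟩
  have h1 : L f = inner ℂ E F := by
    rw [← W.inner_map_map, hF, hE, Completion.inner_coe, he, map_one, one_mul]
  rw [h1, L2.inner_def]
  refine integral_congr_ae ?_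
  filter_upwards [hF', hE'] with x h2 h3
  rw [h2, h3]
  simp

/-- A moment functional is represented by a finite measure. -/
theorem IsMomentFunctional.exists_measure_space (h : IsMomentFunctional L A K) :
    ∃ (X : Type) (_ : MeasurableSpace X) (μ : Measure X) (_ : IsFiniteMeasure μ)
      (z : Fin d → X → ℝ), (∀ k, Measurable (z k)) ∧ ∀ f : MvPolynomial (Fin d) ℂ,
        Integrable (fun x => eval (fun k => (z k x : ℂ)) f) μ ∧
        L f = ∫ x, eval (fun k => (z k x : ℂ)) f ∂μ := by
  let _ : NormedAddCommGroup (PolySpace d) := h.core.toNormedAddCommGroup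
  let _ : InnerProductSpace ℂ (PolySpace d) := InnerProductSpace.ofCore h.core.toCore
  let e : MvPolynomial (Fin d) ℂ ≃ₗ[ℂ] PolySpace d :=
    { toFun := fun f => f
      invFun := fun f => f
      map_add' := fun _ _ => rfl
      map_smul' := fun _ _ => rfl
      left_inv := fun _ => rfl
      right_inv := fun _ => rfl }
  exact h.exists_measure_of_equiv e fun _ _ => rfl

theorem norm_le_sum_abs (x : EuclideanSpace ℝ (Fin d)) : ‖x‖ ≤ ∑ k, |x k| := by
  rw [EuclideanSpace.norm_eq]
  refine Real.sqrt_le_iff.mpr ⟨Finset.sum_nonneg fun _ _ => abs_nonneg _, ?_⟩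
  simpa only [Real.norm_eq_abs] using
    Finset.sum_sq_le_sq_sum_of_nonneg (s := univ) (f := fun k => |x k|) fun _ _ => abs_nonneg _

/-- `‖x‖` is at most `d` times the largest coordinate. This reduces exponential moments to the
hyperbolic cosines of single coordinates, whose series involve only even moments. -/
theorem exp_norm_le (c : ℝ) (hc : 0 ≤ c) (x : EuclideanSpace ℝ (Fin d)) :
    Real.exp (c * ‖x‖) ≤ 1 + ∑ k, 2 * Real.cosh (c * d * x k) := by
  have hnn : ∀ k, 0 ≤ 2 * Real.cosh (c * d * x k) := fun k => by positivity
  rcases (univ : Finset (Fin d)).eq_empty_or_nonempty with he | hne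
  · have h0 : ‖x‖ ≤ 0 := by simpa [he] using norm_le_sum_abs x
    have h1 : ‖x‖ = 0 := le_antisymm h0 (norm_nonneg x)
    rw [h1, mul_zero, Real.exp_zero]
    linarith [Finset.sum_nonneg fun k (_ : k ∈ univ) => hnn k]
  · obtain ⟨k, -, hk⟩ := Finset.exists_max_image univ (fun k => |x k|) hne
    have h1 : ‖x‖ ≤ d * |x k| := by
      refine (norm_le_sum_abs x).trans ((Finset.sum_le_card_nsmul univ _ _ hk).trans_eq ?_)
      simp
    have h2 : c * ‖x‖ ≤ |c * d * x k| := by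
      rw [abs_mul, abs_of_nonneg (by positivity), mul_assoc]
      exact mul_le_mul_of_nonneg_left h1 hc
    have h3 : Real.exp (c * ‖x‖) ≤ 2 * Real.cosh (c * d * x k) := by
      rw [← Real.cosh_abs, Real.cosh_eq]
      have := Real.exp_pos (-|c * d * x k|)
      have := Real.exp_le_exp.mpr h2
      linarith
    have h4 := Finset.single_le_sum (fun k _ => hnn k) (mem_univ k)
    linarith

/-- The moment problem: a moment functional is represented by a measure with exponential moments. -/
theorem IsMomentFunctional.exists_measure (h : IsMomentFunctional L A K) :
    ∃ μ : Measure (EuclideanSpace ℝ (Fin d)), IsFiniteMeasure μ ∧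
      (∃ c, 0 < c ∧ Integrable (fun x => Real.exp (c * ‖x‖)) μ) ∧
      ∀ f : MvPolynomial (Fin d) ℂ, L f = ∫ x, eval (fun k => (x k : ℂ)) f ∂μ := by
  obtain ⟨Ω, _, ν, hν, z, hz, hL⟩ := h.exists_measure_space
  let Φ : Ω → EuclideanSpace ℝ (Fin d) := fun ω => WithLp.toLp 2 fun k => z k ω
  have hΦ : Measurable Φ := (MeasurableEquiv.toLp 2 (Fin d → ℝ)).measurable.comp
    (measurable_pi_lambda _ hz)
  have hcont : ∀ f : MvPolynomial (Fin d) ℂ,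
      Continuous fun x : EuclideanSpace ℝ (Fin d) => eval (fun k => (x k : ℂ)) f := fun f =>
    (MvPolynomial.continuous_eval f).comp (by fun_prop)
  refine ⟨ν.map Φ, inferInstance, ?_, fun f => ?_⟩
  swap
  · rw [integral_map hΦ.aemeasurable (hcont f).aestronglyMeasurable]
    exact (hL f).2
  have hA := h.nonneg_const
  have hK := h.nonneg
  -- Integrate the cosine series term by term: the factorial in its denominators cancels the growth
  -- of the moments and leaves a geometric series of ratio `(K|c|)²`.
  have hcosh : ∀ (c : ℝ) k, K * |c| < 1 → Integrable (fun ω => Real.cosh (c * z k ω)) ν := by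
    intro c k hc
    have hmeas : Measurable fun ω => Real.cosh (c * z k ω) :=
      Real.measurable_cosh.comp ((hz k).const_mul c)
    refine ⟨hmeas.aestronglyMeasurable, ?_⟩
    rw [hasFiniteIntegral_iff_ofReal (Eventually.of_forall fun ω => (Real.cosh_pos _).le)]
    have hterm : ∀ m : ℕ, Integrable (fun ω => (c * z k ω) ^ (2 * m) / (2 * m)!) ν ∧
        ∫ ω, (c * z k ω) ^ (2 * m) / (2 * m)! ∂ν ≤ A * (K * |c|) ^ (2 * m) := by
      intro m
      obtain ⟨hi, he⟩ := hL (monomial (Finsupp.single k (2 * m)) 1)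
      have e1 : ∀ ω, eval (fun k => (z k ω : ℂ)) (monomial (Finsupp.single k (2 * m)) 1) =
          ((z k ω ^ (2 * m) : ℝ) : ℂ) := fun ω => by
        rw [← X_pow_eq_monomial, map_pow, eval_X, Complex.ofReal_pow]
      simp only [e1] at hi he
      have hi' : Integrable (fun ω => z k ω ^ (2 * m)) ν := hi.re
      have e2 : ∀ ω, (c * z k ω) ^ (2 * m) / (2 * m)! = c ^ (2 * m) / (2 * m)! * z k ω ^ (2 * m) :=
        fun ω => by rw [mul_pow]; ring
      simp only [e2]
      refine ⟨hi'.const_mul _, ?_⟩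
      rw [integral_const_mul]
      have h1 := h.growth (Finsupp.single k (2 * m))
      rw [he, integral_complex_ofReal, Complex.norm_real, Finsupp.degree_single] at h1
      have h2 := (le_abs_self _).trans h1
      have h3 : c ^ (2 * m) = |c| ^ (2 * m) := by rw [pow_mul, pow_mul, sq_abs]
      rw [h3]
      refine (mul_le_mul_of_nonneg_left h2 (by positivity)).trans_eq ?_
      have : ((2 * m)! : ℝ) ≠ 0 := by positivity
      field_simp
      ring
    have hnn : ∀ m ω, 0 ≤ (c * z k ω) ^ (2 * m) / (2 * m)! := fun m ω => by
      rw [pow_mul]; positivity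
    have e3 : ∀ ω, ENNReal.ofReal (Real.cosh (c * z k ω)) =
        ∑' m : ℕ, ENNReal.ofReal ((c * z k ω) ^ (2 * m) / (2 * m)!) := fun ω => by
      rw [← ENNReal.ofReal_tsum_of_nonneg (fun m => hnn m ω) (Real.hasSum_cosh _).summable,
        (Real.hasSum_cosh _).tsum_eq]
    simp only [e3]
    rw [lintegral_tsum fun m => ((hterm m).1.aestronglyMeasurable.aemeasurable).ennreal_ofReal]
    have hsum : Summable fun m : ℕ => A * (K * |c|) ^ (2 * m) := by
      have h0 : 0 ≤ K * |c| := by positivity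
      simp only [pow_mul]
      exact (summable_geometric_of_lt_one (by positivity) (by nlinarith)).mul_left A
    refine lt_of_le_of_lt (ENNReal.tsum_le_tsum fun m => ?_) hsum.tsum_ofReal_lt_top
    rw [← ofReal_integral_eq_lintegral_ofReal (hterm m).1 (Eventually.of_forall (hnn m))]
    exact ENNReal.ofReal_le_ofReal (hterm m).2
  -- Small enough that `K · (c d) < 1`, as required for the coordinate functions in `exp_norm_le`.
  refine ⟨1 / ((K + 1) * (d + 1)), by positivity, ?_⟩
  set c := 1 / ((K + 1) * (d + 1)) with hc
  have hc0 : 0 ≤ c := by positivity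
  have hcd : K * |c * d| < 1 := by
    rw [abs_of_nonneg (by positivity), hc, ← mul_assoc, mul_one_div, div_mul_eq_mul_div,
      div_lt_one (by positivity)]
    have : (0 : ℝ) ≤ d := by positivity
    nlinarith
  rw [integrable_map_measure (by fun_prop) hΦ.aemeasurable]
  have hbig : Integrable (fun ω => 1 + ∑ k, 2 * Real.cosh (c * d * z k ω)) ν :=
    (integrable_const _).add (integrable_finsetSum _ fun k _ => (hcosh _ k hcd).const_mul 2)
  refine hbig.mono' ((by fun_prop : Continuous fun x : EuclideanSpace ℝ (Fin d) =>
    Real.exp (c * ‖x‖)).measurable.comp hΦ).aestronglyMeasurable (Eventually.of_forall fun ω => ?_)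
  rw [Function.comp_apply, Real.norm_of_nonneg (Real.exp_pos _).le]
  exact exp_norm_le c hc0 (Φ ω)

end Moments

end AbelianCoulomb

end

noncomputable section

namespace AbelianCoulomb

/-! ### Fourier inversion for finite measures and holomorphic Fourier–Laplace integrals -/

section Inversion

open Filter MeasureTheory
open scoped FourierTransform ContDiff Manifold RealInnerProductSpace

variable {V : Type*} [NormedAddCommGroup V] [InnerProductSpace ℝ V] [FiniteDimensional ℝ V]
  [MeasurableSpace V] [BorelSpace V]

/-- The Fourier transform of a measure, in the normalization of `𝓕`. -/
def fourierMeasure (κ : Measure V) (t : V) : ℂ := charFun κ (-(2 * Real.pi) • t)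

omit [FiniteDimensional ℝ V] [BorelSpace V] in
theorem fourierMeasure_eq (κ : Measure V) (t : V) :
    fourierMeasure κ t = VectorFourier.fourierIntegral Real.fourierChar κ (innerₗ V) 1 t := by
  rw [fourierMeasure, charFun_eq_fourierIntegral', smul_smul]
  congr 1
  rw [neg_mul_neg, inv_mul_cancel₀ (by positivity), one_smul]

/-- Fubini twice: `∫ g dκ = ∫ 𝓕⁻g · κ̂ = ∫ g · 𝓕⁻κ̂`, the first because the test function `g` is `𝓕
(𝓕⁻ g)`. -/
theorem integral_eq_integral_fourierInv (κ : Measure V) [IsFiniteMeasure κ]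
    (h : Integrable (fourierMeasure κ)) {g : V → ℝ} (hg : ContDiff ℝ ∞ g)
    (hc : HasCompactSupport g) :
    ((∫ x, g x ∂κ : ℝ) : ℂ) = ∫ x, g x • 𝓕⁻ (fourierMeasure κ) x := by
  have hGc : HasCompactSupport (fun x => (g x : ℂ)) := hc.comp_left Complex.ofReal_zero
  have hGd : ContDiff ℝ ∞ (fun x => (g x : ℂ)) := Complex.ofRealCLM.contDiff.comp hg
  set G : SchwartzMap V ℂ := hGc.toSchwartzMap hGd with hG
  have hGx : ∀ x, G x = (g x : ℂ) := fun x => rfl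
  have h1 : ∀ x, G x = VectorFourier.fourierIntegral Real.fourierChar volume (innerₗ V)
      (𝓕⁻ G : SchwartzMap V ℂ) x := by
    intro x
    have : 𝓕 (𝓕⁻ G) = G := FourierTransform.fourier_fourierInv_eq G
    conv_lhs => rw [← this]
    rfl
  have hcont : Continuous fun p : V × V => innerₗ V p.1 p.2 := continuous_inner
  have h2 := VectorFourier.integral_fourierIntegral_smul_eq_flip (L := innerₗ V) (μ := volume)
    (ν := κ) (f := (𝓕⁻ G : SchwartzMap V ℂ)) (g := (1 : V → ℂ)) Real.continuous_fourierChar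
    hcont (SchwartzMap.integrable _) (integrable_const _)
  rw [flip_innerₗ] at h2
  simp only [← h1, ← fourierMeasure_eq, hGx, Pi.one_apply, smul_eq_mul, mul_one] at h2
  rw [integral_complex_ofReal] at h2
  rw [h2]
  have hcont' : Continuous fun p : V × V => (-innerₗ V) p.1 p.2 := continuous_inner.neg
  have h3 := VectorFourier.integral_fourierIntegral_smul_eq_flip (L := -innerₗ V) (μ := volume)
    (ν := volume) (f := G) (g := fourierMeasure κ) Real.continuous_fourierChar
    hcont' G.integrable h
  have h4 : ∀ x, VectorFourier.fourierIntegral Real.fourierChar volume (-innerₗ V) G x =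
      (𝓕⁻ G : SchwartzMap V ℂ) x := by
    intro x
    rw [SchwartzMap.fourierInv_coe]
    rfl
  have h5 : ∀ x, VectorFourier.fourierIntegral Real.fourierChar volume (-innerₗ V).flip
      (fourierMeasure κ) x = 𝓕⁻ (fourierMeasure κ) x := by
    intro x
    have : (-innerₗ V).flip = -innerₗ V := by
      ext x y
      simp [real_inner_comm]
    rw [this]
    rfl
  simp only [h4, h5, hGx, smul_eq_mul] at h3
  simpa using h3

theorem norm_fourierInv_le (f : V → ℂ) (x : V) : ‖𝓕⁻ f x‖ ≤ ∫ t, ‖f t‖ := by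
  rw [Real.fourierInv_eq]
  refine (norm_integral_le_integral_norm _).trans_eq ?_
  simp [Circle.norm_smul]

theorem continuous_fourierInv {f : V → ℂ} (hf : Integrable f) : Continuous (𝓕⁻ f) := by
  have hcont : Continuous fun p : V × V => (-innerₗ V) p.1 p.2 := continuous_inner.neg
  exact VectorFourier.fourierIntegral_continuous Real.continuous_fourierChar hcont hf

/-- Against bump functions `κ` behaves like a density bounded by `‖κ̂‖₁`, so a compact null set,
being contained in open sets of arbitrarily small volume, has measure zero. Inner regularity gives
the other null sets. -/
theorem absolutelyContinuous_of_integrable_fourierMeasure (κ : Measure V) [IsFiniteMeasure κ]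
    (h : Integrable (fourierMeasure κ)) : κ ≪ volume := by
  have key : ∀ K : Set V, IsCompact K → volume K = 0 → κ K = 0 := by
    intro K hK h0
    set M : ℝ := ∫ t, ‖fourierMeasure κ t‖
    have hM : 0 ≤ M := integral_nonneg fun _ => norm_nonneg _
    have key : ∀ ε : ℝ, 0 < ε → κ.real K ≤ M * ε := by
      intro ε hε
      obtain ⟨U, hKU, hU, hUε⟩ := K.exists_isOpen_lt_of_lt (μ := volume) (ENNReal.ofReal ε)
        (by rw [h0]; exact ENNReal.ofReal_pos.mpr hε)
      obtain ⟨r, hr⟩ := hK.isBounded.subset_ball (0 : V)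
      obtain ⟨g, hg, hrange, hsupp, hone⟩ := exists_contMDiff_support_eq_eq_one_iff 𝓘(ℝ, V)
        (n := ⊤) (hU.inter Metric.isOpen_ball) hK.isClosed (Set.subset_inter hKU hr)
      have hg01 : ∀ x, 0 ≤ g x ∧ g x ≤ 1 := fun x => hrange (Set.mem_range_self x)
      have hc : HasCompactSupport g := by
        refine HasCompactSupport.of_support_subset_isCompact (isCompact_closedBall (0 : V) r) ?_
        rw [hsupp]
        exact Set.inter_subset_right.trans Metric.ball_subset_closedBall
      have hd : ContDiff ℝ ∞ g := hg.contDiff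
      have hint := integral_eq_integral_fourierInv κ h hd hc
      have hgi : Integrable g κ := hd.continuous.integrable_of_hasCompactSupport hc
      have hle : κ.real K ≤ ∫ x, g x ∂κ := by
        rw [← integral_indicator_one hK.measurableSet]
        refine integral_mono ((integrable_const (1 : ℝ)).indicator hK.measurableSet) hgi ?_
        intro x
        by_cases hx : x ∈ K
        · simp [hx, (hone x).1 hx]
        · simp [hx, (hg01 x).1]
      have hUfin : volume (U ∩ Metric.ball 0 r) < ⊤ :=
        (measure_mono Set.inter_subset_left).trans_lt (hUε.trans ENNReal.ofReal_lt_top)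
      calc κ.real K ≤ ∫ x, g x ∂κ := hle
        _ ≤ ‖((∫ x, g x ∂κ : ℝ) : ℂ)‖ := by
          rw [Complex.norm_real]
          exact le_abs_self _
        _ = ‖∫ x in U ∩ Metric.ball 0 r, g x • 𝓕⁻ (fourierMeasure κ) x‖ := by
          rw [hint, setIntegral_eq_integral_of_forall_compl_eq_zero]
          intro x hx
          rw [← hsupp, Function.notMem_support] at hx
          rw [hx, zero_smul]
        _ ≤ M * volume.real (U ∩ Metric.ball 0 r) := by
          refine norm_setIntegral_le_of_norm_le_const hUfin fun x _ => ?_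
          rw [norm_smul, Real.norm_of_nonneg (hg01 x).1]
          calc g x * ‖𝓕⁻ (fourierMeasure κ) x‖ ≤ 1 * M :=
                mul_le_mul (hg01 x).2 (norm_fourierInv_le _ _) (norm_nonneg _) zero_le_one
            _ = M := one_mul M
        _ ≤ M * ε := by
          refine mul_le_mul_of_nonneg_left ?_ hM
          exact ENNReal.toReal_le_of_le_ofReal hε.le
            ((measure_mono Set.inter_subset_left).trans hUε.le)
    have hK0 : κ.real K ≤ 0 := by
      refine le_of_forall_pos_le_add fun ε hε => ?_
      have := key (ε / (M + 1)) (by positivity)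
      calc κ.real K ≤ M * (ε / (M + 1)) := this
        _ ≤ 0 + ε := by
          rw [zero_add, mul_div_assoc', div_le_iff₀ (by positivity)]
          nlinarith
    exact (measureReal_eq_zero_iff).1 (le_antisymm hK0 measureReal_nonneg)
  refine Measure.AbsolutelyContinuous.mk fun s hs h0 => ?_
  rw [hs.measure_eq_iSup_isCompact_of_ne_top (measure_ne_top κ s)]
  simp only [ENNReal.iSup_eq_zero]
  intro K hK hKc
  exact key K hKc (measure_mono_null hK h0)

/-- **Fourier inversion for finite measures.** -/
theorem rnDeriv_eq_fourierInv (κ : Measure V) [IsFiniteMeasure κ]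
    (h : Integrable (fourierMeasure κ)) :
    ∀ᵐ x, (((κ.rnDeriv volume x).toReal : ℝ) : ℂ) = 𝓕⁻ (fourierMeasure κ) x := by
  have hac := absolutelyContinuous_of_integrable_fourierMeasure κ h
  refine ae_eq_of_integral_contDiff_smul_eq
    (Measure.integrable_toReal_rnDeriv.ofReal.locallyIntegrable)
    (continuous_fourierInv h).locallyIntegrable fun g hg hc => ?_
  rw [← integral_eq_integral_fourierInv κ h hg hc, ← integral_rnDeriv_smul hac,
    ← integral_complex_ofReal]
  refine integral_congr_ae (ae_of_all _ fun x => ?_)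
  simp [mul_comm]

end Inversion

section Holomorphic

open Filter MeasureTheory

/-- Holomorphic dependence of a Fourier–Laplace integral on parameters. -/
theorem differentiableOn_integral_mul_cexp {X E : Type*} [NormedAddCommGroup X] [NormedSpace ℝ X]
    [FiniteDimensional ℝ X] [MeasurableSpace X] [BorelSpace X] [NormedAddCommGroup E]
    [NormedSpace ℂ E] [FiniteDimensional ℂ E] (ν : Measure X) (f : X → ℂ)
    (hf : AEStronglyMeasurable f ν) (a : ℝ)
    (ha : Integrable (fun x => Real.exp (a * ‖x‖) * ‖f x‖) ν) (L : X →L[ℝ] (E →L[ℂ] ℂ))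
    (p : E → ℝ) (hp : Continuous p) (hL : ∀ x z, (L x z).re ≤ p z * ‖x‖) :
    DifferentiableOn ℂ (fun z => ∫ x, f x * Complex.exp (L x z) ∂ν) {z | p z < a} := by
  intro z₀ hz₀
  refine DifferentiableAt.differentiableWithinAt ?_
  have hz₀' : p z₀ < a := hz₀
  set a' : ℝ := (p z₀ + a) / 2 with ha'
  have h1 : p z₀ < a' := by rw [ha']; linarith
  have h2 : a' < a := by rw [ha']; linarith
  have hs : {z | p z < a'} ∈ 𝓝 z₀ := (isOpen_lt hp continuous_const).mem_nhds h1
  have hLx : ∀ z, Continuous fun x => L x z := fun z => by fun_prop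
  have hmeas : ∀ z, AEStronglyMeasurable (fun x => f x * Complex.exp (L x z)) ν := fun z =>
    hf.mul (Complex.continuous_exp.comp (hLx z)).aestronglyMeasurable
  have hexp : ∀ x z, p z < a' → ‖Complex.exp (L x z)‖ ≤ Real.exp (a' * ‖x‖) := by
    intro x z hz
    rw [Complex.norm_exp]
    exact Real.exp_le_exp.2 ((hL x z).trans (mul_le_mul_of_nonneg_right hz.le (norm_nonneg x)))
  have hmono : ∀ x : X, Real.exp (a' * ‖x‖) ≤ Real.exp (a * ‖x‖) := fun x =>
    Real.exp_le_exp.2 (mul_le_mul_of_nonneg_right h2.le (norm_nonneg x))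
  -- The derivative in `z` brings down a factor `‖x‖`; the gap between `a'` and `a` absorbs it.
  have hmono' : ∀ x : X, ‖x‖ * Real.exp (a' * ‖x‖) ≤ (a - a')⁻¹ * Real.exp (a * ‖x‖) := by
    intro x
    have hpos : 0 < a - a' := by linarith
    rw [inv_mul_eq_div, le_div_iff₀ hpos]
    have h3 : (a - a') * ‖x‖ ≤ Real.exp ((a - a') * ‖x‖) :=
      (le_add_of_nonneg_right zero_le_one).trans (Real.add_one_le_exp _)
    calc ‖x‖ * Real.exp (a' * ‖x‖) * (a - a') = ((a - a') * ‖x‖) * Real.exp (a' * ‖x‖) := by ring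
      _ ≤ Real.exp ((a - a') * ‖x‖) * Real.exp (a' * ‖x‖) :=
        mul_le_mul_of_nonneg_right h3 (Real.exp_pos _).le
      _ = Real.exp (a * ‖x‖) := by
        rw [← Real.exp_add]
        ring_nf
  refine (hasFDerivAt_integral_of_dominated_of_fderiv_le (𝕜 := ℂ) (μ := ν)
    (F := fun z x => f x * Complex.exp (L x z))
    (F' := fun z x => (f x * Complex.exp (L x z)) • L x)
    (bound := fun x => ‖L‖ * (a - a')⁻¹ * (Real.exp (a * ‖x‖) * ‖f x‖)) hs
    (Eventually.of_forall hmeas) ?_ ?_ ?_ ?_ ?_).differentiableAt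
  · refine ha.mono' (hmeas z₀) (ae_of_all _ fun x => ?_)
    rw [norm_mul, mul_comm]
    exact mul_le_mul_of_nonneg_right ((hexp x z₀ h1).trans (hmono x)) (norm_nonneg _)
  · exact (hmeas z₀).smul L.continuous.aestronglyMeasurable
  · refine ae_of_all _ fun x z hz => ?_
    rw [norm_smul, norm_mul]
    calc ‖f x‖ * ‖Complex.exp (L x z)‖ * ‖L x‖
        ≤ ‖f x‖ * Real.exp (a' * ‖x‖) * (‖L‖ * ‖x‖) :=
          mul_le_mul (mul_le_mul_of_nonneg_left (hexp x z hz) (norm_nonneg _)) (L.le_opNorm x)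
            (norm_nonneg _) (by positivity)
      _ = ‖L‖ * ‖f x‖ * (‖x‖ * Real.exp (a' * ‖x‖)) := by ring
      _ ≤ ‖L‖ * ‖f x‖ * ((a - a')⁻¹ * Real.exp (a * ‖x‖)) :=
          mul_le_mul_of_nonneg_left (hmono' x) (by positivity)
      _ = ‖L‖ * (a - a')⁻¹ * (Real.exp (a * ‖x‖) * ‖f x‖) := by ring
  · exact ha.const_mul _
  · refine ae_of_all _ fun x z _ => ?_
    have h3 : HasFDerivAt (fun z => Complex.exp (L x z)) (Complex.exp (L x z) • L x) z :=
      (L x).hasFDerivAt.cexp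
    have h4 := h3.const_mul (f x)
    rwa [smul_smul] at h4

end Holomorphic

end AbelianCoulomb

end

noncomputable section

namespace AbelianCoulomb

/-! ### Measures whose weighted Fourier–Laplace transforms decay exponentially -/

section Decay

open Filter MeasureTheory
open scoped RealInnerProductSpace

variable {V : Type*} [NormedAddCommGroup V] [InnerProductSpace ℝ V] [MeasurableSpace V]

/-- The exponential `v ↦ exp (i⟨t, v⟩ - ⟨η, v⟩)`. -/
def twist (t η v : V) : ℂ := Complex.exp ((⟪t, v⟫ : ℂ) * Complex.I - (⟪η, v⟫ : ℂ))

omit [MeasurableSpace V] in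
theorem continuous_twist (t η : V) : Continuous (twist t η) := by
  unfold twist
  fun_prop

omit [MeasurableSpace V] in
theorem norm_twist (t η v : V) : ‖twist t η v‖ = Real.exp (-⟪η, v⟫) := by
  rw [twist, Complex.norm_exp]
  simp

omit [MeasurableSpace V] in
theorem norm_twist_le (t η v : V) : ‖twist t η v‖ ≤ Real.exp (‖η‖ * ‖v‖) := by
  rw [norm_twist]
  exact Real.exp_le_exp.2 ((neg_le_abs _).trans (abs_real_inner_le_norm η v))

/-- The Fourier–Laplace transform of `B m` decays exponentially, uniformly on a tube. -/
def HasDecay (m : Measure V) (B : V → ℂ) : Prop :=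
  ∃ κ δ C : ℝ, 0 < κ ∧ 0 < δ ∧ ∀ t η, ‖η‖ < δ →
    ‖∫ v, B v * twist t η v ∂m‖ ≤ C * Real.exp (-κ * ‖t‖)

/-- Continuous functions of subexponential growth. -/
def IsTame (B : V → ℂ) : Prop :=
  Continuous B ∧ ∀ ε : ℝ, 0 < ε → ∃ M, ∀ v, ‖B v‖ ≤ M * Real.exp (ε * ‖v‖)

omit [InnerProductSpace ℝ V] [MeasurableSpace V] in
theorem IsTame.mul {B B' : V → ℂ} (h : IsTame B) (h' : IsTame B') : IsTame fun v => B v * B' v := by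
  refine ⟨h.1.mul h'.1, fun ε hε => ?_⟩
  obtain ⟨M, hM⟩ := h.2 (ε / 2) (by positivity)
  obtain ⟨M', hM'⟩ := h'.2 (ε / 2) (by positivity)
  refine ⟨M * M', fun v => ?_⟩
  rw [norm_mul]
  calc ‖B v‖ * ‖B' v‖ ≤ (M * Real.exp (ε / 2 * ‖v‖)) * (M' * Real.exp (ε / 2 * ‖v‖)) :=
        mul_le_mul (hM v) (hM' v) (norm_nonneg _) ((norm_nonneg _).trans (hM v))
    _ = M * M' * (Real.exp (ε / 2 * ‖v‖) * Real.exp (ε / 2 * ‖v‖)) := by ring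
    _ = M * M' * Real.exp (ε * ‖v‖) := by
        rw [← Real.exp_add]
        ring_nf

omit [InnerProductSpace ℝ V] [MeasurableSpace V] in
theorem isTame_const (c : ℂ) : IsTame fun _ : V => c := by
  refine ⟨continuous_const, fun ε hε => ⟨‖c‖, fun v => ?_⟩⟩
  refine le_mul_of_one_le_right (norm_nonneg _) (Real.one_le_exp (by positivity))

omit [MeasurableSpace V] in
theorem isTame_affine (α : V) (s : ℂ) : IsTame fun v => (⟪α, v⟫ : ℂ) - s := by
  refine ⟨by fun_prop, fun ε hε => ⟨‖α‖ * ε⁻¹ + ‖s‖, fun v => ?_⟩⟩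
  have h1 : ‖v‖ ≤ ε⁻¹ * Real.exp (ε * ‖v‖) := by
    rw [inv_mul_eq_div, le_div_iff₀ hε, mul_comm]
    exact (le_add_of_nonneg_right zero_le_one).trans (Real.add_one_le_exp _)
  have h2 : 1 ≤ Real.exp (ε * ‖v‖) := Real.one_le_exp (by positivity)
  calc ‖(⟪α, v⟫ : ℂ) - s‖ ≤ ‖(⟪α, v⟫ : ℂ)‖ + ‖s‖ := norm_sub_le _ _
    _ ≤ ‖α‖ * ‖v‖ + ‖s‖ := by
        rw [Complex.norm_real]
        exact add_le_add_left (norm_inner_le_norm α v) _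
    _ ≤ ‖α‖ * (ε⁻¹ * Real.exp (ε * ‖v‖)) + ‖s‖ * Real.exp (ε * ‖v‖) :=
        add_le_add (mul_le_mul_of_nonneg_left h1 (norm_nonneg _))
          (le_mul_of_one_le_right (norm_nonneg _) h2)
    _ = _ := by ring

theorem IsTame.integrable [BorelSpace V] [SecondCountableTopology V] {m : Measure V} {c : ℝ}
    (hm : Integrable (fun v => Real.exp (c * ‖v‖)) m) {B : V → ℂ} (hB : IsTame B) (t η : V)
    (hη : ‖η‖ < c) : Integrable (fun v => B v * twist t η v) m := by
  obtain ⟨M, hM⟩ := hB.2 (c - ‖η‖) (by linarith)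
  refine (hm.const_mul M).mono' (hB.1.mul (continuous_twist t η)).aestronglyMeasurable
    (ae_of_all _ fun v => ?_)
  rw [norm_mul]
  calc ‖B v‖ * ‖twist t η v‖ ≤ (M * Real.exp ((c - ‖η‖) * ‖v‖)) * Real.exp (‖η‖ * ‖v‖) :=
        mul_le_mul (hM v) (norm_twist_le t η v) (norm_nonneg _) ((norm_nonneg _).trans (hM v))
    _ = M * Real.exp (c * ‖v‖) := by
        rw [mul_assoc, ← Real.exp_add]
        ring_nf

/-- A function with exponentially decaying derivative which vanishes at infinity. -/
theorem norm_le_of_deriv_decay {g g' : ℝ → ℂ} {D b : ℝ} (hb : 0 < b)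
    (hg : ∀ r, HasDerivAt g (g' r) r) (hg' : ∀ r, 0 ≤ r → ‖g' r‖ ≤ D * Real.exp (-b * r))
    (hlim : Tendsto g atTop (𝓝 0)) : ‖g 0‖ ≤ D / b := by
  have hD : 0 ≤ D := by
    have := (norm_nonneg _).trans (hg' 0 le_rfl)
    simpa using this
  have key : ∀ R, 0 ≤ R → ‖g R - g 0‖ ≤ D / b := by
    intro R hR
    have h := image_norm_le_of_norm_deriv_right_le_deriv_boundary (a := 0) (b := R)
      (f := fun r => g r - g 0) (f' := g') (B := fun r => D / b * (1 - Real.exp (-b * r)))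
      (B' := fun r => D * Real.exp (-b * r))
      (fun r _ => ((hg r).sub_const _).continuousAt.continuousWithinAt)
      (fun r _ => ((hg r).sub_const _).hasDerivWithinAt) (by simp) ?_
      (fun r hr => hg' r hr.1) (Set.right_mem_Icc.2 hR)
    · refine h.trans ?_
      have : 0 < Real.exp (-b * R) := Real.exp_pos _
      exact mul_le_of_le_one_right (by positivity) (by linarith)
    · intro r
      have h1 : HasDerivAt (fun r : ℝ => Real.exp (-b * r)) (Real.exp (-b * r) * (-b * 1)) r :=
        ((hasDerivAt_id r).const_mul (-b)).exp
      refine ((h1.const_sub 1).const_mul (D / b)).congr_deriv ?_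
      have := hb.ne'
      field_simp
  have h1 : Tendsto (fun R => ‖g R - g 0‖) atTop (𝓝 ‖0 - g 0‖) := (hlim.sub_const _).norm
  rw [zero_sub, norm_neg] at h1
  exact le_of_tendsto h1 (eventually_atTop.2 ⟨0, fun R hR => key R hR⟩)

omit [MeasurableSpace V] in
/-- For a suitable orientation of the line through `t` with direction `α`, exponential decay along
the line integrates to exponential decay in `t`. -/
theorem exists_orientation {α : V} (hα : α ≠ 0) (u : ℝ) {κ : ℝ} (hκ : 0 < κ) :
    ∃ a b : ℝ, 0 < a ∧ 0 < b ∧ ∀ t : V, ∃ σ : ℝ, σ ≠ 0 ∧ |σ| = 1 ∧ σ * u ≤ 0 ∧ ∀ r, 0 ≤ r →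
      Real.exp (r * (σ * u)) * Real.exp (-κ * ‖t + (r * σ) • α‖) ≤
        Real.exp (-a * ‖t‖) * Real.exp (-b * r) := by
  have hα' : 0 < ‖α‖ := norm_pos_iff.2 hα
  rcases eq_or_ne u 0 with rfl | hu
  -- For `u = 0` there is no exponential factor to help. The ray must not approach the origin, so
  -- `σ` is chosen with `σ ⟨t, α⟩ ≥ 0`.
  · refine ⟨κ / 2, κ * ‖α‖ / 2, by positivity, by positivity, fun t => ?_⟩
    have : ∃ σ : ℝ, σ ≠ 0 ∧ |σ| = 1 ∧ 0 ≤ σ * ⟪t, α⟫ := by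
      rcases le_total 0 ⟪t, α⟫ with h | h
      · exact ⟨1, by norm_num, by norm_num, by linarith⟩
      · exact ⟨-1, by norm_num, by norm_num, by linarith⟩
    obtain ⟨σ, h0, h1, h2⟩ := this
    refine ⟨σ, h0, h1, by simp, fun r hr => ?_⟩
    rw [mul_zero, mul_zero, Real.exp_zero, one_mul, ← Real.exp_add]
    refine Real.exp_le_exp.2 ?_
    have h3 : ‖t‖ ^ 2 + (r * ‖α‖) ^ 2 ≤ ‖t + (r * σ) • α‖ ^ 2 := by
      have hσ : σ ^ 2 = 1 := by rw [← sq_abs, h1, one_pow]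
      rw [norm_add_sq_real, norm_smul, inner_smul_right, Real.norm_eq_abs, abs_mul, h1, mul_one,
        abs_of_nonneg hr]
      nlinarith [mul_nonneg hr h2]
    have h4 : (‖t‖ + r * ‖α‖) / 2 ≤ ‖t + (r * σ) • α‖ := by
      refine abs_le_of_sq_le_sq' ?_ (norm_nonneg _) |>.2
      nlinarith [sq_nonneg (‖t‖ - r * ‖α‖), sq_nonneg ‖t‖, sq_nonneg (r * ‖α‖)]
    nlinarith
  · have hu' : 0 < |u| := abs_pos.2 hu
    -- For `u ≠ 0` the sign of `σ` is forced by `σ u = -|u|`, and the ray may pass near the origin.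
    -- Weakening the decay rate to `θ` lets half of `exp(-r|u|)` pay for that.
    set θ : ℝ := min κ (|u| / (2 * ‖α‖)) with hθ
    have hθ0 : 0 < θ := lt_min hκ (by positivity)
    have hθκ : θ ≤ κ := min_le_left _ _
    have hθu : θ * ‖α‖ ≤ |u| / 2 := by
      have : θ ≤ |u| / (2 * ‖α‖) := min_le_right _ _
      rw [le_div_iff₀ (by positivity)] at this
      linarith
    refine ⟨θ, |u| / 2, hθ0, by positivity, fun t => ?_⟩
    have : ∃ σ : ℝ, σ ≠ 0 ∧ |σ| = 1 ∧ σ * u = -|u| := by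
      rcases le_total 0 u with h | h
      · exact ⟨-1, by norm_num, by norm_num, by rw [abs_of_nonneg h]; ring⟩
      · exact ⟨1, by norm_num, by norm_num, by rw [abs_of_nonpos h]; ring⟩
    obtain ⟨σ, h0, h1, h2⟩ := this
    refine ⟨σ, h0, h1, by rw [h2]; linarith, fun r hr => ?_⟩
    rw [h2, ← Real.exp_add, ← Real.exp_add]
    refine Real.exp_le_exp.2 ?_
    have h3 : ‖t‖ - r * ‖α‖ ≤ ‖t + (r * σ) • α‖ := by
      have := norm_sub_norm_le t (-((r * σ) • α))
      rw [sub_neg_eq_add, norm_neg, norm_smul, Real.norm_eq_abs, abs_mul, h1, mul_one,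
        abs_of_nonneg hr] at this
      exact this
    have h4 : θ * ‖t + (r * σ) • α‖ ≤ κ * ‖t + (r * σ) • α‖ :=
      mul_le_mul_of_nonneg_right hθκ (norm_nonneg _)
    have h5 : θ * (‖t‖ - r * ‖α‖) ≤ θ * ‖t + (r * σ) • α‖ :=
      mul_le_mul_of_nonneg_left h3 hθ0.le
    nlinarith

variable [FiniteDimensional ℝ V] [BorelSpace V]

/-- The Riemann–Lebesgue lemma along a line, for absolutely continuous measures. -/
theorem tendsto_integral_line {m : Measure V} [IsFiniteMeasure m] (hm : m ≪ volume) (f : V → ℂ)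
    {α : V} (hα : α ≠ 0) {σ : ℝ} (hσ : σ ≠ 0) :
    Tendsto (fun r : ℝ => ∫ v, f v * Complex.exp (r * σ * (⟪α, v⟫ : ℂ) * Complex.I) ∂m)
      atTop (𝓝 0) := by
  have h1 := tendsto_integral_exp_inner_smul_cocompact
    (fun v : V => (m.rnDeriv volume v).toReal • f v)
  have h2 : Tendsto (fun r : ℝ => (-(r * (σ / (2 * Real.pi)))) • α) atTop (cocompact V) := by
    rw [← Metric.cobounded_eq_cocompact, ← comap_norm_atTop, tendsto_comap_iff]
    have : (norm ∘ fun r : ℝ => (-(r * (σ / (2 * Real.pi)))) • α) =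
        fun r => |r| * (|σ / (2 * Real.pi)| * ‖α‖) := by
      ext r
      simp only [Function.comp_apply, norm_smul, norm_neg, Real.norm_eq_abs, abs_mul]
      ring
    rw [this]
    refine tendsto_abs_atTop_atTop.atTop_mul_const ?_
    have : σ / (2 * Real.pi) ≠ 0 := by positivity
    have := norm_pos_iff.2 hα
    positivity
  have h3 := h1.comp h2
  refine h3.congr fun r => ?_
  rw [← integral_rnDeriv_smul hm]
  refine integral_congr_ae (ae_of_all _ fun v => ?_)
  simp only [Circle.smul_def, Real.fourierChar_apply', inner_smul_right, Circle.coe_exp, smul_eq_mul,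
    Complex.real_smul]
  rw [show 2 * Real.pi * -(-(r * (σ / (2 * Real.pi))) * ⟪v, α⟫) = r * σ * ⟪α, v⟫ by
    rw [real_inner_comm]
    field_simp]
  push_cast
  ring

/-- Exponential decay can be divided by an affine function. -/
theorem HasDecay.of_affine_mul {m : Measure V} [IsFiniteMeasure m] (hm : m ≪ volume) {c : ℝ}
    (hc : 0 < c) (hmc : Integrable (fun v => Real.exp (c * ‖v‖)) m) {α : V} (hα : α ≠ 0) (s : ℂ)
    {B : V → ℂ} (hB : IsTame B) (h : HasDecay m fun v => ((⟪α, v⟫ : ℂ) - s) * B v) :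
    HasDecay m B := by
  obtain ⟨κ, δ, C, hκ, hδ, h⟩ := h
  obtain ⟨a, b, ha, hb, hor⟩ := exists_orientation hα s.im hκ
  refine ⟨a, min δ c, C / b, ha, lt_min hδ hc, fun t η hη => ?_⟩
  have hηδ : ‖η‖ < δ := hη.trans_le (min_le_left _ _)
  have hηc : ‖η‖ < c := hη.trans_le (min_le_right _ _)
  obtain ⟨σ, hσ0, hσ1, hσu, hσ⟩ := hor t
  have hC : 0 ≤ C := by
    have := (norm_nonneg _).trans (h 0 0 (by simpa using hδ))
    simpa using this
  set A : V → ℂ := fun v => (⟪α, v⟫ : ℂ) - s with hA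
  -- Up to a phase factor, `∫ F r` is the transform of `B m` at `t + rσα`. Its `r`-derivative is the
  -- transform of `(⟨α, v⟩ - s) B m` along the ray, which decays by hypothesis.
  set F : ℝ → V → ℂ := fun r v =>
    B v * twist t η v * Complex.exp (r * (σ * Complex.I * A v)) with hF
  have hexp : ∀ (r : ℝ) v, ‖Complex.exp ((r : ℂ) * (σ * Complex.I * A v))‖ = Real.exp (r * (σ * s.im)) := by
    intro r v
    rw [Complex.norm_exp]
    congr 1
    simp [hA]
  have hAc : Continuous A := (isTame_affine α s).1
  have hFm : ∀ r : ℝ, AEStronglyMeasurable (F r) m := fun r =>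
    Continuous.aestronglyMeasurable ((hB.1.mul (continuous_twist t η)).mul (by fun_prop))
  have hFeq : ∀ r v, F r v = Complex.exp (-(r * σ * s * Complex.I)) *
      (B v * twist (t + (r * σ) • α) η v) := by
    intro r v
    simp only [hF, twist, hA]
    rw [mul_assoc, mul_left_comm (Complex.exp _) (B v), ← Complex.exp_add, ← Complex.exp_add,
      inner_add_left, inner_smul_left]
    congr 2
    simp only [conj_trivial]
    push_cast
    ring
  have hderiv : ∀ r : ℝ, HasDerivAt (fun r => ∫ v, F r v ∂m)
      (∫ v, σ * Complex.I * A v * F r v ∂m) r := by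
    intro r
    refine (hasDerivAt_integral_of_dominated_loc_of_deriv_le (𝕜 := ℝ) (μ := m) (F := F)
      (F' := fun r v => σ * Complex.I * A v * F r v)
      (bound := fun v => Real.exp ((|r| + 1) * |σ * s.im|) * ‖A v * B v * twist t η v‖)
      (Metric.ball_mem_nhds r one_pos) (Eventually.of_forall hFm) ?_ ?_ ?_ ?_ ?_).2
    · have h1 := (hB.integrable hmc (t + (r * σ) • α) η hηc).const_mul
        (Complex.exp (-(r * σ * s * Complex.I)))
      exact h1.congr (ae_of_all _ fun v => (hFeq r v).symm)
    · exact (Continuous.aestronglyMeasurable (by fun_prop)).mul (hFm r)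
    · refine ae_of_all _ fun v x hx => ?_
      have hxr : |x| ≤ |r| + 1 := by
        have h1 : |x - r| < 1 := by simpa [Real.dist_eq] using hx
        have h2 := abs_add_le r (x - r)
        rw [add_sub_cancel] at h2
        linarith
      simp only [hF]
      rw [norm_mul, norm_mul, norm_mul, norm_mul, hexp, Complex.norm_real, Real.norm_eq_abs, hσ1,
        Complex.norm_I, mul_one, one_mul]
      rw [norm_mul (A v * B v), norm_mul (A v), norm_mul (B v)]
      have h3 : Real.exp (x * (σ * s.im)) ≤ Real.exp ((|r| + 1) * |σ * s.im|) := by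
        refine Real.exp_le_exp.2 ((le_abs_self _).trans ?_)
        rw [abs_mul]
        exact mul_le_mul_of_nonneg_right hxr (abs_nonneg _)
      calc ‖A v‖ * (‖B v‖ * ‖twist t η v‖ * Real.exp (x * (σ * s.im)))
          = Real.exp (x * (σ * s.im)) * (‖A v‖ * ‖B v‖ * ‖twist t η v‖) := by ring
        _ ≤ _ := mul_le_mul_of_nonneg_right h3 (by positivity)
    · exact (((isTame_affine α s).mul hB).integrable hmc t η hηc).norm.const_mul _
    · refine ae_of_all _ fun v x _ => ?_
      have h1 : HasDerivAt (fun x : ℝ => (x : ℂ) * (σ * Complex.I * A v)) (1 * (σ * Complex.I * A v)) x :=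
        (Complex.ofRealCLM.hasDerivAt (x := x)).mul_const _
      have h2 := h1.cexp.const_mul (B v * twist t η v)
      refine h2.congr_deriv ?_
      ring
  have hphase : ∀ r : ℝ, ‖Complex.exp (-(r * σ * s * Complex.I))‖ = Real.exp (r * (σ * s.im)) := by
    intro r
    rw [Complex.norm_exp]
    congr 1
    simp
    ring
  have hbound : ∀ r, 0 ≤ r → ‖∫ v, σ * Complex.I * A v * F r v ∂m‖ ≤
      C * Real.exp (-a * ‖t‖) * Real.exp (-b * r) := by
    intro r hr
    have h1 : (∫ v, σ * Complex.I * A v * F r v ∂m) =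
        (σ * Complex.I * Complex.exp (-(r * σ * s * Complex.I))) *
          ∫ v, A v * B v * twist (t + (r * σ) • α) η v ∂m := by
      rw [← integral_const_mul]
      refine integral_congr_ae (ae_of_all _ fun v => ?_)
      simp only [hFeq]
      ring
    rw [h1, norm_mul, norm_mul, norm_mul, hphase, Complex.norm_real, Real.norm_eq_abs, hσ1,
      Complex.norm_I, mul_one, one_mul]
    calc Real.exp (r * (σ * s.im)) * ‖∫ v, A v * B v * twist (t + (r * σ) • α) η v ∂m‖
        ≤ Real.exp (r * (σ * s.im)) * (C * Real.exp (-κ * ‖t + (r * σ) • α‖)) :=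
          mul_le_mul_of_nonneg_left (h _ η hηδ) (Real.exp_pos _).le
      _ = C * (Real.exp (r * (σ * s.im)) * Real.exp (-κ * ‖t + (r * σ) • α‖)) := by ring
      _ ≤ C * (Real.exp (-a * ‖t‖) * Real.exp (-b * r)) := mul_le_mul_of_nonneg_left (hσ r hr) hC
      _ = _ := by ring
  -- Absolute continuity of `m` enters here, through the Riemann–Lebesgue lemma; the phase factor
  -- stays bounded because `σ Im s ≤ 0`. The value at `r = 0` is then recovered by integrating the
  -- derivative from infinity.
  have hlim : Tendsto (fun r : ℝ => ∫ v, F r v ∂m) atTop (𝓝 0) := by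
    have h1 := tendsto_integral_line hm (fun v => B v * twist t η v) hα hσ0
    rw [tendsto_zero_iff_norm_tendsto_zero] at h1 ⊢
    refine squeeze_zero' (Eventually.of_forall fun _ => norm_nonneg _) ?_ h1
    filter_upwards [eventually_ge_atTop 0] with r hr
    have h2 : (∫ v, F r v ∂m) = Complex.exp (-(r * σ * s * Complex.I)) *
        ∫ v, B v * twist t η v * Complex.exp (r * σ * (⟪α, v⟫ : ℂ) * Complex.I) ∂m := by
      rw [← integral_const_mul]
      refine integral_congr_ae (ae_of_all _ fun v => ?_)
      simp only [hF, hA]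
      rw [mul_left_comm (Complex.exp (-(r * σ * s * Complex.I))), ← Complex.exp_add]
      ring_nf
    rw [h2, norm_mul, hphase]
    refine mul_le_of_le_one_left (norm_nonneg _) (Real.exp_le_one_iff.2 ?_)
    exact mul_nonpos_of_nonneg_of_nonpos hr hσu
  have hfin := norm_le_of_deriv_decay hb hderiv hbound hlim
  have h0 : (∫ v, F 0 v ∂m) = ∫ v, B v * twist t η v ∂m := by
    refine integral_congr_ae (ae_of_all _ fun v => ?_)
    simp [hF]
  rw [h0] at hfin
  exact hfin.trans_eq (by ring)

/-- Multiplication by `p` reflects exponential decay. -/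
def IsStrippable (m : Measure V) (p : V → ℂ) : Prop :=
  IsTame p ∧ ∀ B : V → ℂ, IsTame B → HasDecay m (fun v => p v * B v) → HasDecay m B

omit [FiniteDimensional ℝ V] [BorelSpace V] in
theorem IsStrippable.mul {m : Measure V} {p q : V → ℂ} (hp : IsStrippable m p)
    (hq : IsStrippable m q) : IsStrippable m fun v => p v * q v := by
  refine ⟨hp.1.mul hq.1, fun B hB h => hq.2 B hB (hp.2 _ (hq.1.mul hB) ?_)⟩
  simpa only [mul_assoc] using h

omit [FiniteDimensional ℝ V] [BorelSpace V] in
theorem isStrippable_const {m : Measure V} {c : ℂ} (hc : c ≠ 0) :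
    IsStrippable m fun _ : V => c := by
  refine ⟨isTame_const c, fun B hB ⟨κ, δ, C, hκ, hδ, h⟩ => ?_⟩
  refine ⟨κ, δ, ‖c‖⁻¹ * C, hκ, hδ, fun t η hη => ?_⟩
  have h1 := h t η hη
  simp only [mul_assoc] at h1
  rw [integral_const_mul, norm_mul] at h1
  rw [mul_assoc, inv_mul_eq_div, le_div_iff₀ (norm_pos_iff.2 hc), mul_comm]
  exact h1

omit [FiniteDimensional ℝ V] [BorelSpace V] in
theorem isStrippable_prod {m : Measure V} {ι : Type*} (S : Finset ι) (p : ι → V → ℂ)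
    (h : ∀ i ∈ S, IsStrippable m (p i)) : IsStrippable m fun v => ∏ i ∈ S, p i v := by
  classical
  induction S using Finset.induction_on with
  | empty => simpa using isStrippable_const (m := m) one_ne_zero
  | insert i S hi ih =>
    simp only [Finset.prod_insert hi]
    exact (h i (Finset.mem_insert_self _ _)).mul
      (ih fun j hj => h j (Finset.mem_insert_of_mem hj))

theorem isStrippable_affine {m : Measure V} [IsFiniteMeasure m] (hm : m ≪ volume) {c : ℝ}
    (hc : 0 < c) (hmc : Integrable (fun v => Real.exp (c * ‖v‖)) m) {α : V} (hα : α ≠ 0) (s : ℂ) :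
    IsStrippable m fun v => (⟪α, v⟫ : ℂ) - s :=
  ⟨isTame_affine α s, fun _ hB h => h.of_affine_mul hm hc hmc hα s hB⟩

end Decay

end AbelianCoulomb

end

noncomputable section

namespace AbelianCoulomb

/-! ### Holomorphic densities -/

section Density

open Filter MeasureTheory
open scoped RealInnerProductSpace FourierTransform

variable {V : Type*} [NormedAddCommGroup V] [InnerProductSpace ℝ V] [FiniteDimensional ℝ V]
  [MeasurableSpace V] [BorelSpace V]

theorem integrable_exp_neg_mul_norm {b : ℝ} (hb : 0 < b) :
    Integrable fun t : V => Real.exp (-b * ‖t‖) := by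
  set N : ℕ := Module.finrank ℝ V + 1 with hN
  have h1 : Integrable fun t : V => (1 + ‖t‖) ^ (-(N : ℝ)) :=
    integrable_one_add_norm (by rw [hN]; push_cast; linarith)
  refine (h1.const_mul (Real.exp b * N.factorial / b ^ N)).mono'
    (Continuous.aestronglyMeasurable (by fun_prop)) (ae_of_all _ fun t => ?_)
  have hpos : 0 < 1 + ‖t‖ := by positivity
  have h2 := Real.pow_div_factorial_le_exp (b * (1 + ‖t‖)) (by positivity) N
  rw [div_le_iff₀ (by positivity), mul_pow] at h2
  rw [Real.norm_of_nonneg (Real.exp_pos _).le, Real.rpow_neg hpos.le, Real.rpow_natCast,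
    ← div_eq_mul_inv, le_div_iff₀ (by positivity), le_div_iff₀ (by positivity)]
  calc Real.exp (-b * ‖t‖) * (1 + ‖t‖) ^ N * b ^ N
      = Real.exp (-b * ‖t‖) * (b ^ N * (1 + ‖t‖) ^ N) := by ring
    _ ≤ Real.exp (-b * ‖t‖) * (Real.exp (b * (1 + ‖t‖)) * N.factorial) :=
        mul_le_mul_of_nonneg_left h2 (Real.exp_pos _).le
    _ = Real.exp b * N.factorial := by
        rw [← mul_assoc, ← Real.exp_add]
        ring_nf

/-- The holomorphic extension of the density of `m` to the points `x + i y`, by the Fourier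
inversion formula. -/
def holomorphicDensity (m : Measure V) (x y : V) : ℂ :=
  ∫ t, fourierMeasure m t *
    Complex.exp (2 * Real.pi * Complex.I * ((⟪t, x⟫ : ℂ) + Complex.I * (⟪t, y⟫ : ℂ)))

theorem measurable_fourierMeasure (m : Measure V) [IsFiniteMeasure m] :
    Measurable (fourierMeasure m) :=
  measurable_charFun.comp (measurable_const_smul _)

/-- An imaginary part of size at most `κ/2` uses up half of the decay rate and leaves an integrable
exponential. -/
theorem norm_holomorphicDensity_le {m : Measure V} {C κ : ℝ}
    (h : ∀ t, ‖fourierMeasure m t‖ ≤ C * Real.exp (-(2 * Real.pi * κ) * ‖t‖)) {x y : V}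
    (hκ : 0 < κ) (hy : ‖y‖ ≤ κ / 2) :
    ‖holomorphicDensity m x y‖ ≤ C * ∫ t : V, Real.exp (-(Real.pi * κ) * ‖t‖) := by
  have hπ := Real.pi_pos
  have hC : 0 ≤ C := by
    have := (norm_nonneg _).trans (h 0)
    simpa using this
  rw [← integral_const_mul]
  refine norm_integral_le_of_norm_le ((integrable_exp_neg_mul_norm (by positivity)).const_mul C)
    (ae_of_all _ fun t => ?_)
  rw [norm_mul, Complex.norm_exp]
  have h1 : (2 * Real.pi * Complex.I * ((⟪t, x⟫ : ℂ) + Complex.I * (⟪t, y⟫ : ℂ))).re =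
      -(2 * Real.pi * ⟪t, y⟫) := by
    simp
  have h2 : -⟪t, y⟫ ≤ ‖t‖ * (κ / 2) :=
    (neg_le_abs _).trans ((abs_real_inner_le_norm t y).trans
      (mul_le_mul_of_nonneg_left hy (norm_nonneg t)))
  rw [h1]
  calc ‖fourierMeasure m t‖ * Real.exp (-(2 * Real.pi * ⟪t, y⟫))
      ≤ (C * Real.exp (-(2 * Real.pi * κ) * ‖t‖)) * Real.exp (-(2 * Real.pi * ⟪t, y⟫)) :=
        mul_le_mul_of_nonneg_right (h t) (Real.exp_pos _).le
    _ = C * Real.exp (-(2 * Real.pi * κ) * ‖t‖ + -(2 * Real.pi * ⟪t, y⟫)) := by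
        rw [mul_assoc, ← Real.exp_add]
    _ ≤ C * Real.exp (-(Real.pi * κ) * ‖t‖) := by
        refine mul_le_mul_of_nonneg_left (Real.exp_le_exp.2 ?_) hC
        nlinarith

theorem integrable_exp_mul_fourierMeasure {m : Measure V} [IsFiniteMeasure m] {C κ : ℝ}
    (h : ∀ t, ‖fourierMeasure m t‖ ≤ C * Real.exp (-(2 * Real.pi * κ) * ‖t‖)) (hκ : 0 < κ) :
    Integrable fun t : V => Real.exp (Real.pi * κ * ‖t‖) * ‖fourierMeasure m t‖ := by
  have hπ := Real.pi_pos
  refine ((integrable_exp_neg_mul_norm (V := V) (b := Real.pi * κ) (by positivity)).const_mul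
    C).mono' ?_ (ae_of_all _ fun t => ?_)
  · exact (Continuous.aestronglyMeasurable (by fun_prop)).mul
      (measurable_fourierMeasure m).norm.aestronglyMeasurable
  · rw [norm_mul, norm_norm, Real.norm_of_nonneg (Real.exp_pos _).le]
    calc Real.exp (Real.pi * κ * ‖t‖) * ‖fourierMeasure m t‖
        ≤ Real.exp (Real.pi * κ * ‖t‖) * (C * Real.exp (-(2 * Real.pi * κ) * ‖t‖)) :=
          mul_le_mul_of_nonneg_left (h t) (Real.exp_pos _).le
      _ = C * Real.exp (-(Real.pi * κ) * ‖t‖) := by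
          rw [mul_left_comm, ← Real.exp_add]
          ring_nf

theorem integrable_fourierMeasure {m : Measure V} [IsFiniteMeasure m] {C κ : ℝ}
    (h : ∀ t, ‖fourierMeasure m t‖ ≤ C * Real.exp (-(2 * Real.pi * κ) * ‖t‖)) (hκ : 0 < κ) :
    Integrable (fourierMeasure m) := by
  have hπ := Real.pi_pos
  refine (integrable_exp_mul_fourierMeasure h hκ).mono'
    (measurable_fourierMeasure m).aestronglyMeasurable (ae_of_all _ fun t => ?_)
  exact le_mul_of_one_le_left (norm_nonneg _) (Real.one_le_exp (by positivity))

theorem fourierInv_fourierMeasure (m : Measure V) (x : V) :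
    𝓕⁻ (fourierMeasure m) x = holomorphicDensity m x 0 := by
  rw [Real.fourierInv_eq', holomorphicDensity]
  refine integral_congr_ae (ae_of_all _ fun t => ?_)
  simp only [inner_zero_right, smul_eq_mul, Complex.ofReal_zero, mul_zero, add_zero]
  rw [mul_comm]
  push_cast
  ring_nf

/-- Holomorphy of the density along a complex line. -/
theorem differentiableOn_holomorphicDensity_line {m : Measure V} [IsFiniteMeasure m] {C κ : ℝ}
    (h : ∀ t, ‖fourierMeasure m t‖ ≤ C * Real.exp (-(2 * Real.pi * κ) * ‖t‖)) (hκ : 0 < κ)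
    (x y : V) :
    DifferentiableOn ℂ (fun s : ℂ => ∫ t, fourierMeasure m t *
      Complex.exp (2 * Real.pi * Complex.I * ((⟪t, x⟫ : ℂ) + s * (⟪t, y⟫ : ℂ))))
      {s | 2 * Real.pi * ‖y‖ * |s.im| < Real.pi * κ} := by
  have hcont : Continuous fun t : V => Complex.exp (2 * Real.pi * Complex.I * (⟪t, x⟫ : ℂ)) := by
    fun_prop
  have hphase : ∀ t : V, ‖Complex.exp (2 * Real.pi * Complex.I * (⟪t, x⟫ : ℂ))‖ = 1 := by
    intro t
    rw [Complex.norm_exp]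
    simp
  have hL := differentiableOn_integral_mul_cexp (X := V) (E := ℂ) volume
    (fun t => fourierMeasure m t * Complex.exp (2 * Real.pi * Complex.I * (⟪t, x⟫ : ℂ)))
    ((measurable_fourierMeasure m).aestronglyMeasurable.mul hcont.aestronglyMeasurable)
    (Real.pi * κ) ?_
    ((innerSL ℝ y).smulRight ((2 * Real.pi * Complex.I) • ContinuousLinearMap.id ℂ ℂ))
    (fun s => 2 * Real.pi * ‖y‖ * |s.im|) (by fun_prop) ?_
  · refine hL.congr fun s _ => integral_congr_ae (ae_of_all _ fun t => ?_)
    simp only [ContinuousLinearMap.smulRight_apply, innerSL_apply_apply, smul_apply,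
      ContinuousLinearMap.id_apply, smul_eq_mul, Complex.real_smul]
    rw [mul_assoc (fourierMeasure m t), ← Complex.exp_add, real_inner_comm y t]
    ring_nf
  · simpa only [norm_mul, hphase, mul_one] using integrable_exp_mul_fourierMeasure h hκ
  · intro t s
    have h1 : (((innerSL ℝ y).smulRight
        ((2 * Real.pi * Complex.I) • ContinuousLinearMap.id ℂ ℂ)) t s).re =
        2 * Real.pi * (-(⟪y, t⟫ * s.im)) := by
      simp
      ring
    rw [h1]
    have h2 : -(⟪y, t⟫ * s.im) ≤ ‖y‖ * ‖t‖ * |s.im| := by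
      refine (neg_le_abs _).trans ?_
      rw [abs_mul]
      exact mul_le_mul_of_nonneg_right (abs_real_inner_le_norm y t) (abs_nonneg _)
    have hπ := Real.pi_pos
    calc 2 * Real.pi * (-(⟪y, t⟫ * s.im)) ≤ 2 * Real.pi * (‖y‖ * ‖t‖ * |s.im|) :=
          mul_le_mul_of_nonneg_left h2 (by positivity)
      _ = _ := by ring

/-- The measure `e^(-⟨η, v⟩) m`. -/
def tilt (m : Measure V) (η : V) : Measure V :=
  m.withDensity fun v => ENNReal.ofReal (Real.exp (-⟪η, v⟫))

omit [FiniteDimensional ℝ V] in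
theorem isFiniteMeasure_tilt {m : Measure V} {c : ℝ}
    (hmc : Integrable (fun v => Real.exp (c * ‖v‖)) m) {η : V} (hη : ‖η‖ ≤ c) :
    IsFiniteMeasure (tilt m η) := by
  refine isFiniteMeasure_withDensity_ofReal (Integrable.hasFiniteIntegral ?_)
  refine hmc.mono' (Continuous.aestronglyMeasurable (by fun_prop)) (ae_of_all _ fun v => ?_)
  rw [Real.norm_of_nonneg (Real.exp_pos _).le]
  exact Real.exp_le_exp.2 ((neg_le_abs _).trans ((abs_real_inner_le_norm η v).trans
    (mul_le_mul_of_nonneg_right hη (norm_nonneg v))))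

theorem fourierMeasure_tilt (m : Measure V) (η t : V) :
    fourierMeasure (tilt m η) t = ∫ v, twist (-(2 * Real.pi) • t) η v ∂m := by
  rw [fourierMeasure, charFun_apply, tilt, integral_withDensity_eq_integral_toReal_smul
    (Measurable.ennreal_ofReal (by fun_prop)) (ae_of_all _ fun _ => ENNReal.ofReal_lt_top)]
  refine integral_congr_ae (ae_of_all _ fun v => ?_)
  simp only [twist]
  rw [ENNReal.toReal_ofReal (Real.exp_pos _).le, Complex.real_smul, Complex.ofReal_exp,
    ← Complex.exp_add, real_inner_comm (-(2 * Real.pi) • t) v]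
  push_cast
  ring_nf

/-- A measure with exponential moments, whose Fourier–Laplace transform decays exponentially, has a
holomorphic and exponentially decaying density. -/
theorem HasDecay.exists_density {m : Measure V} [IsFiniteMeasure m] {c : ℝ} (hc : 0 < c)
    (hmc : Integrable (fun v => Real.exp (c * ‖v‖)) m) (h : HasDecay m fun _ => 1) :
    m ≪ volume ∧ (∀ᵐ x, (((m.rnDeriv volume x).toReal : ℝ) : ℂ) = holomorphicDensity m x 0) ∧
      ∃ κ : ℝ, 0 < κ ∧
        Integrable (fun t : V => Real.exp (Real.pi * κ * ‖t‖) * ‖fourierMeasure m t‖) ∧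
        ∃ C c : ℝ, 0 < c ∧ ∀ x y, ‖y‖ < κ / 2 →
          ‖holomorphicDensity m x y‖ ≤ C * Real.exp (-c * ‖x‖) := by
  obtain ⟨κ, δ₀, C, hκ, hδ₀, h⟩ := h
  have hπ := Real.pi_pos
  set δ : ℝ := min δ₀ c with hδdef
  have hδ : 0 < δ := lt_min hδ₀ hc
  have hfin : ∀ η : V, ‖η‖ < δ → IsFiniteMeasure (tilt m η) := fun η hη =>
    isFiniteMeasure_tilt hmc (hη.le.trans (min_le_right _ _))
  have hbound : ∀ η : V, ‖η‖ < δ → ∀ t,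
      ‖fourierMeasure (tilt m η) t‖ ≤ C * Real.exp (-(2 * Real.pi * κ) * ‖t‖) := by
    intro η hη t
    rw [fourierMeasure_tilt]
    have h1 := h (-(2 * Real.pi) • t) η (hη.trans_le (min_le_left _ _))
    simp only [one_mul] at h1
    rw [norm_smul, norm_neg, Real.norm_of_nonneg (by positivity)] at h1
    refine h1.trans_eq ?_
    ring_nf
  have htilt0 : tilt m (0 : V) = m := by
    simp [tilt]
  have hbound0 := hbound 0 (by simpa using hδ)
  rw [htilt0] at hbound0
  have hint := integrable_fourierMeasure hbound0 hκ
  have hac := absolutelyContinuous_of_integrable_fourierMeasure m hint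
  have hdens := rnDeriv_eq_fourierInv m hint
  -- Tilting the measure multiplies its density by `exp(-⟨η, x⟩)`. The two sides agree almost
  -- everywhere, and everywhere by continuity.
  have hreal : ∀ η : V, ‖η‖ < δ → ∀ x,
      holomorphicDensity (tilt m η) x 0 = Complex.exp (-(⟪η, x⟫ : ℂ)) * holomorphicDensity m x 0 := by
    intro η hη
    have := hfin η hη
    have hint' := integrable_fourierMeasure (hbound η hη) hκ
    have h1 := rnDeriv_eq_fourierInv (tilt m η) hint'
    have h2 : (tilt m η).rnDeriv volume =ᵐ[volume] _ := Measure.rnDeriv_withDensity_left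
      (μ := m) (ν := volume) (f := fun v => ENNReal.ofReal (Real.exp (-⟪η, v⟫)))
      (Measurable.aemeasurable (Measurable.ennreal_ofReal (by fun_prop)))
      (ae_of_all _ fun _ => ENNReal.ofReal_ne_top)
    have h3 : 𝓕⁻ (fourierMeasure (tilt m η)) =ᵐ[volume]
        fun x => Complex.exp (-(⟪η, x⟫ : ℂ)) * 𝓕⁻ (fourierMeasure m) x := by
      filter_upwards [h1, h2, hdens] with x hx1 hx2 hx3
      rw [← hx1, ← hx3, hx2, ENNReal.toReal_mul, ENNReal.toReal_ofReal (Real.exp_pos _).le]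
      push_cast
      rfl
    have h4 := Measure.eq_of_ae_eq h3 (continuous_fourierInv hint')
      ((by fun_prop : Continuous fun x : V => Complex.exp (-(⟪η, x⟫ : ℂ))).mul
        (continuous_fourierInv hint))
    intro x
    rw [← fourierInv_fourierMeasure, ← fourierInv_fourierMeasure, h4]
  have hcomplex : ∀ η : V, ‖η‖ < δ → ∀ x y, ‖y‖ < κ / 2 → holomorphicDensity (tilt m η) x y =
      Complex.exp (-((⟪η, x⟫ : ℂ) + Complex.I * (⟪η, y⟫ : ℂ))) * holomorphicDensity m x y := by
    intro η hη x y hy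
    have := hfin η hη
    -- Identity theorem on the complex line `s ↦ x + s y`: the formula holds for real `s` and is
    -- wanted at `s = i`.
    set Ω : Set ℂ := {s | 2 * Real.pi * ‖y‖ * |s.im| < Real.pi * κ} with hΩ
    have hΩo : IsOpen Ω := isOpen_lt (by fun_prop) continuous_const
    have hΩc : Convex ℝ Ω := by
      have : Ω = Complex.imLm ⁻¹' {r : ℝ | 2 * Real.pi * ‖y‖ * |r| < Real.pi * κ} := rfl
      rw [this]
      refine Convex.linear_preimage ?_ _
      have hconv : ConvexOn ℝ Set.univ fun r : ℝ => 2 * Real.pi * ‖y‖ * |r| := by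
        have := (convexOn_norm (convex_univ (𝕜 := ℝ) (E := ℝ))).smul
          (by positivity : (0 : ℝ) ≤ 2 * Real.pi * ‖y‖)
        exact this
      simpa using hconv.convex_lt (Real.pi * κ)
    have h0 : (0 : ℂ) ∈ Ω := by simp [hΩ]; positivity
    have hI : Complex.I ∈ Ω := by
      simp only [hΩ, Set.mem_ofPred_eq, Complex.I_im, abs_one, mul_one]
      nlinarith
    have hf := (differentiableOn_holomorphicDensity_line (hbound η hη) hκ x y).analyticOnNhd hΩo
    have hg := (differentiableOn_holomorphicDensity_line hbound0 hκ x y)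
    have hg' : DifferentiableOn ℂ (fun s : ℂ => Complex.exp (-((⟪η, x⟫ : ℂ) + s * (⟪η, y⟫ : ℂ))) *
        ∫ t, fourierMeasure m t *
          Complex.exp (2 * Real.pi * Complex.I * ((⟪t, x⟫ : ℂ) + s * (⟪t, y⟫ : ℂ)))) Ω :=
      DifferentiableOn.mul (by fun_prop) hg
    have heq := hf.eqOn_of_preconnected_of_frequently_eq (hg'.analyticOnNhd hΩo)
      hΩc.isPreconnected h0 ?_ hI
    · exact heq
    · have hreal' : ∀ r : ℝ, (∫ t, fourierMeasure (tilt m η) t *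
          Complex.exp (2 * Real.pi * Complex.I * ((⟪t, x⟫ : ℂ) + r * (⟪t, y⟫ : ℂ)))) =
          Complex.exp (-((⟪η, x⟫ : ℂ) + r * (⟪η, y⟫ : ℂ))) * ∫ t, fourierMeasure m t *
          Complex.exp (2 * Real.pi * Complex.I * ((⟪t, x⟫ : ℂ) + r * (⟪t, y⟫ : ℂ))) := by
        intro r
        have h1 := hreal η hη (x + r • y)
        simp only [holomorphicDensity, inner_add_right, inner_smul_right, inner_zero_right,
          Complex.ofReal_zero, mul_zero, add_zero] at h1
        push_cast at h1
        exact h1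
      have ht : Tendsto (fun n : ℕ => (((n : ℝ) + 1)⁻¹ : ℝ)) atTop (𝓝 0) :=
        tendsto_inv_atTop_zero.comp (tendsto_atTop_add_const_right _ _ tendsto_natCast_atTop_atTop)
      have ht' : Tendsto (fun n : ℕ => ((((n : ℝ) + 1)⁻¹ : ℝ) : ℂ)) atTop (𝓝[≠] 0) := by
        refine tendsto_nhdsWithin_iff.2 ⟨?_, Eventually.of_forall fun n => ?_⟩
        · exact (Complex.continuous_ofReal.tendsto' 0 0 (by simp)).comp ht
        · simp only [Set.mem_compl_iff, Set.mem_singleton_iff, Complex.ofReal_eq_zero]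
          positivity
      exact ht'.frequently (Frequently.of_forall fun n => hreal' _)
  refine ⟨hac, ?_, κ, hκ, integrable_exp_mul_fourierMeasure hbound0 hκ, ?_⟩
  · simpa only [fourierInv_fourierMeasure] using hdens
  · refine ⟨C * ∫ t : V, Real.exp (-(Real.pi * κ) * ‖t‖), δ / 2, by positivity, fun x y hy => ?_⟩
    -- The tilted densities have a bound independent of `η`. Tilting in the direction of `-x` turns
    -- this bound into decay at rate `δ/2`.
    set η : V := -((δ / 2 * ‖x‖⁻¹) • x) with hη
    have hηδ : ‖η‖ < δ := by
      rw [hη, norm_neg, norm_smul, Real.norm_of_nonneg (by positivity), mul_assoc]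
      have : ‖x‖⁻¹ * ‖x‖ ≤ 1 := inv_mul_le_one
      nlinarith
    have hηx : ⟪η, x⟫ = -(δ / 2 * ‖x‖) := by
      rw [hη, inner_neg_left, inner_smul_left, real_inner_self_eq_norm_sq]
      rcases eq_or_ne ‖x‖ 0 with h0 | h0
      · simp [h0]
      · simp only [conj_trivial]
        field_simp
    have h1 := norm_holomorphicDensity_le (hbound η hηδ) (x := x) hκ hy.le
    rw [hcomplex η hηδ x y hy, norm_mul, Complex.norm_exp] at h1
    have h2 : (-((⟪η, x⟫ : ℂ) + Complex.I * (⟪η, y⟫ : ℂ))).re = δ / 2 * ‖x‖ := by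
      simp [hηx]
    rw [h2] at h1
    calc ‖holomorphicDensity m x y‖
        = Real.exp (-(δ / 2) * ‖x‖) * (Real.exp (δ / 2 * ‖x‖) * ‖holomorphicDensity m x y‖) := by
          rw [← mul_assoc, ← Real.exp_add]
          ring_nf
          simp
      _ ≤ Real.exp (-(δ / 2) * ‖x‖) * (C * ∫ t : V, Real.exp (-(Real.pi * κ) * ‖t‖)) :=
          mul_le_mul_of_nonneg_left h1 (Real.exp_pos _).le
      _ = _ := mul_comm _ _

end Density

end AbelianCoulomb

end

noncomputable section

namespace AbelianCoulomb

/-! ### Shift relations for measures -/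

section ShiftRelation

open Filter MeasureTheory
open scoped RealInnerProductSpace Nat

theorem IsTame.add {V : Type*} [NormedAddCommGroup V] {B B' : V → ℂ} (h : IsTame B)
    (h' : IsTame B') : IsTame fun v => B v + B' v := by
  refine ⟨h.1.add h'.1, fun ε hε => ?_⟩
  obtain ⟨M, hM⟩ := h.2 ε hε
  obtain ⟨M', hM'⟩ := h'.2 ε hε
  refine ⟨M + M', fun v => (norm_add_le _ _).trans ?_⟩
  rw [add_mul]
  exact add_le_add (hM v) (hM' v)

variable {d : ℕ}

/-- The value of a polynomial at the imaginary point `i z`. -/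
def imagEval (z : EuclideanSpace ℝ (Fin d)) : MvPolynomial (Fin d) ℂ →+* ℂ :=
  MvPolynomial.eval fun k => Complex.I * (z k : ℂ)

theorem imagEval_C (z : EuclideanSpace ℝ (Fin d)) (a : ℂ) :
    imagEval z (MvPolynomial.C a) = a := MvPolynomial.eval_C a

theorem imagEval_X (z : EuclideanSpace ℝ (Fin d)) (k : Fin d) :
    imagEval z (MvPolynomial.X k) = Complex.I * (z k : ℂ) := MvPolynomial.eval_X k

theorem isTame_imagEval (f : MvPolynomial (Fin d) ℂ) :
    IsTame fun z : EuclideanSpace ℝ (Fin d) => imagEval z f := by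
  induction f using MvPolynomial.induction_on with
  | C a => simpa only [imagEval_C] using isTame_const a
  | add p q hp hq => simpa only [map_add] using hp.add hq
  | mul_X p k hp =>
    simp only [map_mul, imagEval_X]
    refine hp.mul ((isTame_const Complex.I).mul ?_)
    have h := isTame_affine (EuclideanSpace.single k (1 : ℝ)) 0
    simpa only [EuclideanSpace.inner_single_left, map_one, one_mul, sub_zero] using h

/-- A lattice vector, as a vector of the Euclidean space. -/
def latticeVector (l : Fin d → ℤ) : EuclideanSpace ℝ (Fin d) := WithLp.toLp 2 fun k => (l k : ℝ)

/-- The relation between a measure and its translate by `i l`, on the ideal generated by `D`, in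
terms of Fourier–Laplace transforms. -/
def ShiftRelation (ν : Measure (EuclideanSpace ℝ (Fin d))) (c : ℝ) (l : Fin d → ℤ)
    (D : MvPolynomial (Fin d) ℂ) (χ : ℂ) : Prop :=
  ∀ (g : MvPolynomial (Fin d) ℂ) (t η : EuclideanSpace ℝ (Fin d)), ‖η‖ < c →
    Complex.exp ((⟪t, latticeVector l⟫ : ℂ) + Complex.I * (⟪η, latticeVector l⟫ : ℂ)) *
      ∫ z, imagEval z (shift l (g * D)) * twist t η z ∂ν =
    χ * ∫ z, imagEval z (g * D) * twist t η z ∂ν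

/-- Links transforms to moments: for polynomial `p` and `q` every term of the series is a moment. -/
theorem hasSum_integral_exp {X : Type*} [MeasurableSpace X] {ν : Measure X} {p q : X → ℂ}
    (hp : AEStronglyMeasurable p ν) (hq : AEStronglyMeasurable q ν)
    (h : Integrable (fun x => ‖p x‖ * Real.exp ‖q x‖) ν) :
    HasSum (fun m : ℕ => ∫ x, p x * (q x ^ m / (m ! : ℂ)) ∂ν)
      (∫ x, p x * Complex.exp (q x) ∂ν) := by
  have hsum : ∀ x, HasSum (fun m : ℕ => ‖p x‖ * (‖q x‖ ^ m / (m ! : ℝ)))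
      (‖p x‖ * Real.exp ‖q x‖) := by
    intro x
    rw [Real.exp_eq_exp_ℝ]
    exact (NormedSpace.expSeries_div_hasSum_exp ‖q x‖).mul_left _
  refine hasSum_integral_of_dominated_convergence
    (fun m x => ‖p x‖ * (‖q x‖ ^ m / (m ! : ℝ))) (fun m => ?_) (fun m => ?_) ?_ ?_ ?_
  · exact hp.mul ((hq.pow m).mul_const _)
  · refine ae_of_all _ fun x => ?_
    simp
  · exact ae_of_all _ fun x => (hsum x).summable
  · exact h.congr (ae_of_all _ fun x => (hsum x).tsum_eq.symm)
  · refine ae_of_all _ fun x => ?_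
    rw [Complex.exp_eq_exp_ℂ]
    exact (NormedSpace.expSeries_div_hasSum_exp (q x)).mul_left _

theorem shift_C (l : Fin d → ℤ) (a : ℂ) : shift l (MvPolynomial.C a) = MvPolynomial.C a := by
  simp [shift, MvPolynomial.algebraMap_eq]

/-- The linear form `x ↦ ⟨t + i η, x⟩`, as a polynomial. -/
def complexForm (t η : EuclideanSpace ℝ (Fin d)) : MvPolynomial (Fin d) ℂ :=
  ∑ k, MvPolynomial.C ((t k : ℂ) + Complex.I * (η k : ℂ)) * MvPolynomial.X k

theorem imagEval_complexForm (t η z : EuclideanSpace ℝ (Fin d)) :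
    imagEval z (complexForm t η) = (⟪t, z⟫ : ℂ) * Complex.I - (⟪η, z⟫ : ℂ) := by
  simp only [complexForm, map_sum, map_mul, imagEval_C, imagEval_X, PiLp.inner_apply]
  push_cast
  rw [Finset.sum_mul, ← Finset.sum_sub_distrib]
  refine Finset.sum_congr rfl fun k _ => ?_
  simp only [RCLike.inner_apply, conj_trivial]
  push_cast
  linear_combination (η k : ℂ) * (z k : ℂ) * Complex.I_sq

theorem shift_complexForm (l : Fin d → ℤ) (t η : EuclideanSpace ℝ (Fin d)) :
    shift l (complexForm t η) = complexForm t η + MvPolynomial.C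
      ((⟪t, latticeVector l⟫ : ℂ) + Complex.I * (⟪η, latticeVector l⟫ : ℂ)) := by
  have h : ((⟪t, latticeVector l⟫ : ℂ) + Complex.I * (⟪η, latticeVector l⟫ : ℂ)) =
      ∑ k, ((t k : ℂ) + Complex.I * (η k : ℂ)) * (l k : ℂ) := by
    simp only [PiLp.inner_apply, latticeVector, RCLike.inner_apply, conj_trivial]
    push_cast
    rw [Finset.mul_sum, ← Finset.sum_add_distrib]
    refine Finset.sum_congr rfl fun k _ => ?_
    ring
  rw [h, complexForm, map_sum, map_sum, ← Finset.sum_add_distrib]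
  refine Finset.sum_congr rfl fun k _ => ?_
  rw [map_mul, map_mul, shift_C, shift_X, mul_add]

variable {ν : Measure (EuclideanSpace ℝ (Fin d))} {c : ℝ}

theorem integrable_imagEval (hν : Integrable (fun z => Real.exp (c * ‖z‖)) ν)
    (f : MvPolynomial (Fin d) ℂ) {a : ℝ} (ha : a < c) :
    Integrable (fun z => Real.exp (a * ‖z‖) * ‖imagEval z f‖) ν := by
  obtain ⟨M, hM⟩ := (isTame_imagEval f).2 (c - a) (by linarith)
  refine (hν.const_mul M).mono' (Continuous.aestronglyMeasurable
    ((by fun_prop : Continuous _).mul (isTame_imagEval f).1.norm)) (ae_of_all _ fun z => ?_)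
  rw [norm_mul, norm_norm, Real.norm_of_nonneg (Real.exp_pos _).le]
  calc Real.exp (a * ‖z‖) * ‖imagEval z f‖
      ≤ Real.exp (a * ‖z‖) * (M * Real.exp ((c - a) * ‖z‖)) :=
        mul_le_mul_of_nonneg_left (hM z) (Real.exp_pos _).le
    _ = M * Real.exp (c * ‖z‖) := by
        rw [mul_left_comm, ← Real.exp_add]
        ring_nf

theorem norm_imagEval_complexForm_le (t η z : EuclideanSpace ℝ (Fin d)) :
    ‖imagEval z (complexForm t η)‖ ≤ (‖t‖ + ‖η‖) * ‖z‖ := by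
  rw [imagEval_complexForm]
  refine (norm_sub_le _ _).trans ?_
  rw [norm_mul, Complex.norm_I, mul_one, Complex.norm_real, Complex.norm_real, add_mul]
  exact add_le_add (norm_inner_le_norm t z) (norm_inner_le_norm η z)

/-- Relations between moments yield shift relations. -/
theorem shiftRelation_of_moments (hc : 0 < c) (hν : Integrable (fun z => Real.exp (c * ‖z‖)) ν)
    {l : Fin d → ℤ} {D : MvPolynomial (Fin d) ℂ} {χ : ℂ}
    (h : ∀ g, ∫ z, imagEval z (shift l (g * D)) ∂ν = χ * ∫ z, imagEval z (g * D) ∂ν) :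
    ShiftRelation ν c l D χ := by
  intro g t η hη
  set b : ℂ := (⟪t, latticeVector l⟫ : ℂ) + Complex.I * (⟪η, latticeVector l⟫ : ℂ) with hb
  set ℓ := complexForm t η with hℓ
  obtain ⟨a, ha1, ha2⟩ := exists_between hη
  have ha0 : 0 < a := (norm_nonneg _).trans_lt ha1
  -- Both sides are considered at `s (t + iη)`. The real part of the exponent is `-⟨Re s · η + Im s
  -- · t, z⟩`, so `Ω` is a convex domain of holomorphy containing 0 and 1.
  set Ω : Set ℂ := {s | ‖s.re • η + s.im • t‖ < a} with hΩ
  have hcont : Continuous fun s : ℂ => ‖s.re • η + s.im • t‖ :=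
    ((Complex.continuous_re.smul continuous_const).add
      (Complex.continuous_im.smul continuous_const)).norm
  have hΩo : IsOpen Ω := isOpen_lt hcont continuous_const
  have hΩc : Convex ℝ Ω := by
    have h1 : Ω = ((Complex.reLm.smulRight η + Complex.imLm.smulRight t : ℂ →ₗ[ℝ]
        EuclideanSpace ℝ (Fin d))) ⁻¹' Metric.ball 0 a := by
      ext s
      simp [hΩ]
    rw [h1]
    exact (convex_ball _ _).linear_preimage _
  have h0 : (0 : ℂ) ∈ Ω := by simpa [hΩ] using ha0
  have h1 : (1 : ℂ) ∈ Ω := by simpa [hΩ] using ha1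
  have hdiff : ∀ f : MvPolynomial (Fin d) ℂ, DifferentiableOn ℂ
      (fun s : ℂ => ∫ z, imagEval z f * Complex.exp (s * imagEval z ℓ) ∂ν) Ω := by
    intro f
    have hL := differentiableOn_integral_mul_cexp (X := EuclideanSpace ℝ (Fin d)) (E := ℂ) ν
      (fun z => imagEval z f) (isTame_imagEval f).1.aestronglyMeasurable a
      (integrable_imagEval hν f ha2)
      ((innerSL ℝ t).smulRight (Complex.I • ContinuousLinearMap.id ℂ ℂ) -
        (innerSL ℝ η).smulRight (ContinuousLinearMap.id ℂ ℂ))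
      (fun s => ‖s.re • η + s.im • t‖) hcont ?_
    · refine hL.congr fun s _ => integral_congr_ae (ae_of_all _ fun z => ?_)
      simp only [hℓ, imagEval_complexForm, sub_apply, ContinuousLinearMap.smulRight_apply,
        innerSL_apply_apply, smul_apply, ContinuousLinearMap.id_apply, smul_eq_mul,
        Complex.real_smul]
      ring_nf
    · intro z s
      have h2 : ((((innerSL ℝ t).smulRight (Complex.I • ContinuousLinearMap.id ℂ ℂ) -
          (innerSL ℝ η).smulRight (ContinuousLinearMap.id ℂ ℂ)) z) s).re =
          -⟪s.re • η + s.im • t, z⟫ := by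
        simp only [sub_apply, ContinuousLinearMap.smulRight_apply, innerSL_apply_apply, smul_apply,
          ContinuousLinearMap.id_apply, smul_eq_mul, Complex.real_smul, inner_add_left,
          inner_smul_left, conj_trivial]
        simp
        ring
      rw [h2]
      exact (neg_le_abs _).trans (abs_real_inner_le_norm _ z)
  set F₁ : ℂ → ℂ := fun s => Complex.exp (s * b) *
    ∫ z, imagEval z (shift l (g * D)) * Complex.exp (s * imagEval z ℓ) ∂ν with hF₁
  set F₂ : ℂ → ℂ := fun s => χ * ∫ z, imagEval z (g * D) * Complex.exp (s * imagEval z ℓ) ∂ν with hF₂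
  have hF₁d : AnalyticOnNhd ℂ F₁ Ω := (DifferentiableOn.mul (by fun_prop) (hdiff _)).analyticOnNhd hΩo
  have hF₂d : AnalyticOnNhd ℂ F₂ Ω := ((hdiff _).const_mul χ).analyticOnNhd hΩo
  have hdom : ∀ (f : MvPolynomial (Fin d) ℂ) (s β : ℂ), ‖s‖ * (‖t‖ + ‖η‖) < c →
      Integrable (fun z => ‖imagEval z f‖ * Real.exp ‖s * (imagEval z ℓ + β)‖) ν := by
    intro f s β hs
    refine ((integrable_imagEval hν f hs).const_mul (Real.exp (‖s‖ * ‖β‖))).mono'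
      (Continuous.aestronglyMeasurable ((isTame_imagEval f).1.norm.mul (Real.continuous_exp.comp
        (continuous_const.mul ((isTame_imagEval ℓ).1.add continuous_const)).norm)))
      (ae_of_all _ fun z => ?_)
    rw [norm_mul, norm_norm, Real.norm_of_nonneg (Real.exp_pos _).le, ← mul_assoc, ← Real.exp_add,
      mul_comm]
    refine mul_le_mul_of_nonneg_right (Real.exp_le_exp.2 ?_) (norm_nonneg _)
    rw [norm_mul]
    calc ‖s‖ * ‖imagEval z ℓ + β‖ ≤ ‖s‖ * ((‖t‖ + ‖η‖) * ‖z‖ + ‖β‖) :=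
          mul_le_mul_of_nonneg_left ((norm_add_le _ _).trans
            (add_le_add_left (norm_imagEval_complexForm_le t η z) _)) (norm_nonneg _)
      _ = _ := by ring
  -- For small `s` the exponentials expand into moments. The relation holds term by term, with `g`
  -- replaced by `g ℓ^m`, since `S_l ℓ = ℓ + b`. Analytic continuation then leads to `s = 1`.
  have hnear : ∀ s : ℂ, ‖s‖ * (‖t‖ + ‖η‖) < c → F₁ s = F₂ s := by
    intro s hs
    have e1 := hasSum_integral_exp (ν := ν) (p := fun z => imagEval z (shift l (g * D)))
      (q := fun z => s * (imagEval z ℓ + b)) (isTame_imagEval _).1.aestronglyMeasurable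
      (continuous_const.mul ((isTame_imagEval ℓ).1.add continuous_const)).aestronglyMeasurable
      (hdom _ s b hs)
    have e2 := (hasSum_integral_exp (ν := ν) (p := fun z => imagEval z (g * D))
      (q := fun z => s * (imagEval z ℓ + 0)) (isTame_imagEval _).1.aestronglyMeasurable
      (continuous_const.mul ((isTame_imagEval ℓ).1.add continuous_const)).aestronglyMeasurable
      (hdom _ s 0 hs)).mul_left χ
    have e3 : ∀ m : ℕ, (∫ z, imagEval z (shift l (g * D)) *
        ((s * (imagEval z ℓ + b)) ^ m / (m ! : ℂ)) ∂ν) =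
        χ * ∫ z, imagEval z (g * D) * ((s * (imagEval z ℓ + 0)) ^ m / (m ! : ℂ)) ∂ν := by
      intro m
      have h2 := h (MvPolynomial.C (s ^ m / (m ! : ℂ)) * ℓ ^ m * g)
      have h3 : ∀ z : EuclideanSpace ℝ (Fin d), imagEval z (shift l
          (MvPolynomial.C (s ^ m / (m ! : ℂ)) * ℓ ^ m * g * D)) =
          imagEval z (shift l (g * D)) * ((s * (imagEval z ℓ + b)) ^ m / (m ! : ℂ)) := by
        intro z
        rw [mul_assoc, map_mul (shift l), map_mul (shift l), map_pow, shift_C, hℓ,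
          shift_complexForm, ← hb, map_mul, map_mul, map_pow, map_add, imagEval_C, imagEval_C, mul_pow]
        ring
      have h5 : ∀ z : EuclideanSpace ℝ (Fin d), imagEval z
          (MvPolynomial.C (s ^ m / (m ! : ℂ)) * ℓ ^ m * g * D) =
          imagEval z (g * D) * ((s * (imagEval z ℓ + 0)) ^ m / (m ! : ℂ)) := by
        intro z
        rw [mul_assoc, map_mul, map_mul, map_pow, imagEval_C, mul_pow, add_zero]
        ring
      simpa only [h3, h5] using h2
    rw [funext e3] at e1
    have e4 := e1.unique e2
    simp only [hF₁, hF₂]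
    simp only [add_zero] at e4
    rw [← e4, ← integral_const_mul]
    refine integral_congr_ae (ae_of_all _ fun z => ?_)
    simp only []
    rw [mul_left_comm, ← Complex.exp_add]
    ring_nf
  have hev : ∀ᶠ s in 𝓝 (0 : ℂ), F₁ s = F₂ s := by
    have : {s : ℂ | ‖s‖ * (‖t‖ + ‖η‖) < c} ∈ 𝓝 (0 : ℂ) :=
      (isOpen_lt (by fun_prop) continuous_const).mem_nhds (by simpa using hc)
    filter_upwards [this] with s hs using hnear s hs
  have heq := hF₁d.eqOn_of_preconnected_of_eventuallyEq hF₂d hΩc.isPreconnected h0 hev h1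
  simp only [hF₁, hF₂, one_mul, hℓ, imagEval_complexForm] at heq
  exact heq

/-- Shift relations restrict to the hyperplanes invariant under the shift. -/
theorem ShiftRelation.restrict [IsFiniteMeasure ν]
    (hν : Integrable (fun z => Real.exp (c * ‖z‖)) ν) {l : Fin d → ℤ}
    {D : MvPolynomial (Fin d) ℂ} {χ : ℂ} (h : ShiftRelation ν c l D χ)
    {α : EuclideanSpace ℝ (Fin d)} (hα : ⟪α, latticeVector l⟫ = 0) (u : ℝ) :
    ShiftRelation (ν.restrict {z | ⟪α, z⟫ = u}) c l D χ := by
  intro g t η hη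
  set b : ℂ := Complex.exp
    ((⟪t, latticeVector l⟫ : ℂ) + Complex.I * (⟪η, latticeVector l⟫ : ℂ)) with hb
  have hi : ∀ (f : MvPolynomial (Fin d) ℂ) (t : EuclideanSpace ℝ (Fin d)),
      Integrable (fun z => imagEval z f * twist t η z) ν := fun f t =>
    (isTame_imagEval f).integrable hν t η hη
  set p : EuclideanSpace ℝ (Fin d) → ℂ := fun z =>
    b * (imagEval z (shift l (g * D)) * twist t η z) - χ * (imagEval z (g * D) * twist t η z) with hp
  have hpi : Integrable p ν := ((hi _ t).const_mul b).sub ((hi _ t).const_mul χ)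
  have hS : MeasurableSet {z : EuclideanSpace ℝ (Fin d) | ⟪α, z⟫ = u} :=
    (isClosed_eq (by fun_prop) continuous_const).measurableSet
  suffices hz : ∫ z in {z | ⟪α, z⟫ = u}, p z ∂ν = 0 by
    rw [hp, integral_sub ((hi _ t).const_mul b).integrableOn ((hi _ t).const_mul χ).integrableOn,
      integral_const_mul, integral_const_mul, sub_eq_zero] at hz
    exact hz
  -- Replacing `t` by `t - 2πrα` does not change the exponential prefactor, because `⟨α, l⟩ = 0`. So
  -- the image of `p ν` under `z ↦ ⟨α, z⟩` has vanishing Fourier transform.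
  have hline : ∀ r : ℝ, ∫ z, Complex.exp ((-(2 * Real.pi * (r * ⟪α, z⟫)) : ℝ) * Complex.I) * p z ∂ν =
      0 := by
    intro r
    have h1 := h g (t + (-(2 * Real.pi * r)) • α) η hη
    rw [inner_add_left, inner_smul_left, hα, mul_zero, add_zero, ← hb, ← sub_eq_zero,
      ← integral_const_mul, ← integral_const_mul, ← integral_sub ((hi _ _).const_mul _)
        ((hi _ _).const_mul _)] at h1
    rw [← h1]
    refine integral_congr_ae (ae_of_all _ fun z => ?_)
    have h2 : twist (t + (-(2 * Real.pi * r)) • α) η z =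
        Complex.exp ((-(2 * Real.pi * (r * ⟪α, z⟫)) : ℝ) * Complex.I) * twist t η z := by
      rw [twist, twist, ← Complex.exp_add, inner_add_left, inner_smul_left, conj_trivial]
      push_cast
      ring_nf
    simp only [hp, h2]
    ring
  -- Pairing with the transforms of Gaussians gives Gaussians centred on the hyperplane; as `ε → 0`
  -- they converge boundedly to its indicator function.
  have hgauss : ∀ ε : ℝ, 0 < ε →
      ∫ z, Complex.exp (-Real.pi ^ 2 * ‖u - ⟪α, z⟫‖ ^ 2 / ε) * p z ∂ν = 0 := by
    intro ε hε
    have hf : Integrable fun r : ℝ => Complex.exp (-(ε : ℂ) * ‖r‖ ^ 2 +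
        2 * Real.pi * Complex.I * ⟪u, r⟫) :=
      GaussianFourier.integrable_cexp_neg_mul_sq_norm_add (by simpa using hε) _ _
    set L : ℝ →ₗ[ℝ] EuclideanSpace ℝ (Fin d) →ₗ[ℝ] ℝ :=
      LinearMap.smulRight LinearMap.id (innerₗ (EuclideanSpace ℝ (Fin d)) α) with hL
    have hLapp : ∀ r z, L r z = r * ⟪α, z⟫ := fun r z => by simp [hL]
    have h1 := VectorFourier.integral_fourierIntegral_smul_eq_flip (L := L) (μ := volume) (ν := ν)
      (f := fun r : ℝ => Complex.exp (-(ε : ℂ) * ‖r‖ ^ 2 + 2 * Real.pi * Complex.I * ⟪u, r⟫))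
      (g := p) Real.continuous_fourierChar
      (by simp only [hLapp]; fun_prop) hf hpi
    have h2 : ∀ r : ℝ, VectorFourier.fourierIntegral Real.fourierChar ν L.flip p r = 0 := by
      intro r
      rw [← hline r]
      refine integral_congr_ae (ae_of_all _ fun z => ?_)
      simp only [LinearMap.flip_apply, hLapp, Circle.smul_def, Real.fourierChar_apply, smul_eq_mul]
      push_cast
      ring_nf
    have h3 : ∀ z, VectorFourier.fourierIntegral Real.fourierChar volume L
        (fun r : ℝ => Complex.exp (-(ε : ℂ) * ‖r‖ ^ 2 + 2 * Real.pi * Complex.I * ⟪u, r⟫)) z =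
        (Real.pi / ε) ^ ((1 : ℂ) / 2) * Complex.exp (-Real.pi ^ 2 * ‖u - ⟪α, z⟫‖ ^ 2 / ε) := by
      intro z
      have h4 := fourier_gaussian_innerProductSpace' (V := ℝ) (b := (ε : ℂ)) (by simpa using hε) u
        ⟪α, z⟫
      rw [Module.finrank_self, Nat.cast_one] at h4
      rw [← h4, Real.fourier_eq]
      refine integral_congr_ae (ae_of_all _ fun r => ?_)
      simp only [hLapp, RCLike.inner_apply, conj_trivial, mul_comm r]
    simp only [h2, h3, smul_eq_mul, mul_zero, integral_zero] at h1
    simp only [mul_assoc] at h1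
    rw [integral_const_mul] at h1
    refine (mul_eq_zero.1 h1).resolve_left ?_
    have : ((Real.pi : ℂ) / ε) ≠ 0 := by
      exact_mod_cast (div_pos Real.pi_pos hε).ne'
    simp [Complex.cpow_eq_zero_iff, this]
  have hlim : Tendsto (fun n : ℕ => ∫ z, Complex.exp
      (-Real.pi ^ 2 * ‖u - ⟪α, z⟫‖ ^ 2 / (((n : ℝ) + 1)⁻¹ : ℝ)) * p z ∂ν) atTop
      (𝓝 (∫ z, Set.indicator {z | ⟪α, z⟫ = u} p z ∂ν)) := by
    have hnorm : ∀ (n : ℕ) (z : EuclideanSpace ℝ (Fin d)), Complex.exp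
        (-Real.pi ^ 2 * ‖u - ⟪α, z⟫‖ ^ 2 / (((n : ℝ) + 1)⁻¹ : ℝ)) =
        (Real.exp (-(((n : ℝ) + 1) * (Real.pi ^ 2 * (u - ⟪α, z⟫) ^ 2))) : ℝ) := by
      intro n z
      push_cast
      rw [Real.norm_eq_abs, ← Complex.ofReal_pow |(u - ⟪α, z⟫)| 2, sq_abs]
      congr 1
      push_cast
      rw [div_inv_eq_mul]
      ring
    simp only [hnorm]
    refine tendsto_integral_of_dominated_convergence (fun z => ‖p z‖) (fun n => ?_) hpi.norm
      (fun n => ae_of_all _ fun z => ?_) (ae_of_all _ fun z => ?_)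
    · exact (Continuous.aestronglyMeasurable (by fun_prop)).mul hpi.1
    · rw [norm_mul, Complex.norm_real, Real.norm_of_nonneg (Real.exp_pos _).le]
      refine mul_le_of_le_one_left (norm_nonneg _) (Real.exp_le_one_iff.2 ?_)
      simp only [Left.neg_nonpos_iff]
      positivity
    · by_cases hz : ⟪α, z⟫ = u
      · simp [hz]
      · have hz' : z ∉ {z | ⟪α, z⟫ = u} := hz
        rw [Set.indicator_of_notMem hz']
        have hpos : 0 < Real.pi ^ 2 * (u - ⟪α, z⟫) ^ 2 := by
          have : u - ⟪α, z⟫ ≠ 0 := sub_ne_zero.2 (Ne.symm hz)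
          positivity
        have h1 : Tendsto (fun n : ℕ => Real.exp (-(((n : ℝ) + 1) *
            (Real.pi ^ 2 * (u - ⟪α, z⟫) ^ 2)))) atTop (𝓝 0) :=
          Real.tendsto_exp_neg_atTop_nhds_zero.comp
            ((tendsto_atTop_add_const_right _ _ tendsto_natCast_atTop_atTop).atTop_mul_const hpos)
        have h2 := ((Complex.continuous_ofReal.tendsto 0).comp h1).mul_const (p z)
        simpa using h2
  rw [integral_indicator hS] at hlim
  refine tendsto_nhds_unique hlim ?_
  refine tendsto_const_nhds.congr fun n => (hgauss _ (by positivity)).symm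

end ShiftRelation

end AbelianCoulomb

end

noncomputable section

namespace AbelianCoulomb

/-! ### The measure of a positive trace -/

section TraceMeasure

open MvPolynomial Finset MeasureTheory
open scoped Nat RealInnerProductSpace

variable {d n : ℕ} {ξ : Fin n → Fin d → ℤ} {b : Fin n → ℂ}

/-- The substitution `f ↦ f(a x)`. -/
def rescale (a : ℂ) : MvPolynomial (Fin d) ℂ →ₐ[ℂ] MvPolynomial (Fin d) ℂ :=
  aeval fun k => C a * X k

theorem rescale_X (a : ℂ) (k : Fin d) : rescale a (X k) = C a * X k := by
  simp [rescale]

theorem rescale_C (a c : ℂ) : rescale (d := d) a (C c) = C c := by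
  simp [rescale, algebraMap_eq]

theorem rescale_rescale {a a' : ℂ} (h : a * a' = 1) (f : MvPolynomial (Fin d) ℂ) :
    rescale a (rescale a' f) = f := by
  have : (rescale a).comp (rescale (d := d) a') = AlgHom.id ℂ _ := by
    refine MvPolynomial.algHom_ext fun k => ?_
    rw [AlgHom.comp_apply, rescale_X, map_mul, rescale_C, rescale_X, ← mul_assoc, ← C_mul,
      mul_comm a', h, C_1, one_mul, AlgHom.id_apply]
  exact DFunLike.congr_fun this f

theorem rescale_monomial (a : ℂ) (γ : Fin d →₀ ℕ) :
    rescale a (monomial γ 1) = a ^ γ.degree • monomial γ (1 : ℂ) := by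
  rw [rescale, aeval_monomial, map_one, one_mul, Finsupp.prod]
  simp only [mul_pow, Finset.prod_mul_distrib, ← C_pow, ← map_prod]
  rw [monomial_eq, Finsupp.prod, C_1, one_mul, Finset.prod_pow_eq_pow_sum, smul_eq_C_mul]
  rfl

theorem rescale_conjCoeff (f : MvPolynomial (Fin d) ℂ) :
    rescale (-Complex.I) (conjCoeff f) = polyStar (rescale (-Complex.I) f) := by
  induction f using MvPolynomial.induction_on with
  | C c => rw [conjCoeff, map_C, rescale_C, rescale_C, polyStar_C]
  | add p q hp hq => simp only [map_add, hp, hq]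
  | mul_X p k hp =>
    rw [map_mul, map_mul, map_mul, map_mul, hp, conjCoeff, map_X, rescale_X, map_mul, polyStar_C,
      polyStar_X]
    simp

theorem imagEval_rescale (z : EuclideanSpace ℝ (Fin d)) (f : MvPolynomial (Fin d) ℂ) :
    imagEval z (rescale (-Complex.I) f) = eval (fun k => (z k : ℂ)) f := by
  induction f using MvPolynomial.induction_on with
  | C c => rw [rescale_C, imagEval_C, eval_C]
  | add p q hp hq => simp only [map_add, hp, hq]
  | mul_X p k hp =>
    rw [map_mul, map_mul, hp, rescale_X, map_mul, imagEval_C, imagEval_X, map_mul, eval_X]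
    linear_combination (-(eval (fun k => (z k : ℂ)) p * (z k : ℂ))) * Complex.I_sq

theorem imagEval_polyStar (z : EuclideanSpace ℝ (Fin d)) (f : MvPolynomial (Fin d) ℂ) :
    imagEval z (polyStar f) = starRingEnd ℂ (imagEval z f) := by
  induction f using MvPolynomial.induction_on with
  | C c => rw [polyStar_C, imagEval_C, imagEval_C]
  | add p q hp hq => simp only [map_add, hp, hq]
  | mul_X p k hp =>
    rw [map_mul, map_mul, hp, polyStar_X, map_neg, imagEval_X, map_mul, map_mul, imagEval_X, map_mul,
      Complex.conj_I, Complex.conj_ofReal]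
    ring

/-- A positive trace is integration against a measure with exponential moments on the imaginary
points, for which all shift relations hold. -/
theorem exists_trace_measure {ρ : CoulombBranch ξ b ≃+* CoulombBranch ξ b} (hρ : IsAdmissible ρ)
    {T : CoulombBranch ξ b →ₗ[ℂ] ℂ} (hT : IsPositiveTrace ρ T) :
    ∃ (μ : Measure (EuclideanSpace ℝ (Fin d))) (c : ℝ) (χ : (Fin d → ℤ) → ℂ), IsFiniteMeasure μ ∧
      0 < c ∧ Integrable (fun z => Real.exp (c * ‖z‖)) μ ∧
      (∀ R, T (ofPoly ξ b R) = ∫ z, imagEval z R ∂μ) ∧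
      ∀ l, ShiftRelation μ c l (descent ξ b l) (χ l) := by
  obtain ⟨χ, hχ⟩ := exists_trace_relation hρ hT
  obtain ⟨A, K, hA, hK, hgrowth⟩ := exists_growth (T := polyPart T) (fun l g => hχ l g)
  -- The substitution `x = i z` turns `polyStar` into conjugation of coefficients, so that `L` is a
  -- moment functional in the real variable `z`.
  set L : MvPolynomial (Fin d) ℂ →ₗ[ℂ] ℂ := polyPart T ∘ₗ (rescale (-Complex.I)).toLinearMap with hL
  have hII : (-Complex.I) * Complex.I = 1 := by simp
  have hII' : Complex.I * (-Complex.I) = 1 := by simp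
  have hmom : IsMomentFunctional L A K := by
    refine ⟨fun f hf => ?_, hA, zero_le_one.trans hK, fun γ => ?_⟩
    · have h1 : L (f * conjCoeff f) = polyPart T (rescale (-Complex.I) f *
          polyStar (rescale (-Complex.I) f)) := by
        simp only [hL, LinearMap.comp_apply, AlgHom.toLinearMap_apply, map_mul, rescale_conjCoeff]
      rw [h1]
      refine polyPart_pos hρ hT fun h0 => hf ?_
      rw [← rescale_rescale hII' f, h0, map_zero]
    · have h1 : L (monomial γ 1) = (-Complex.I) ^ γ.degree • polyPart T (monomial γ 1) := by
        simp only [hL, LinearMap.comp_apply, AlgHom.toLinearMap_apply, rescale_monomial, map_smul]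
      rw [h1, norm_smul, norm_pow, norm_neg, Complex.norm_I, one_pow, one_mul]
      exact hgrowth γ
  obtain ⟨μ, hμ, ⟨c, hc, hμc⟩, hint⟩ := hmom.exists_measure
  have hR : ∀ R, T (ofPoly ξ b R) = ∫ z, imagEval z R ∂μ := by
    intro R
    have h1 := hint (rescale Complex.I R)
    simp only [← imagEval_rescale, rescale_rescale hII] at h1
    rw [← h1]
    simp only [hL, LinearMap.comp_apply, AlgHom.toLinearMap_apply, rescale_rescale hII]
    rfl
  refine ⟨μ, c, χ, hμ, hc, hμc, hR, fun l => shiftRelation_of_moments hc hμc fun g => ?_⟩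
  rw [← hR, ← hR]
  exact hχ l g

end TraceMeasure

/-! ### Removing an exceptional null set -/

section NullSet

open MeasureTheory

variable {V : Type*} [NormedAddCommGroup V] [InnerProductSpace ℝ V] [FiniteDimensional ℝ V]
  [MeasurableSpace V] [BorelSpace V]

/-- If `|p|² m` has decaying transforms, then `m` is absolutely continuous off a null set containing
the zeros of `p`, and the null set does not contribute to the transforms of `|p|² m`. -/
theorem HasDecay.restrict_compl {m : Measure V} [IsFiniteMeasure m] {c : ℝ} (hc : 0 < c)
    (hmc : Integrable (fun v => Real.exp (c * ‖v‖)) m) {p : V → ℂ} (hp : IsTame p)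
    (h : HasDecay m fun v => p v * starRingEnd ℂ (p v)) {N : Set V} (hN : MeasurableSet N)
    (hN0 : volume N = 0) (hpN : ∀ v ∉ N, p v ≠ 0) :
    m.restrict Nᶜ ≪ volume ∧
      HasDecay (m.restrict Nᶜ) fun v => p v * starRingEnd ℂ (p v) := by
  have hsq : ∀ v, p v * starRingEnd ℂ (p v) = ((‖p v‖ ^ 2 : ℝ) : ℂ) := fun v => by
    rw [Complex.mul_conj']
    push_cast
    rfl
  simp only [hsq] at h ⊢
  have hmeas : Measurable fun v => ENNReal.ofReal (‖p v‖ ^ 2) :=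
    (hp.1.norm.pow 2).measurable.ennreal_ofReal
  have hint : Integrable (fun v => ‖p v‖ ^ 2) m := by
    have h1 := ((hp.mul hp).integrable hmc 0 0 (by simpa using hc)).norm
    refine h1.congr (ae_of_all _ fun v => ?_)
    simp [twist, pow_two]
  -- The factor `|p|²` is real and nonnegative, so this is a positive measure and Fourier inversion
  -- shows it to be absolutely continuous. Off the zeros of `p` so is `m`, whereas at the zeros `m`
  -- may have a singular part.
  set k : Measure V := m.withDensity fun v => ENNReal.ofReal (‖p v‖ ^ 2) with hk
  have hkfin : IsFiniteMeasure k := isFiniteMeasure_withDensity_ofReal hint.hasFiniteIntegral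
  have hfour : ∀ t, fourierMeasure k t =
      ∫ v, ((‖p v‖ ^ 2 : ℝ) : ℂ) * twist (-(2 * Real.pi) • t) 0 v ∂m := by
    intro t
    rw [fourierMeasure, charFun_apply, hk, integral_withDensity_eq_integral_toReal_smul hmeas
      (ae_of_all _ fun _ => ENNReal.ofReal_lt_top)]
    refine integral_congr_ae (ae_of_all _ fun v => ?_)
    simp only [twist, inner_zero_left, Complex.ofReal_zero, sub_zero]
    rw [ENNReal.toReal_ofReal (by positivity), Complex.real_smul, real_inner_comm]
  obtain ⟨κ, δ, C, hκ, hδ, h⟩ := h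
  have hbound : ∀ t, ‖fourierMeasure k t‖ ≤ C * Real.exp (-(2 * Real.pi * κ) * ‖t‖) := by
    intro t
    rw [hfour]
    refine (h _ 0 (by simpa using hδ)).trans_eq ?_
    have := Real.pi_pos
    rw [norm_smul, norm_neg, Real.norm_of_nonneg (by positivity)]
    ring_nf
  have hac := absolutelyContinuous_of_integrable_fourierMeasure k (integrable_fourierMeasure hbound hκ)
  have hzero : ∀ A : Set V, volume A = 0 → m ({v | p v ≠ 0} ∩ A) = 0 := by
    intro A hA
    have h1 := hac hA
    rw [hk, withDensity_apply_eq_zero hmeas] at h1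
    refine measure_mono_null (Set.inter_subset_inter_left _ fun v hv => ?_) h1
    have hv' : p v ≠ 0 := hv
    simp [hv']
  refine ⟨?_, κ, δ, C, hκ, hδ, fun t η hη => ?_⟩
  · refine Measure.AbsolutelyContinuous.mk fun A hA h0 => ?_
    rw [Measure.restrict_apply hA]
    refine measure_mono_null (fun v hv => ?_) (hzero A h0)
    exact ⟨hpN v hv.2, hv.1⟩
  · have h1 : (∫ v in Nᶜ, ((‖p v‖ ^ 2 : ℝ) : ℂ) * twist t η v ∂m) =
        ∫ v, ((‖p v‖ ^ 2 : ℝ) : ℂ) * twist t η v ∂m := by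
      rw [← integral_indicator hN.compl]
      have h2 : ∀ᵐ v ∂m, v ∉ {v | p v ≠ 0} ∩ N := measure_eq_zero_iff_ae_notMem.1 (hzero N hN0)
      refine integral_congr_ae ?_
      filter_upwards [h2] with v hv
      by_cases hvN : v ∈ N
      · have : p v = 0 := by
          by_contra h0
          exact hv ⟨h0, hvN⟩
        simp [this]
      · exact Set.indicator_of_mem (s := Nᶜ) hvN _
    rw [h1]
    exact h t η hη

end NullSet

end AbelianCoulomb

end

noncomputable section

namespace AbelianCoulomb

/-! ### Flats of an affine arrangement and decay of transforms along them -/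

section Flat

open MeasureTheory Finset
open scoped RealInnerProductSpace

variable {V ι : Type*} [NormedAddCommGroup V] [InnerProductSpace ℝ V]

/-- The affine subspace `{z | ⟨a i, z⟩ = h i for i ∈ I}`. -/
def flat (a : ι → V) (h : ι → ℝ) (I : Finset ι) : AffineSubspace ℝ V where
  carrier := {z | ∀ i ∈ I, ⟪a i, z⟫ = h i}
  smul_vsub_vadd_mem' := by
    intro c x y z hx hy hz i hi
    rw [vsub_eq_sub, vadd_eq_add, inner_add_right, inner_smul_right, inner_sub_right, hx i hi,
      hy i hi, hz i hi]
    ring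

theorem mem_flat {a : ι → V} {h : ι → ℝ} {I : Finset ι} {z : V} :
    z ∈ flat a h I ↔ ∀ i ∈ I, ⟪a i, z⟫ = h i := Iff.rfl

theorem mem_direction_flat {a : ι → V} {h : ι → ℝ} {I : Finset ι} {z : V} (hz : z ∈ flat a h I)
    (t : V) : t ∈ (flat a h I).direction ↔ ∀ i ∈ I, ⟪a i, t⟫ = 0 := by
  rw [AffineSubspace.mem_direction_iff_eq_vsub_right hz]
  constructor
  · rintro ⟨x, hx, rfl⟩ i hi
    rw [vsub_eq_sub, inner_sub_right, hx i hi, hz i hi, sub_self]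
  · intro ht
    refine ⟨t + z, fun i hi => ?_, by simp⟩
    rw [inner_add_right, ht i hi, hz i hi, zero_add]

theorem isClosed_flat (a : ι → V) (h : ι → ℝ) (I : Finset ι) :
    IsClosed (flat a h I : Set V) := by
  have : (flat a h I : Set V) = ⋂ i ∈ I, {z | ⟪a i, z⟫ = h i} := by
    ext z
    simp only [SetLike.mem_coe, mem_flat, Set.mem_iInter]
    rfl
  rw [this]
  exact isClosed_biInter fun i _ => isClosed_eq (by fun_prop) continuous_const

end Flat

section FlatDecay

open MeasureTheory Finset
open scoped RealInnerProductSpace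

variable {d n : ℕ} {ξ : Fin n → Fin d → ℤ} {b : Fin n → ℂ}

theorem inner_latticeVector (χ l : Fin d → ℤ) :
    ⟪latticeVector χ, latticeVector l⟫ = (pairing χ l : ℝ) := by
  simp only [latticeVector, PiLp.inner_apply, RCLike.inner_apply, conj_trivial, pairing]
  push_cast
  exact Finset.sum_congr rfl fun k _ => mul_comm _ _

theorem imagEval_linearForm (χ : Fin d → ℤ) (z : EuclideanSpace ℝ (Fin d)) :
    imagEval z (linearForm χ) = Complex.I * (⟪latticeVector χ, z⟫ : ℂ) := by
  simp only [linearForm, map_sum, map_mul, imagEval_C, imagEval_X, latticeVector, PiLp.inner_apply,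
    RCLike.inner_apply, conj_trivial]
  push_cast
  rw [Finset.mul_sum]
  exact Finset.sum_congr rfl fun k _ => by ring

/-- The affine subspace on which the weights `ξ i + b i`, `i ∈ I`, are real at the points `i z`. -/
def weightFlat (ξ : Fin n → Fin d → ℤ) (b : Fin n → ℂ) (I : Finset (Fin n)) :
    AffineSubspace ℝ (EuclideanSpace ℝ (Fin d)) :=
  flat (fun i => latticeVector (ξ i)) (fun i => -(b i).im) I

variable {μ : Measure (EuclideanSpace ℝ (Fin d))} {c : ℝ}

theorem ShiftRelation.restrict_weightFlat [IsFiniteMeasure μ]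
    (hμ : Integrable (fun z => Real.exp (c * ‖z‖)) μ) {l : Fin d → ℤ}
    {D : MvPolynomial (Fin d) ℂ} {χ : ℂ} (h : ShiftRelation μ c l D χ) (I : Finset (Fin n))
    (hI : ∀ i ∈ I, pairing (ξ i) l = 0) :
    ShiftRelation (μ.restrict (weightFlat ξ b I)) c l D χ := by
  induction I using Finset.induction_on with
  | empty =>
    have : (weightFlat ξ b ∅ : Set (EuclideanSpace ℝ (Fin d))) = Set.univ := by
      ext z
      simp [weightFlat, mem_flat]
    rwa [this, Measure.restrict_univ]
  | insert i I hi ih =>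
    have h1 := ih fun j hj => hI j (mem_insert_of_mem hj)
    have h2 := h1.restrict hμ.restrict (α := latticeVector (ξ i))
      (by rw [inner_latticeVector, hI i (mem_insert_self _ _), Int.cast_zero]) (-(b i).im)
    rw [Measure.restrict_restrict (isClosed_eq (by fun_prop) continuous_const).measurableSet] at h2
    convert h2 using 2
    ext z
    simp [weightFlat, mem_flat]

theorem exists_transform_bound (hμ : Integrable (fun z => Real.exp (c * ‖z‖)) μ)
    (hc : 0 < c) (f : MvPolynomial (Fin d) ℂ) :
    ∃ C, 0 ≤ C ∧ ∀ t η, ‖η‖ < c / 2 → ‖∫ z, imagEval z f * twist t η z ∂μ‖ ≤ C := by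
  have hi := integrable_imagEval hμ f (a := c / 2) (by linarith)
  refine ⟨∫ z, Real.exp (c / 2 * ‖z‖) * ‖imagEval z f‖ ∂μ, integral_nonneg fun z => by positivity,
    fun t η hη => norm_integral_le_of_norm_le hi (ae_of_all _ fun z => ?_)⟩
  rw [norm_mul, mul_comm]
  refine mul_le_mul_of_nonneg_right ((norm_twist_le t η z).trans (Real.exp_le_exp.2 ?_))
    (norm_nonneg _)
  exact mul_le_mul_of_nonneg_right hη.le (norm_nonneg z)

/-- A multiple `D_(-l) g` equals `S_l(S_(-l)(g) D_l)`, so the shift relation expresses its transform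
as `exp(-⟨t + iη, l⟩)` times a bounded one. -/
theorem ShiftRelation.exists_bound (hμ : Integrable (fun z => Real.exp (c * ‖z‖)) μ)
    (hc : 0 < c) {l : Fin d → ℤ} {χ : ℂ} (h : ShiftRelation μ c l (descent ξ b l) χ)
    {f : MvPolynomial (Fin d) ℂ} (hf : descent ξ b (-l) ∣ f) :
    ∃ C, 0 ≤ C ∧ ∀ t η, ‖η‖ < c / 2 →
      ‖∫ z, imagEval z f * twist t η z ∂μ‖ ≤ C * Real.exp (-⟪t, latticeVector l⟫) := by
  obtain ⟨g, rfl⟩ := hf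
  obtain ⟨C, hC, hbound⟩ := exists_transform_bound hμ hc (shift (-l) g * descent ξ b l)
  refine ⟨‖χ‖ * C, by positivity, fun t η hη => ?_⟩
  have h1 := h (shift (-l) g) t η (by linarith [norm_nonneg η])
  have h2 : shift l (shift (-l) g * descent ξ b l) = descent ξ b (-l) * g := by
    rw [map_mul, shift_add, add_neg_cancel, shift_zero, shift_descent, mul_comm]
  rw [h2] at h1
  have h3 := congrArg norm h1
  have h4 : ((⟪t, latticeVector l⟫ : ℂ) + Complex.I * (⟪η, latticeVector l⟫ : ℂ)).re =
      ⟪t, latticeVector l⟫ := by simp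
  rw [norm_mul, norm_mul, Complex.norm_exp, h4] at h3
  rw [Real.exp_neg, ← div_eq_mul_inv, le_div_iff₀ (Real.exp_pos _), mul_comm, h3]
  exact mul_le_mul_of_nonneg_left (hbound t η hη) (norm_nonneg χ)

/-- On the common kernel the decomposition of `m` times the identity gives `m t = Σ t_k l_k`. So the
`l k` detect the size of every `t` in the direction of the flat. -/
theorem norm_le_sum_inner {I : Finset (Fin n)} {m : ℤ} {l : Fin d → Fin d → ℤ}
    {e : Fin n → Fin d → ℚ}
    (h : ∀ k j, (l k j : ℚ) + m * ∑ i ∈ I, (ξ i k : ℚ) * e i j = if k = j then (m : ℚ) else 0)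
    {t : EuclideanSpace ℝ (Fin d)} (ht : ∀ i ∈ I, ⟪latticeVector (ξ i), t⟫ = 0) :
    |(m : ℝ)| * ‖t‖ ≤ ∑ k, |⟪t, latticeVector (l k)⟫| := by
  have h' : ∀ k j, (l k j : ℝ) + m * ∑ i ∈ I, (ξ i k : ℝ) * (e i j : ℝ) =
      if k = j then (m : ℝ) else 0 := by
    intro k j
    have := congrArg (Rat.cast : ℚ → ℝ) (h k j)
    push_cast at this
    rw [this]
    split_ifs <;> simp
  have ht' : ∀ i ∈ I, ∑ k, t k * (ξ i k : ℝ) = 0 := by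
    intro i hi
    have := ht i hi
    simpa [latticeVector, PiLp.inner_apply] using this
  have hcoord : ∀ j, ∑ k, t k * (l k j : ℝ) = m * t j := by
    intro j
    have h1 : ∑ k, t k * ((l k j : ℝ) + m * ∑ i ∈ I, (ξ i k : ℝ) * (e i j : ℝ)) = m * t j := by
      simp only [h', mul_ite, mul_zero, Finset.sum_ite_eq', Finset.mem_univ, if_true]
      ring
    have h2 : ∑ k, t k * ((m : ℝ) * ∑ i ∈ I, (ξ i k : ℝ) * (e i j : ℝ)) = 0 := by
      have : ∑ k, t k * ((m : ℝ) * ∑ i ∈ I, (ξ i k : ℝ) * (e i j : ℝ)) =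
          m * ∑ i ∈ I, (∑ k, t k * (ξ i k : ℝ)) * (e i j : ℝ) := by
        simp only [Finset.mul_sum, Finset.sum_mul]
        rw [Finset.sum_comm]
        exact Finset.sum_congr rfl fun i _ => Finset.sum_congr rfl fun k _ => by ring
      rw [this, Finset.sum_eq_zero fun i hi => by rw [ht' i hi, zero_mul], mul_zero]
    rw [← h1]
    simp only [mul_add, Finset.sum_add_distrib, h2, add_zero]
  have hsq : (m : ℝ) * ‖t‖ ^ 2 = ∑ k, t k * ⟪t, latticeVector (l k)⟫ := by
    rw [← real_inner_self_eq_norm_sq, PiLp.inner_apply, Finset.mul_sum]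
    simp only [RCLike.inner_apply, conj_trivial, ← mul_assoc, ← hcoord, PiLp.inner_apply,
      latticeVector, Finset.mul_sum, Finset.sum_mul]
    rw [Finset.sum_comm]
  rcases eq_or_ne ‖t‖ 0 with h0 | h0
  · rw [h0, mul_zero]
    exact Finset.sum_nonneg fun k _ => abs_nonneg _
  · have hpos : 0 < ‖t‖ := lt_of_le_of_ne (norm_nonneg t) (Ne.symm h0)
    refine le_of_mul_le_mul_right ?_ hpos
    calc |(m : ℝ)| * ‖t‖ * ‖t‖ = |(m : ℝ) * ‖t‖ ^ 2| := by
          rw [abs_mul, abs_of_nonneg (sq_nonneg ‖t‖)]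
          ring
      _ ≤ ∑ k, |t k * ⟪t, latticeVector (l k)⟫| := by
          rw [hsq]
          exact Finset.abs_sum_le_sum_abs _ _
      _ ≤ ∑ k, |⟪t, latticeVector (l k)⟫| * ‖t‖ := by
          refine Finset.sum_le_sum fun k _ => ?_
          rw [abs_mul, mul_comm]
          exact mul_le_mul_of_nonneg_left (by simpa using PiLp.norm_apply_le t k) (abs_nonneg _)
      _ = _ := (Finset.sum_mul _ _ _).symm

/-- On each flat, the transforms decay after multiplication by suitable products of structure
constants, attached to cocharacters annihilated by the weights which cut out the flat. -/
theorem exists_decay_on_flat [IsFiniteMeasure μ] (hμ : Integrable (fun z => Real.exp (c * ‖z‖)) μ)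
    (hc : 0 < c) {χ : (Fin d → ℤ) → ℂ} (h : ∀ l, ShiftRelation μ c l (descent ξ b l) (χ l))
    (I : Finset (Fin n)) :
    ∃ S : Finset (Fin d → ℤ), (∀ l ∈ S, ∀ i ∈ I, pairing (ξ i) l = 0) ∧
      ∃ κ C : ℝ, 0 < κ ∧ ∀ t η, (∀ i ∈ I, ⟪latticeVector (ξ i), t⟫ = 0) → ‖η‖ < c / 2 →
        ‖∫ z in weightFlat ξ b I, imagEval z ((∏ l ∈ S, descent ξ b l) *
          polyStar (∏ l ∈ S, descent ξ b l)) * twist t η z ∂μ‖ ≤ C * Real.exp (-κ * ‖t‖) := by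
  classical
  obtain ⟨m, l, e, hm, hl, he⟩ := exists_lattice_projection ξ I
  have hl' : ∀ i ∈ I, ∀ k, pairing (ξ i) (-(l k)) = 0 := by
    intro i hi k
    have := hl i hi k
    simp only [pairing, Pi.neg_apply, mul_neg, Finset.sum_neg_distrib, neg_eq_zero] at this ⊢
    exact this
  -- Both signs are included: the vector `l` gives decay only where `⟨t, l⟩` is positive. The
  -- conjugate factor `polyStar` makes the product equal to `|Q|²` on the imaginary points.
  set S : Finset (Fin d → ℤ) := univ.image l ∪ univ.image (fun k => -(l k)) with hS
  have hSl : ∀ k, l k ∈ S := fun k =>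
    mem_union_left _ (mem_image_of_mem _ (mem_univ k))
  have hSl' : ∀ k, -(l k) ∈ S := fun k =>
    mem_union_right _ (mem_image_of_mem (fun k => -(l k)) (mem_univ k))
  have hSI : ∀ l' ∈ S, ∀ i ∈ I, pairing (ξ i) l' = 0 := by
    intro l' hl'S i hi
    rcases mem_union.1 hl'S with h1 | h1
    · obtain ⟨k, _, rfl⟩ := mem_image.1 h1
      exact hl i hi k
    · obtain ⟨k, _, rfl⟩ := mem_image.1 h1
      exact hl' i hi k
  set F := (∏ l ∈ S, descent ξ b l) * polyStar (∏ l ∈ S, descent ξ b l) with hF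
  have hdvd : ∀ l' ∈ S, descent ξ b l' ∣ F := fun l' hl'S =>
    (Finset.dvd_prod_of_mem _ hl'S).mul_right _
  have hν : Integrable (fun z => Real.exp (c * ‖z‖)) (μ.restrict (weightFlat ξ b I)) := hμ.restrict
  have hrel : ∀ l' ∈ S, ShiftRelation (μ.restrict (weightFlat ξ b I)) c l' (descent ξ b l') (χ l') :=
    fun l' hl'S => (h l').restrict_weightFlat hμ I (hSI l' hl'S)
  have hplus : ∀ k, ∃ C, 0 ≤ C ∧ ∀ t η, ‖η‖ < c / 2 →
      ‖∫ z in weightFlat ξ b I, imagEval z F * twist t η z ∂μ‖ ≤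
        C * Real.exp (-⟪t, latticeVector (l k)⟫) := fun k =>
    (hrel _ (hSl k)).exists_bound hν hc (hdvd _ (hSl' k))
  have hminus : ∀ k, ∃ C, 0 ≤ C ∧ ∀ t η, ‖η‖ < c / 2 →
      ‖∫ z in weightFlat ξ b I, imagEval z F * twist t η z ∂μ‖ ≤
        C * Real.exp (-⟪t, latticeVector (-(l k))⟫) := fun k =>
    (hrel _ (hSl' k)).exists_bound hν hc (hdvd _ (by rw [neg_neg]; exact hSl k))
  choose C₁ hC₁ h₁ using hplus
  choose C₂ hC₂ h₂ using hminus
  obtain ⟨C₀, hC₀, h₀⟩ := exists_transform_bound hν hc F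
  have hm' : 0 < |(m : ℝ)| := abs_pos.2 (Int.cast_ne_zero.2 hm)
  -- With this `κ`, the `d` inner products `⟨t, l k⟩` cannot all be smaller than `κ ‖t‖` unless `t =
  -- 0`.
  set κ : ℝ := |(m : ℝ)| / (d + 1) with hκ
  have hκ0 : 0 < κ := by positivity
  set C : ℝ := C₀ + ∑ k, (C₁ k + C₂ k) with hC
  have hsum : ∀ k, C₁ k + C₂ k ≤ ∑ k, (C₁ k + C₂ k) := fun k =>
    Finset.single_le_sum (f := fun k => C₁ k + C₂ k)
      (fun j _ => add_nonneg (hC₁ j) (hC₂ j)) (mem_univ k)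
  refine ⟨S, hSI, κ, C, hκ0, fun t η ht hη => ?_⟩
  have hneg : ∀ k, latticeVector (-(l k)) = -latticeVector (l k) := by
    intro k
    ext j
    simp [latticeVector]
  by_cases hk : ∃ k, κ * ‖t‖ ≤ |⟪t, latticeVector (l k)⟫|
  · obtain ⟨k, hk⟩ := hk
    have hexp : Real.exp (-|⟪t, latticeVector (l k)⟫|) ≤ Real.exp (-κ * ‖t‖) :=
      Real.exp_le_exp.2 (by linarith)
    rcases le_total 0 ⟪t, latticeVector (l k)⟫ with h0 | h0
    · rw [abs_of_nonneg h0] at hexp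
      refine (h₁ k t η hη).trans (mul_le_mul ?_ hexp (Real.exp_pos _).le ?_)
      · linarith [hsum k, hC₂ k]
      · linarith [hsum k, hC₂ k, hC₁ k]
    · rw [abs_of_nonpos h0, neg_neg] at hexp
      refine (h₂ k t η hη).trans (mul_le_mul ?_ ?_ (Real.exp_pos _).le ?_)
      · linarith [hsum k, hC₁ k]
      · rw [hneg, inner_neg_right, neg_neg]
        exact hexp
      · linarith [hsum k, hC₂ k, hC₁ k]
  · push Not at hk
    have ht0 : ‖t‖ = 0 := by
      by_contra h0
      have hpos : 0 < ‖t‖ := lt_of_le_of_ne (norm_nonneg t) (Ne.symm h0)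
      have h3 : ∑ k, |⟪t, latticeVector (l k)⟫| ≤ d * (κ * ‖t‖) := by
        refine (Finset.sum_le_sum fun k _ => (hk k).le).trans_eq ?_
        simp
      have h4 := (norm_le_sum_inner he ht).trans h3
      have h5 : |(m : ℝ)| = κ * (d + 1) := by
        rw [hκ]
        field_simp
      rw [h5] at h4
      nlinarith [mul_pos hκ0 hpos]
    rw [ht0, mul_zero, Real.exp_zero, mul_one]
    refine (h₀ t η hη).trans ?_
    rw [hC]
    exact le_add_of_nonneg_right (Finset.sum_nonneg fun k _ => add_nonneg (hC₁ k) (hC₂ k))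

end FlatDecay

end AbelianCoulomb

end

noncomputable section

namespace AbelianCoulomb

/-! ### Holomorphic weights on affine subspaces -/

section Weight

open MeasureTheory Filter
open scoped RealInnerProductSpace

variable {d : ℕ}

theorem IsTame.comp_add_coe {V : Type*} [NormedAddCommGroup V] [InnerProductSpace ℝ V]
    {B : V → ℂ} (h : IsTame B) (z₀ : V) (W : Submodule ℝ V) :
    IsTame fun v : W => B (z₀ + (v : V)) := by
  refine ⟨h.1.comp (by fun_prop), fun ε hε => ?_⟩
  obtain ⟨M, hM⟩ := h.2 ε hε
  have hM0 : 0 ≤ M := by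
    have := (norm_nonneg _).trans (hM 0)
    simpa using this
  refine ⟨M * Real.exp (ε * ‖z₀‖), fun v => (hM _).trans ?_⟩
  rw [mul_assoc, ← Real.exp_add]
  refine mul_le_mul_of_nonneg_left (Real.exp_le_exp.2 ?_) hM0
  rw [← mul_add]
  exact mul_le_mul_of_nonneg_left (norm_add_le z₀ (v : V)) hε.le

/-- The functional `t ↦ 2πi ∑ t_k z_k` on a subspace, as a function of `z`. -/
def phaseFunctional (W : Submodule ℝ (EuclideanSpace ℝ (Fin d))) :
    W →L[ℝ] ((Fin d → ℂ) →L[ℂ] ℂ) :=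
  ∑ k, ((EuclideanSpace.proj k : EuclideanSpace ℝ (Fin d) →L[ℝ] ℝ).comp W.subtypeL).smulRight
    ((2 * Real.pi * Complex.I) • (ContinuousLinearMap.proj k : (Fin d → ℂ) →L[ℂ] ℂ))

theorem phaseFunctional_apply (W : Submodule ℝ (EuclideanSpace ℝ (Fin d))) (t : W) (z : Fin d → ℂ) :
    phaseFunctional W t z =
      2 * Real.pi * Complex.I * ∑ k, ((t : EuclideanSpace ℝ (Fin d)) k : ℂ) * z k := by
  simp only [phaseFunctional, sum_apply, ContinuousLinearMap.smulRight_apply,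
    ContinuousLinearMap.comp_apply, smul_apply, ContinuousLinearMap.proj_apply, smul_eq_mul,
    Complex.real_smul, Submodule.subtypeL_apply, PiLp.proj_apply, Finset.mul_sum]
  exact Finset.sum_congr rfl fun k _ => by ring

theorem phaseFunctional_complexPoint (W : Submodule ℝ (EuclideanSpace ℝ (Fin d))) (t : W)
    (x y : EuclideanSpace ℝ (Fin d)) : phaseFunctional W t (complexPoint x y) =
      2 * Real.pi * Complex.I * ((⟪(t : EuclideanSpace ℝ (Fin d)), x⟫ : ℂ) +
        Complex.I * (⟪(t : EuclideanSpace ℝ (Fin d)), y⟫ : ℂ)) := by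
  rw [phaseFunctional_apply]
  simp only [complexPoint, PiLp.inner_apply, RCLike.inner_apply, conj_trivial]
  push_cast
  rw [Finset.mul_sum Finset.univ _ Complex.I, ← Finset.sum_add_distrib]
  congr 1
  exact Finset.sum_congr rfl fun k _ => by ring

/-- A measure with exponential moments and exponentially decaying transform on an affine subspace is
integration against a holomorphic weight without poles. -/
theorem exists_isWeight {U : AffineSubspace ℝ (EuclideanSpace ℝ (Fin d))}
    {z₀ : EuclideanSpace ℝ (Fin d)} (hz₀ : z₀ ∈ U) {m : Measure U.direction} [IsFiniteMeasure m]
    {c : ℝ} (hc : 0 < c) (hmc : Integrable (fun v => Real.exp (c * ‖v‖)) m)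
    (h : HasDecay m fun _ => 1) :
    ∃ w : (Fin d → ℂ) → ℂ, IsWeight U w 0 ∧ ∀ R : MvPolynomial (Fin d) ℂ,
      HasContourIntegral U w 0 R (∫ v : U.direction, imagEval (z₀ + (v : EuclideanSpace ℝ (Fin d))) R ∂m) := by
  obtain ⟨hac, hdens, κ, hκ, hint, C, c', hc', hbound⟩ := h.exists_density hc hmc
  have hπ := Real.pi_pos
  -- The extra phase recentres at the base point `z₀`, so that `w(z)` is the inversion integral at
  -- `z - z₀`.
  set f : U.direction → ℂ := fun t => fourierMeasure m t *
    Complex.exp (-phaseFunctional U.direction t (complexPoint z₀ 0)) with hf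
  have hfnorm : ∀ t, ‖f t‖ = ‖fourierMeasure m t‖ := by
    intro t
    rw [hf, norm_mul, phaseFunctional_complexPoint, Complex.norm_exp]
    simp
  set w : (Fin d → ℂ) → ℂ := fun z => ∫ t, f t * Complex.exp (phaseFunctional U.direction t z) with hw
  have hw' : ∀ x y : U.direction, w (complexPoint (z₀ + x) y) = holomorphicDensity m x y := by
    intro x y
    refine integral_congr_ae (ae_of_all _ fun t => ?_)
    simp only [hf]
    rw [mul_assoc, ← Complex.exp_add, phaseFunctional_complexPoint, phaseFunctional_complexPoint,
      inner_add_right, inner_zero_right, Submodule.coe_inner, Submodule.coe_inner]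
    push_cast
    ring_nf
  have hdiff : DifferentiableOn ℂ w
      {z | 2 * Real.pi * ‖WithLp.toLp 2 fun k => (z k).im‖ < Real.pi * κ} := by
    refine differentiableOn_integral_mul_cexp (X := U.direction) (E := Fin d → ℂ) volume f ?_
      (Real.pi * κ) ?_ (phaseFunctional U.direction)
      (fun z => 2 * Real.pi * ‖WithLp.toLp 2 fun k => (z k).im‖) ?_ ?_
    · refine (measurable_fourierMeasure m).aestronglyMeasurable.mul
        (Continuous.aestronglyMeasurable ?_)
      fun_prop
    · simpa only [hfnorm] using hint
    · refine continuous_const.mul (Continuous.norm ?_)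
      exact (PiLp.continuous_toLp 2 _).comp
        (continuous_pi fun k => Complex.continuous_im.comp (continuous_apply k))
    · intro t z
      have h1 : (phaseFunctional U.direction t z).re =
          -(2 * Real.pi * ⟪(t : EuclideanSpace ℝ (Fin d)), WithLp.toLp 2 fun k => (z k).im⟫) := by
        rw [phaseFunctional_apply]
        simp [PiLp.inner_apply, mul_comm]
      rw [h1, ← mul_neg]
      refine (mul_le_mul_of_nonneg_left ((neg_le_abs _).trans (abs_real_inner_le_norm _ _))
        (by positivity)).trans_eq ?_
      rw [Submodule.coe_norm, mul_comm ‖(t : EuclideanSpace ℝ (Fin d))‖]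
      ring
  -- No polar hyperplanes, so `g = w` and the zero vector is admissible as `v`; the contour
  -- integrals then do not depend on `ε`.
  refine ⟨w, ⟨Submodule.zero_mem _, ∅, by simp, by simp, κ / 2, by positivity, w, ?_, ?_, ?_⟩, ?_⟩
  · refine hdiff.mono ?_
    rintro z ⟨x, -, y, -, hy, rfl⟩
    have h1 : (WithLp.toLp 2 fun k => (complexPoint x y k).im) = y := by
      ext k
      simp [complexPoint]
    rw [Set.mem_ofPred_eq, h1]
    nlinarith
  · refine ⟨C * Real.exp (c' * ‖z₀‖), c', hc', fun x hx y hy hyκ => ?_⟩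
    have hx' : x - z₀ ∈ U.direction := AffineSubspace.vsub_mem_direction hx hz₀
    have h1 := hbound ⟨x - z₀, hx'⟩ ⟨y, hy⟩ hyκ
    rw [← hw', add_sub_cancel] at h1
    refine h1.trans ?_
    have hC : 0 ≤ C := by
      have := (norm_nonneg _).trans (hbound 0 0 (by simpa using hκ))
      simpa using this
    rw [mul_assoc, ← Real.exp_add]
    refine mul_le_mul_of_nonneg_left (Real.exp_le_exp.2 ?_) hC
    have h2 : ‖x‖ ≤ ‖x - z₀‖ + ‖z₀‖ := norm_le_norm_sub_add x z₀
    have h3 : c' * ‖x‖ ≤ c' * (‖x - z₀‖ + ‖z₀‖) := mul_le_mul_of_nonneg_left h2 hc'.le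
    have h4 : ‖(⟨x - z₀, hx'⟩ : U.direction)‖ = ‖x - z₀‖ := rfl
    rw [h4]
    linarith
  · intro z _ _
    simp
  · intro R
    have htame : IsTame fun v : U.direction =>
        imagEval (z₀ + (v : EuclideanSpace ℝ (Fin d))) R := (isTame_imagEval R).comp_add_coe z₀ _
    have hRint : Integrable (fun v : U.direction =>
        imagEval (z₀ + (v : EuclideanSpace ℝ (Fin d))) R) m := by
      simpa [twist] using htame.integrable hmc 0 0 (by simpa using hc)
    have hcongr : ∀ ε : ℝ, (fun u : U.direction => MvPolynomial.eval (fun k => Complex.I *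
        complexPoint (z₀ + (u : EuclideanSpace ℝ (Fin d))) (ε • 0) k) R *
        w (complexPoint (z₀ + (u : EuclideanSpace ℝ (Fin d))) (ε • 0))) =ᵐ[volume]
        fun u => (m.rnDeriv volume u).toReal • imagEval (z₀ + (u : EuclideanSpace ℝ (Fin d))) R := by
      intro ε
      filter_upwards [hdens] with u hu
      have h1 := hw' u 0
      rw [Submodule.coe_zero] at h1
      rw [smul_zero, h1, ← hu, Complex.real_smul, mul_comm]
      congr 1
      simp [imagEval, complexPoint]
    refine ⟨z₀, hz₀, Eventually.of_forall fun ε => ?_, ?_⟩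
    · exact ((integrable_rnDeriv_smul_iff hac).2 hRint).congr (hcongr ε).symm
    · refine tendsto_const_nhds.congr fun ε => ?_
      rw [← integral_rnDeriv_smul hac]
      exact (integral_congr_ae (hcongr ε)).symm

end Weight

end AbelianCoulomb

end

noncomputable section

namespace AbelianCoulomb

/-! ### Strata -/

section Stratum

open MeasureTheory Filter Finset
open scoped RealInnerProductSpace

variable {d n : ℕ} {ξ : Fin n → Fin d → ℤ} {b : Fin n → ℂ}

/-- The points `z` for which exactly the weights `ξ i + b i` with `i ∈ I` are real at `i z`. -/
def stratum (ξ : Fin n → Fin d → ℤ) (b : Fin n → ℂ) (I : Finset (Fin n)) :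
    Set (EuclideanSpace ℝ (Fin d)) :=
  {z | ∀ i, ⟪latticeVector (ξ i), z⟫ = -(b i).im ↔ i ∈ I}

theorem stratum_subset (I : Finset (Fin n)) :
    stratum ξ b I ⊆ (weightFlat ξ b I : Set (EuclideanSpace ℝ (Fin d))) :=
  fun _ hz i hi => (hz i).2 hi

theorem measurableSet_stratum (I : Finset (Fin n)) : MeasurableSet (stratum ξ b I) := by
  have : stratum ξ b I = ⋂ i, {z | ⟪latticeVector (ξ i), z⟫ = -(b i).im ↔ i ∈ I} := by
    ext z
    simp [stratum]
  rw [this]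
  refine MeasurableSet.iInter fun i => ?_
  have hm : MeasurableSet {z : EuclideanSpace ℝ (Fin d) | ⟪latticeVector (ξ i), z⟫ = -(b i).im} :=
    (isClosed_eq (by fun_prop) continuous_const).measurableSet
  by_cases hi : i ∈ I
  · simpa [hi] using hm
  · simp only [hi, iff_false]
    exact hm.compl

/-- The linear factors of the structure constants. -/
theorem exists_imagEval_descent (l : Fin d → ℤ) :
    ∃ K : Fin n → Finset ℤ, (∀ i, pairing (ξ i) l = 0 → K i = ∅) ∧
      ∀ z, imagEval z (descent ξ b l) = ∏ i, ∏ k ∈ K i,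
        (Complex.I * (⟪latticeVector (ξ i), z⟫ : ℂ) + (b i + ((k : ℂ) + 1 / 2))) := by
  refine ⟨fun i => between 0 (-pairing (ξ i) l) ∩
    between (-pairing (ξ i) l) (-pairing (ξ i) l + pairing (ξ i) l), fun i hi => ?_, fun z => ?_⟩
  · simp [hi, between]
  · simp only [descent_eq, factor_eq, map_prod, map_add, imagEval_C, imagEval_linearForm, add_assoc]

/-- The imaginary part of a factor attached to `ξ_i` is `⟨ξ_i, z⟩ + Im b_i`, and the factors of
`D_l` come only from weights outside `I`. -/
theorem imagEval_descent_ne_zero {I : Finset (Fin n)} {z : EuclideanSpace ℝ (Fin d)}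
    (hz : z ∈ stratum ξ b I) {l : Fin d → ℤ} (hl : ∀ i ∈ I, pairing (ξ i) l = 0) :
    imagEval z (descent ξ b l) ≠ 0 := by
  obtain ⟨K, hK, h⟩ := exists_imagEval_descent (ξ := ξ) (b := b) l
  rw [h]
  refine Finset.prod_ne_zero_iff.2 fun i _ => Finset.prod_ne_zero_iff.2 fun k hk h0 => ?_
  have hi : i ∉ I := fun hi => by
    rw [hK i (hl i hi)] at hk
    exact absurd hk (Finset.notMem_empty k)
  refine hi ((hz i).1 ?_)
  have h1 := congrArg Complex.im h0
  simp at h1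
  linarith

/-- The structure constants attached to directions of the flat are strippable on the flat, and so
are their conjugates. -/
theorem isStrippable_descent {W : Submodule ℝ (EuclideanSpace ℝ (Fin d))} {m : Measure W}
    [IsFiniteMeasure m] (hm : m ≪ volume) {c : ℝ} (hc : 0 < c)
    (hmc : Integrable (fun v => Real.exp (c * ‖v‖)) m) (z₀ : EuclideanSpace ℝ (Fin d))
    {l : Fin d → ℤ} (hl : latticeVector l ∈ W) (σ : ℂ →+* ℂ) (hσ : ∀ r : ℝ, σ r = r) :
    IsStrippable m fun v : W =>
      σ (imagEval (z₀ + (v : EuclideanSpace ℝ (Fin d))) (descent ξ b l)) := by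
  obtain ⟨K, hK, h⟩ := exists_imagEval_descent (ξ := ξ) (b := b) l
  simp only [h, map_prod]
  refine isStrippable_prod _ _ fun i _ => isStrippable_prod _ _ fun k hk => ?_
  have hi : pairing (ξ i) l ≠ 0 := fun hi => by
    rw [hK i hi] at hk
    exact absurd hk (Finset.notMem_empty k)
  -- The restriction of `ξ_i` to `W` as a vector of `W`. It is nonzero because `ξ_i(l) ≠ 0` and `l`
  -- lies in `W`.
  set α : W := W.orthogonalProjectionOnto (latticeVector (ξ i)) with hα
  have hinner : ∀ v : W, ⟪α, v⟫ = ⟪latticeVector (ξ i), (v : EuclideanSpace ℝ (Fin d))⟫ := fun v =>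
    W.inner_orthogonalProjectionOnto_eq_of_mem_right v _
  have hα0 : α ≠ 0 := by
    intro h0
    have h1 := hinner ⟨latticeVector l, hl⟩
    rw [h0, inner_zero_left, inner_latticeVector] at h1
    exact hi (by exact_mod_cast h1.symm)
  set s : ℂ := -(⟪latticeVector (ξ i), z₀⟫ : ℂ) + Complex.I * (b i + ((k : ℂ) + 1 / 2)) with hs
  have hσI : σ Complex.I ≠ 0 := (map_ne_zero σ).2 Complex.I_ne_zero
  convert (isStrippable_const (m := m) hσI).mul
    (isStrippable_affine hm hc hmc hα0 (σ s)) using 2 with v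
  rw [hinner, ← hσ ⟪latticeVector (ξ i), (v : EuclideanSpace ℝ (Fin d))⟫, ← map_sub, ← map_mul,
    inner_add_right]
  congr 1
  rw [hs]
  push_cast
  linear_combination (b i + ((k : ℂ) + 1 / 2)) * Complex.I_sq

/-- The points of the flat outside of the stratum are negligible. -/
theorem volume_compl_stratum {I : Finset (Fin n)} {z₀ : EuclideanSpace ℝ (Fin d)}
    (hz₀ : z₀ ∈ stratum ξ b I) :
    volume {v : (weightFlat ξ b I).direction |
      z₀ + (v : EuclideanSpace ℝ (Fin d)) ∉ stratum ξ b I} = 0 := by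
  set W := (weightFlat ξ b I).direction with hW
  -- The complement is covered by the subspaces where a further weight becomes real. They are proper
  -- since `z₀` avoids them.
  set A : Fin n → AffineSubspace ℝ W := fun i =>
    flat (fun _ : Unit => W.orthogonalProjectionOnto (latticeVector (ξ i)))
      (fun _ => -(b i).im - ⟪latticeVector (ξ i), z₀⟫) {()} with hA
  have hmem : ∀ i (v : W), v ∈ A i ↔
      ⟪latticeVector (ξ i), z₀ + (v : EuclideanSpace ℝ (Fin d))⟫ = -(b i).im := by
    intro i v
    simp only [hA, mem_flat, Finset.mem_singleton]
    rw [W.inner_orthogonalProjectionOnto_eq_of_mem_right, inner_add_right, eq_sub_iff_add_eq']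
    exact ⟨fun h => h () trivial, fun h _ _ => h⟩
  have hsub : {v : W | z₀ + (v : EuclideanSpace ℝ (Fin d)) ∉ stratum ξ b I} ⊆
      ⋃ i ∈ Iᶜ, (A i : Set W) := by
    intro v hv
    have hv' : ¬ ∀ i, ⟪latticeVector (ξ i), z₀ + (v : EuclideanSpace ℝ (Fin d))⟫ = -(b i).im ↔
      i ∈ I := hv
    push Not at hv'
    obtain ⟨i, hi⟩ := hv'
    rcases hi with ⟨h1, h2⟩ | ⟨h1, h2⟩
    · simp only [Set.mem_iUnion]
      exact ⟨i, Finset.mem_compl.2 h2, (hmem i v).2 h1⟩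
    · refine absurd ?_ h1
      rw [inner_add_right, (hz₀ i).2 h2,
        (mem_direction_flat (stratum_subset I hz₀) _).1 v.2 i h2, add_zero]
  refine measure_mono_null hsub ((measure_biUnion_null_iff (Finset.countable_toSet _)).2
    fun i hi => ?_)
  refine Measure.addHaar_affineSubspace _ _ fun htop => ?_
  have h0 : (0 : W) ∈ A i := by
    rw [htop]
    exact AffineSubspace.mem_top _ _ _
  rw [hmem, Submodule.coe_zero, add_zero] at h0
  exact Finset.mem_compl.1 hi ((hz₀ i).1 h0)

variable {μ : Measure (EuclideanSpace ℝ (Fin d))} {c : ℝ}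

/-- The restriction of the measure of a positive trace to a stratum has a holomorphic weight. -/
theorem exists_isWeight_stratum [IsFiniteMeasure μ]
    (hμ : Integrable (fun z => Real.exp (c * ‖z‖)) μ) (hc : 0 < c) {χ : (Fin d → ℤ) → ℂ}
    (h : ∀ l, ShiftRelation μ c l (descent ξ b l) (χ l)) {I : Finset (Fin n)}
    (hI : (stratum ξ b I).Nonempty) :
    ∃ w : (Fin d → ℂ) → ℂ, IsWeight (weightFlat ξ b I) w 0 ∧ ∀ R : MvPolynomial (Fin d) ℂ,
      HasContourIntegral (weightFlat ξ b I) w 0 R (∫ z in stratum ξ b I, imagEval z R ∂μ) := by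
  obtain ⟨z₀, hz₀⟩ := hI
  have hz₀' : z₀ ∈ weightFlat ξ b I := stratum_subset I hz₀
  obtain ⟨S, hS, κ, C, hκ, hdecay⟩ := exists_decay_on_flat hμ hc h I
  set U := weightFlat ξ b I with hU
  set W := U.direction with hW
  have hdir : ∀ t, t ∈ W ↔ ∀ i ∈ I, ⟪latticeVector (ξ i), t⟫ = 0 := mem_direction_flat hz₀'
  set π : EuclideanSpace ℝ (Fin d) → W := fun z => W.orthogonalProjectionOnto (z - z₀) with hπ
  have hπc : Continuous π := by fun_prop
  have hπU : ∀ z ∈ U, z₀ + (π z : EuclideanSpace ℝ (Fin d)) = z := by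
    intro z hz
    have h1 : z - z₀ ∈ W := AffineSubspace.vsub_mem_direction hz hz₀'
    have h2 : π z = ⟨z - z₀, h1⟩ := W.orthogonalProjectionOnto_mem_subspace_eq_self ⟨z - z₀, h1⟩
    rw [h2]
    exact add_sub_cancel _ _
  have hUm : MeasurableSet (U : Set (EuclideanSpace ℝ (Fin d))) :=
    (isClosed_flat _ _ _).measurableSet
  -- `μ|_U` transported to the vector space `W` with origin `z₀`; the projection `π` is only used on
  -- `U`, where it is the translation.
  set ν : Measure W := (μ.restrict U).map π with hν
  have hνfin : IsFiniteMeasure ν := Measure.isFiniteMeasure_map _ _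
  have hνc : Integrable (fun v => Real.exp (c * ‖v‖)) ν := by
    rw [hν, integrable_map_measure (Continuous.aestronglyMeasurable (by fun_prop))
      hπc.measurable.aemeasurable]
    refine (hμ.restrict.const_mul (Real.exp (c * ‖z₀‖))).mono'
      (Continuous.aestronglyMeasurable (by fun_prop)) (ae_of_all _ fun z => ?_)
    rw [Function.comp_apply, Real.norm_of_nonneg (Real.exp_pos _).le, ← Real.exp_add]
    refine Real.exp_le_exp.2 ?_
    have h1 : ‖π z‖ ≤ ‖z‖ + ‖z₀‖ :=
      (W.norm_orthogonalProjectionOnto_apply_le _).trans (norm_sub_le _ _)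
    calc c * ‖π z‖ ≤ c * (‖z‖ + ‖z₀‖) := mul_le_mul_of_nonneg_left h1 hc.le
      _ = _ := by ring
  set Q := ∏ l ∈ S, descent ξ b l with hQ
  set p : W → ℂ := fun v => imagEval (z₀ + (v : EuclideanSpace ℝ (Fin d))) Q with hp
  have hptame : IsTame p := (isTame_imagEval Q).comp_add_coe z₀ W
  have hpdecay : HasDecay ν fun v => p v * starRingEnd ℂ (p v) := by
    refine ⟨κ, c / 2, Real.exp (c / 2 * ‖z₀‖) * C, hκ, by positivity, fun t η hη => ?_⟩
    have h1 : (∫ v, p v * starRingEnd ℂ (p v) * twist t η v ∂ν) =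
        twist (t : EuclideanSpace ℝ (Fin d)) η (-z₀) * ∫ z in (U : Set (EuclideanSpace ℝ (Fin d))),
          imagEval z (Q * polyStar Q) * twist (t : EuclideanSpace ℝ (Fin d)) η z ∂μ := by
      have hcont : Continuous fun v => p v * starRingEnd ℂ (p v) * twist t η v :=
        (hptame.1.mul (Complex.continuous_conj.comp hptame.1)).mul (continuous_twist t η)
      rw [hν, integral_map hπc.measurable.aemeasurable hcont.aestronglyMeasurable,
        ← integral_const_mul]
      refine setIntegral_congr_fun hUm fun z hz => ?_
      have h2 : twist t η (π z) = twist (t : EuclideanSpace ℝ (Fin d)) η (-z₀) *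
          twist (t : EuclideanSpace ℝ (Fin d)) η z := by
        have h3 : (π z : EuclideanSpace ℝ (Fin d)) = -z₀ + z := by
          rw [eq_neg_add_iff_add_eq]
          exact hπU z hz
        rw [twist, twist, twist, ← Complex.exp_add, Submodule.coe_inner, Submodule.coe_inner, h3,
          inner_add_right, inner_add_right]
        push_cast
        ring_nf
      simp only [hp, hπU z hz, map_mul, imagEval_polyStar, h2]
      ring
    rw [h1, norm_mul]
    have h2 : ‖twist (t : EuclideanSpace ℝ (Fin d)) η (-z₀)‖ ≤ Real.exp (c / 2 * ‖z₀‖) := by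
      refine (norm_twist_le _ _ _).trans (Real.exp_le_exp.2 ?_)
      rw [norm_neg]
      exact mul_le_mul_of_nonneg_right hη.le (norm_nonneg _)
    refine (mul_le_mul h2 (hdecay t η ((hdir t).1 t.2) hη) (norm_nonneg _)
      (Real.exp_pos _).le).trans_eq ?_
    rw [mul_assoc]
    rfl
  -- The part of the flat that belongs to smaller strata. `μ` may be singular there, and its
  -- contribution is counted on those strata.
  set N : Set W := {v | z₀ + (v : EuclideanSpace ℝ (Fin d)) ∉ stratum ξ b I} with hN
  have hNm : MeasurableSet N :=
    ((by fun_prop : Continuous fun v : W => z₀ + (v : EuclideanSpace ℝ (Fin d))).measurable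
      (measurableSet_stratum I)).compl
  have hN0 : volume N = 0 := volume_compl_stratum hz₀
  have hpN : ∀ v ∉ N, p v ≠ 0 := by
    intro v hv
    have hv' : z₀ + (v : EuclideanSpace ℝ (Fin d)) ∈ stratum ξ b I := not_not.1 hv
    simp only [hp, hQ, map_prod]
    exact Finset.prod_ne_zero_iff.2 fun l hl => imagEval_descent_ne_zero hv' (hS l hl)
  obtain ⟨hac, hdec⟩ := hpdecay.restrict_compl hc hνc hptame hNm hN0 hpN
  have hlW : ∀ l ∈ S, latticeVector l ∈ W := by
    intro l hl
    rw [hdir]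
    intro i hi
    rw [inner_latticeVector, hS l hl i hi, Int.cast_zero]
  have hstrip : IsStrippable (ν.restrict Nᶜ) fun v => p v * starRingEnd ℂ (p v) := by
    refine IsStrippable.mul ?_ ?_
    · simp only [hp, hQ, map_prod]
      exact isStrippable_prod _ _ fun l hl =>
        isStrippable_descent hac hc hνc.restrict z₀ (hlW l hl) (RingHom.id ℂ) fun r => rfl
    · simp only [hp, hQ, map_prod]
      exact isStrippable_prod _ _ fun l hl =>
        isStrippable_descent hac hc hνc.restrict z₀ (hlW l hl) (starRingEnd ℂ) Complex.conj_ofReal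
  -- Dividing out all affine factors of `|Q|²` leaves decay of the transform of the measure itself.
  have hone : HasDecay (ν.restrict Nᶜ) fun _ => 1 :=
    hstrip.2 _ (isTame_const 1) (by simpa only [mul_one] using hdec)
  obtain ⟨w, hw, hint⟩ := exists_isWeight hz₀' hc hνc.restrict hone
  refine ⟨w, hw, fun R => ?_⟩
  have hset : π ⁻¹' Nᶜ ∩ (U : Set (EuclideanSpace ℝ (Fin d))) = stratum ξ b I := by
    ext z
    constructor
    · rintro ⟨h1, h2⟩
      have h3 : z₀ + (π z : EuclideanSpace ℝ (Fin d)) ∈ stratum ξ b I := not_not.1 h1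
      rwa [hπU z h2] at h3
    · intro hz
      have h2 : z ∈ U := stratum_subset I hz
      refine ⟨?_, h2⟩
      have h3 : z₀ + (π z : EuclideanSpace ℝ (Fin d)) ∈ stratum ξ b I := by rwa [hπU z h2]
      exact not_not.2 h3
  have hR := hint R
  rw [hν, setIntegral_map hNm.compl ((isTame_imagEval R).comp_add_coe z₀ W).1.aestronglyMeasurable
    hπc.measurable.aemeasurable, Measure.restrict_restrict (hπc.measurable hNm.compl), hset,
    setIntegral_congr_fun (g := fun z => imagEval z R) (measurableSet_stratum I)
      fun z hz => by simp only [hπU z (stratum_subset I hz)]] at hR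
  exact hR

/-- The integral of a polynomial is the sum of the integrals over the strata. -/
theorem integral_eq_sum_stratum [DecidablePred fun I => (stratum ξ b I).Nonempty]
    (hμ : Integrable (fun z => Real.exp (c * ‖z‖)) μ) (hc : 0 < c) (R : MvPolynomial (Fin d) ℂ) :
    ∫ z, imagEval z R ∂μ =
      ∑ I ∈ univ.filter fun I => (stratum ξ b I).Nonempty, ∫ z in stratum ξ b I, imagEval z R ∂μ := by
  classical
  have hi : Integrable (fun z => imagEval z R) μ := by
    simpa [twist] using (isTame_imagEval R).integrable hμ 0 0 (by simpa using hc)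
  rw [Finset.sum_filter_of_ne fun I _ h0 => ?_, ← integral_iUnion_fintype
    (fun I => measurableSet_stratum I) ?_ fun I => hi.integrableOn]
  · have : (⋃ I, stratum ξ b I) = Set.univ := by
      refine Set.eq_univ_of_forall fun z => Set.mem_iUnion.2
        ⟨univ.filter fun i => ⟪latticeVector (ξ i), z⟫ = -(b i).im, fun i => ?_⟩
      simp
    rw [this, Measure.restrict_univ]
  · intro I J hIJ
    refine Set.disjoint_left.2 fun z hz hz' => hIJ ?_
    ext i
    rw [← hz i, ← hz' i]
  · by_contra hne
    rw [Set.not_nonempty_iff_eq_empty] at hne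
    simp [hne] at h0

/-- The set of weights which are real on a subspace. -/
def realWeights (ξ : Fin n → Fin d → ℤ) (b : Fin n → ℂ)
    (U : AffineSubspace ℝ (EuclideanSpace ℝ (Fin d))) : Finset (Fin n) := by
  classical exact univ.filter fun i => ∀ z ∈ U, ⟪latticeVector (ξ i), z⟫ = -(b i).im

/-- A flat with nonempty stratum determines its index set, so distinct strata have distinct flats,
and data attached to `I` become functions of the subspace. -/
theorem realWeights_weightFlat {I : Finset (Fin n)} (hI : (stratum ξ b I).Nonempty) :
    realWeights ξ b (weightFlat ξ b I) = I := by
  obtain ⟨z₀, hz₀⟩ := hI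
  ext i
  simp only [realWeights, Finset.mem_filter, Finset.mem_univ, true_and]
  exact ⟨fun h => (hz₀ i).1 (h z₀ (stratum_subset I hz₀)), fun hi z hz => hz i hi⟩

end Stratum

end AbelianCoulomb

end

/-! ### Summation over the strata. -/

open AbelianCoulomb in
theorem corollary4p4 {d n : ℕ} (ξ : Fin n → Fin d → ℤ) (b : Fin n → ℂ)
    (ρ : CoulombBranch ξ b ≃+* CoulombBranch ξ b) (hρ : IsAdmissible ρ)
    (T : CoulombBranch ξ b →ₗ[ℂ] ℂ) (hT : IsPositiveTrace ρ T) :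
    ∃ (s : Finset (AffineSubspace ℝ (EuclideanSpace ℝ (Fin d))))
      (w : AffineSubspace ℝ (EuclideanSpace ℝ (Fin d)) → (Fin d → ℂ) → ℂ)
      (v : AffineSubspace ℝ (EuclideanSpace ℝ (Fin d)) → EuclideanSpace ℝ (Fin d)),
      (∀ U ∈ s, (U : Set (EuclideanSpace ℝ (Fin d))).Nonempty ∧ IsWeight U (w U) (v U)) ∧
      ∀ R : MvPolynomial (Fin d) ℂ,
        ∃ I : AffineSubspace ℝ (EuclideanSpace ℝ (Fin d)) → ℂ,
          (∀ U ∈ s, HasContourIntegral U (w U) (v U) R (I U)) ∧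
          T (ofPoly ξ b R) = ∑ U ∈ s, I U := by
  classical
  obtain ⟨μ, c, χ, hμ, hc, hμc, hint, hrel⟩ := exists_trace_measure hρ hT
  have hstratum : ∀ J : Finset (Fin n), ∃ w : (Fin d → ℂ) → ℂ, (stratum ξ b J).Nonempty →
      IsWeight (weightFlat ξ b J) w 0 ∧ ∀ R : MvPolynomial (Fin d) ℂ, HasContourIntegral
        (weightFlat ξ b J) w 0 R (∫ z in stratum ξ b J, imagEval z R ∂μ) := by
    intro J
    by_cases hJ : (stratum ξ b J).Nonempty
    · obtain ⟨w, hw⟩ := exists_isWeight_stratum hμc hc hrel hJ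
      exact ⟨w, fun _ => hw⟩
    · exact ⟨0, fun h => absurd h hJ⟩
  choose w hw using hstratum
  refine ⟨(Finset.univ.filter fun J => (stratum ξ b J).Nonempty).image (weightFlat ξ b),
    fun U => w (realWeights ξ b U), fun _ => 0, fun U hU => ?_, fun R =>
    ⟨fun U => ∫ z in stratum ξ b (realWeights ξ b U), imagEval z R ∂μ, fun U hU => ?_, ?_⟩⟩
  · obtain ⟨J, hJ, rfl⟩ := Finset.mem_image.1 hU
    have hJ' := (Finset.mem_filter.1 hJ).2
    refine ⟨hJ'.mono (stratum_subset J), ?_⟩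
    beta_reduce
    rw [realWeights_weightFlat hJ']
    exact (hw J hJ').1
  · obtain ⟨J, hJ, rfl⟩ := Finset.mem_image.1 hU
    have hJ' := (Finset.mem_filter.1 hJ).2
    beta_reduce
    rw [realWeights_weightFlat hJ']
    exact (hw J hJ').2 R
  · rw [hint, integral_eq_sum_stratum (ξ := ξ) (b := b) hμc hc, Finset.sum_image]
    · refine Finset.sum_congr rfl fun J hJ => ?_
      rw [realWeights_weightFlat (Finset.mem_filter.1 hJ).2]
    · intro J hJ J' hJ' h
      rw [← realWeights_weightFlat (Finset.mem_filter.1 hJ).2, h,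
        realWeights_weightFlat (Finset.mem_filter.1 hJ').2]
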